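/- For every $\varepsilon>0$ there are a decoding program $P$ for the real RAM, a constant $T$ (depending only on $\varepsilon$), and, for all $K,n$, a random measurement matrix $A\in\mathbb{C}^{m\times n}$ with $m=m(K)$ and $m\le 6K(1+\varepsilon)-2$ for $K\ge 1$, whose law does not depend on the signal, such that the following holds. For every $\delta>0$ there is $K_0$ such that for all $K\ge K_0$, all $n\ge K$ and every fixed signal $x\in\mathbb{C}^n$ with at most $K$ non-zero components, with probability at least $1-\delta$ over $A$, the program $P$, given $K,n,m$, $A$ and the magnitudes $|a_1x|,\dots,|a_mx|$ (where $a_i$ is the $i$-th row of $A$), halts after at most $T\cdot K$ steps and outputs exactly $\varphi x$ for some $\varphi\in\mathbb{C}$ with $|\varphi|=1$ (as a list of positions and complex values). The order $O(K)$ of the running time is optimal: a program which, for some matrix $A$, recovers a signal with exactly $K$ non-zero components up to a global phase in this way makes at least $K$ steps. Here the real RAM computes with exact real numbers and with words of $O(\log(K+n+m))$ bits. The four arithmetic operations on reals or on words, comparisons, truncation of a real number to a word, memory accesses by address, and accesses to the input (a magnitude, an entry of $A$, or the position of the $k$-th non-zero entry of a column of $A$) take unit time each. -/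

import Mathlib

open scoped Matrix

namespace PhaseRetrieval

noncomputable section

/-- The Borel (product) sigma-algebra on complex matrices. -/
instance matrixMeasurableSpace (m n : ℕ) : MeasurableSpace (Matrix (Fin m) (Fin n) ℂ) :=
  inferInstanceAs (MeasurableSpace (Fin m → Fin n → ℂ))

/-- The magnitudes `|a_i x|` of the linear measurements of `x` with the rows `a_i` of `A`. -/
def magnitudes {m n : ℕ} (A : Matrix (Fin m) (Fin n) ℂ) (x : Fin n → ℂ) : Fin m → ℝ :=
  fun i => ‖(A *ᵥ x) i‖

open Classical in
/-- The number of non-zero components of `x`. -/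
def numNonzero {n : ℕ} (x : Fin n → ℂ) : ℕ :=
  (Finset.univ.filter fun j => x j ≠ 0).card

/-! ### The machine: a real RAM

The machine has words (natural numbers of `O(log)` bits) and exact real numbers, each kind stored in
finitely many arrays with random access.  Programs are finite and do not depend on the size of the
input.  Every operation on words or reals, every memory access, every access to the input and every
test has unit cost. -/

/-- The read-only input of the decoder: the parameters, the measurement matrix and the measured
magnitudes. -/
structure Input where
  K : ℕ
  n : ℕ
  m : ℕ
  A : Matrix (Fin m) (Fin n) ℂ
  y : Fin m → ℝ

/-- The entry of the matrix at `(i, j)`, and `0` out of range. -/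
def Input.entry (I : Input) (i j : ℕ) : ℂ :=
  if h : i < I.m ∧ j < I.n then I.A ⟨i, h.1⟩ ⟨j, h.2⟩ else 0

/-- The `i`-th measured magnitude, and `0` out of range. -/
def Input.meas (I : Input) (i : ℕ) : ℝ :=
  if h : i < I.m then I.y ⟨i, h⟩ else 0

open Classical in
/-- The matrix is stored by sparse columns: this is the row of the `k`-th non-zero entry (counted
from `0`, from top to bottom) in column `j`, and the end mark `m` if there is none. -/
def Input.colRow (I : Input) (j k : ℕ) : ℕ :=
  ((List.range I.m).filter fun i => I.entry i j ≠ 0).getD k I.m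

/-- The read-write memory: `nat a i` and `real a i` are the cells with address `i` of the arrays
with name `a`. -/
structure State where
  nat : ℕ → ℕ → ℕ
  real : ℕ → ℕ → ℝ

/-- The memory before the run. -/
def State.init : State where
  nat := fun _ _ => 0
  real := fun _ _ => 0

/-- The memory after `v` has been written into the cell `i` of the word array `a`. -/
def State.setNat (s : State) (a i v : ℕ) : State :=
  { s with nat := fun b j => if b = a ∧ j = i then v else s.nat b j }

/-- The memory after `v` has been written into the cell `i` of the real array `a`. -/
def State.setReal (s : State) (a i : ℕ) (v : ℝ) : State :=
  { s with real := fun b j => if b = a ∧ j = i then v else s.real b j }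

/-- Expressions with values in the words. -/
inductive NExpr where
  | const (c : ℕ)
  | paramK
  | paramN
  | paramM
  | load (a : ℕ) (i : NExpr)
  | colRow (j k : NExpr)
  | add (e f : NExpr)
  | sub (e f : NExpr)
  | mul (e f : NExpr)
  | div (e f : NExpr)

/-- Expressions with values in the reals. -/
inductive RExpr where
  | const (q : ℚ)
  | ofNat (e : NExpr)
  | load (a : ℕ) (i : NExpr)
  | meas (i : NExpr)
  | entryRe (i j : NExpr)
  | entryIm (i j : NExpr)
  | add (e f : RExpr)
  | sub (e f : RExpr)
  | mul (e f : RExpr)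
  | div (e f : RExpr)

/-- Tests. -/
inductive Test where
  | natLt (e f : NExpr)
  | natEq (e f : NExpr)
  | realLt (e f : RExpr)
  | realEq (e f : RExpr)
  | not (b : Test)
  | and (b c : Test)

def NExpr.eval (I : Input) (s : State) : NExpr → ℕ
  | const c => c
  | paramK => I.K
  | paramN => I.n
  | paramM => I.m
  | load a i => s.nat a (i.eval I s)
  | colRow j k => I.colRow (j.eval I s) (k.eval I s)
  | add e f => e.eval I s + f.eval I s
  | sub e f => e.eval I s - f.eval I s
  | mul e f => e.eval I s * f.eval I s
  | div e f => e.eval I s / f.eval I s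

def RExpr.eval (I : Input) (s : State) : RExpr → ℝ
  | const q => (q : ℝ)
  | ofNat e => (e.eval I s : ℝ)
  | load a i => s.real a (i.eval I s)
  | meas i => I.meas (i.eval I s)
  | entryRe i j => (I.entry (i.eval I s) (j.eval I s)).re
  | entryIm i j => (I.entry (i.eval I s) (j.eval I s)).im
  | add e f => e.eval I s + f.eval I s
  | sub e f => e.eval I s - f.eval I s
  | mul e f => e.eval I s * f.eval I s
  | div e f => e.eval I s / f.eval I s

def Test.holds (I : Input) (s : State) : Test → Prop
  | natLt e f => e.eval I s < f.eval I s
  | natEq e f => e.eval I s = f.eval I s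
  | realLt e f => e.eval I s < f.eval I s
  | realEq e f => e.eval I s = f.eval I s
  | not b => ¬ b.holds I s
  | and b c => b.holds I s ∧ c.holds I s

/-- The cost of an expression is the number of operations in it. -/
def NExpr.cost : NExpr → ℕ
  | const _ => 1
  | paramK => 1
  | paramN => 1
  | paramM => 1
  | load _ i => i.cost + 1
  | colRow j k => j.cost + k.cost + 1
  | add e f => e.cost + f.cost + 1
  | sub e f => e.cost + f.cost + 1
  | mul e f => e.cost + f.cost + 1
  | div e f => e.cost + f.cost + 1

def RExpr.cost : RExpr → ℕ
  | const _ => 1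
  | ofNat e => e.cost + 1
  | load _ i => i.cost + 1
  | meas i => i.cost + 1
  | entryRe i j => i.cost + j.cost + 1
  | entryIm i j => i.cost + j.cost + 1
  | add e f => e.cost + f.cost + 1
  | sub e f => e.cost + f.cost + 1
  | mul e f => e.cost + f.cost + 1
  | div e f => e.cost + f.cost + 1

def Test.cost : Test → ℕ
  | natLt e f => e.cost + f.cost + 1
  | natEq e f => e.cost + f.cost + 1
  | realLt e f => e.cost + f.cost + 1
  | realEq e f => e.cost + f.cost + 1
  | not b => b.cost + 1
  | and b c => b.cost + c.cost + 1

/-- Programs. `setNat a i e` and `setReal a i e` store the value of `e` in the cell `i` of the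
array `a`; `setFloor a i e` stores the integer part of the real number `e` as a word. -/
inductive Cmd where
  | skip
  | setNat (a : ℕ) (i : NExpr) (e : NExpr)
  | setReal (a : ℕ) (i : NExpr) (e : RExpr)
  | setFloor (a : ℕ) (i : NExpr) (e : RExpr)
  | seq (p q : Cmd)
  | ite (b : Test) (p q : Cmd)
  | while (b : Test) (p : Cmd)

/-- `Exec I W p s t s'`: on input `I`, started in the memory `s`, the program `p` halts after
exactly `t` steps in the memory `s'`.  Stored words saturate at `W`. -/
inductive Exec (I : Input) (W : ℕ) : Cmd → State → ℕ → State → Prop where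
  | skip (s : State) : Exec I W .skip s 1 s
  | setNat (a : ℕ) (i e : NExpr) (s : State) :
      Exec I W (.setNat a i e) s (i.cost + e.cost + 1)
        (s.setNat a (i.eval I s) (min (e.eval I s) W))
  | setReal (a : ℕ) (i : NExpr) (e : RExpr) (s : State) :
      Exec I W (.setReal a i e) s (i.cost + e.cost + 1)
        (s.setReal a (i.eval I s) (e.eval I s))
  | setFloor (a : ℕ) (i : NExpr) (e : RExpr) (s : State) :
      Exec I W (.setFloor a i e) s (i.cost + e.cost + 1)
        (s.setNat a (i.eval I s) (min ⌊e.eval I s⌋₊ W))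
  | seq {p q : Cmd} {s s' s'' : State} {t t' : ℕ} :
      Exec I W p s t s' → Exec I W q s' t' s'' → Exec I W (.seq p q) s (t + t') s''
  | iteTrue {b : Test} {p q : Cmd} {s s' : State} {t : ℕ} :
      b.holds I s → Exec I W p s t s' → Exec I W (.ite b p q) s (b.cost + t) s'
  | iteFalse {b : Test} {p q : Cmd} {s s' : State} {t : ℕ} :
      ¬ b.holds I s → Exec I W q s t s' → Exec I W (.ite b p q) s (b.cost + t) s'
  | whileFalse {b : Test} {p : Cmd} {s : State} :
      ¬ b.holds I s → Exec I W (.while b p) s b.cost s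
  | whileTrue {b : Test} {p : Cmd} {s s' s'' : State} {t t' : ℕ} :
      b.holds I s → Exec I W p s t s' → Exec I W (.while b p) s' t' s'' →
        Exec I W (.while b p) s (b.cost + t + t') s''

/-- The largest word, `(K + n + m + 2) ^ c`: words have `O(log (K + n + m))` bits. -/
def Input.wordBound (I : Input) (c : ℕ) : ℕ := (I.K + I.n + I.m + 2) ^ c

/-- The output is a list of positions with their complex values: cell `0` of word array `0` holds
its length, word array `1` the positions (counted from `0`), and real arrays `0` and `1` the real
and imaginary parts.  This is the vector of length `n` that the list describes. -/
def State.output (s : State) (n : ℕ) : Fin n → ℂ := fun j =>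
  ∑ l ∈ Finset.range (s.nat 0 0),
    if s.nat 1 l = (j : ℕ) then (⟨s.real 0 l, s.real 1 l⟩ : ℂ) else 0

/-- `RecoversIn P c K A x t`: given the sparsity bound `K`, the matrix `A` and the magnitudes
`|A x|`, the program `P` on words of size parameter `c` halts after exactly `t` steps and outputs
`x` up to a global phase. -/
def RecoversIn (P : Cmd) (c K : ℕ) {m n : ℕ} (A : Matrix (Fin m) (Fin n) ℂ) (x : Fin n → ℂ)
    (t : ℕ) : Prop :=
  let I : Input := ⟨K, n, m, A, magnitudes A x⟩
  ∃ s : State, Exec I (I.wordBound c) P State.init t s ∧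
    ∃ φ : ℂ, ‖φ‖ = 1 ∧ s.output n = φ • x

end

end PhaseRetrieval

namespace PhaseRetrieval

noncomputable section

/-! ### The lower bound on the running time -/

/-! Lower bound: one step changes at most one real cell, while an output with `K` non-zero
components needs `K` distinct addresses holding a non-zero value
(`Exec.valueCells_finite_and_ncard_le`, `numNonzero_output_le`).

Upper bound: each linear functional `v` of the signal is measured as `v`, `v + R` and `v + iR`
against one common reference `R`. Polarization then gives `φ v`, where `φ` rotates `R` to the
positive axis (`value_design`). As `φ` is the same for all functionals, the task becomes linear
recovery of `φ x`. The components are multiplied by random integers `u j` from a range so large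
that, with high probability, no non-trivial relation with small integer coefficients holds among the
non-zero `u j * x j`. Hence an equality test between measured values reveals exactly which entries
contribute to them.

Each functional is also taken with the weights `j + 1`. For a sum with a single entry, the quotient
of the two values is the position plus one; by genericity a sum with several entries never passes as
single (`Decodable.eq_singleton`, `decode_spec`).

Positions are hashed into about `K / s₀` groups, with labels below a constant `Q`. A group is
measured by its first `a + 1` power sums in the labels, with `a = s₀ + s₀ / p`. A combination of
these with the coefficients of a polynomial weights each entry by the value of the polynomial at its
label. The polynomial with root set `T` thus detects whether all labels lie in `T`, and dropping the
root `q` isolates the label `q` (`labels_spec`). Trying every `T` of size `a` costs a constant that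
depends on `ε` only. This finds the entries with a label of their own in a group that is not
overloaded. Chebyshev's inequality for collision counts leaves at most `K / (24 p²)` other entries
(`card_hard_le`).

These are found by peeling: four tables of about `K / p` buckets store plain sums. Every entry found
is subtracted from its four buckets, and a bucket left with one entry reveals it. Peeling can stall
only at a set of missing entries that meets no bucket exactly once, and a union bound excludes small
sets of this kind (`card_stopping_le`).

The groups use `K (1 + O(1 / p))` functionals and the tables `O(K / p)`; the position weights double
and polarization triples this, whence the factor `6`. All failure probabilities are `O(1 / K)`, with
constants depending on `ε` only. -/

/-- The addresses at which an output value is non-zero. -/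
def State.valueCells (s : State) : Set ℕ := {l | s.real 0 l ≠ 0 ∨ s.real 1 l ≠ 0}

/-- Only `setReal` can create a new non-zero value, at a single address and at a cost of at least
one. Finiteness is carried along because `ncard` of an infinite set is `0`. -/
theorem Exec.valueCells_finite_and_ncard_le {I : Input} {W : ℕ} {p : Cmd} {s s' : State} {t : ℕ}
    (h : Exec I W p s t s') (hs : s.valueCells.Finite) :
    s'.valueCells.Finite ∧ s'.valueCells.ncard ≤ s.valueCells.ncard + t := by
  induction h with
  | skip s => exact ⟨hs, by omega⟩
  | setNat a i e s => exact ⟨hs, by simp only [State.valueCells, State.setNat]; omega⟩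
  | setFloor a i e s => exact ⟨hs, by simp only [State.valueCells, State.setNat]; omega⟩
  | setReal a i e s =>
    have hsub : (s.setReal a (i.eval I s) (e.eval I s)).valueCells ⊆
        insert (i.eval I s) s.valueCells := by
      intro l hl
      by_cases h : l = i.eval I s
      · exact Or.inl h
      · right
        simpa [State.valueCells, State.setReal, h] using hl
    refine ⟨(hs.insert _).subset hsub, (Set.ncard_le_ncard hsub (hs.insert _)).trans ?_⟩
    have := Set.ncard_insert_le (i.eval I s) s.valueCells
    omega
  | seq _ _ ih₁ ih₂ =>
    obtain ⟨f₁, c₁⟩ := ih₁ hs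
    obtain ⟨f₂, c₂⟩ := ih₂ f₁
    exact ⟨f₂, by omega⟩
  | iteTrue _ _ ih =>
    obtain ⟨f, c⟩ := ih hs
    exact ⟨f, by omega⟩
  | iteFalse _ _ ih =>
    obtain ⟨f, c⟩ := ih hs
    exact ⟨f, by omega⟩
  | whileFalse _ => exact ⟨hs, by omega⟩
  | whileTrue _ _ _ ih₁ ih₂ =>
    obtain ⟨f₁, c₁⟩ := ih₁ hs
    obtain ⟨f₂, c₂⟩ := ih₂ f₁
    exact ⟨f₂, by omega⟩

/-- A non-zero component needs a list entry with a non-zero value, and an entry carries only one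
position, so choosing one entry per component is injective. -/
theorem numNonzero_output_le {s : State} (hs : s.valueCells.Finite) (n : ℕ) :
    numNonzero (s.output n) ≤ s.valueCells.ncard := by
  classical
  have key : ∀ j : Fin n, s.output n j ≠ 0 → ∃ l ∈ s.valueCells, s.nat 1 l = j := by
    intro j hj
    obtain ⟨l, -, hl⟩ := Finset.exists_ne_zero_of_sum_ne_zero hj
    by_cases h : s.nat 1 l = j
    · refine ⟨l, ?_, h⟩
      by_contra hc
      simp only [State.valueCells, Set.mem_ofPred_eq, not_or, not_not] at hc
      simp [h, hc.1, hc.2, Complex.ext_iff] at hl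
    · simp [h] at hl
  choose! f hf hf' using key
  rw [Set.ncard_eq_toFinset_card _ hs]
  refine Finset.card_le_card_of_injOn f ?_ ?_
  · intro j hj
    simpa using hf j (by simpa using hj)
  · intro j hj k hk hjk
    have h1 := hf' j (by simpa using hj)
    have h2 := hf' k (by simpa using hk)
    rw [hjk] at h1
    exact Fin.ext (h1.symm.trans h2)

/-- Writing down a signal with `K` non-zero components takes at least `K` steps. -/
theorem RecoversIn.le_time {P : Cmd} {c K m n : ℕ} {A : Matrix (Fin m) (Fin n) ℂ}
    {x : Fin n → ℂ} {t : ℕ} (hx : numNonzero x = K) (h : RecoversIn P c K A x t) : K ≤ t := by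
  obtain ⟨s, hs, φ, hφ, ho⟩ := h
  have h0 : State.init.valueCells = ∅ := by ext; simp [State.valueCells, State.init]
  obtain ⟨f, hc⟩ := hs.valueCells_finite_and_ncard_le (by rw [h0]; exact Set.finite_empty)
  have hle := numNonzero_output_le f n
  have hφ0 : φ ≠ 0 := by
    rintro rfl
    simp at hφ
  have : numNonzero (s.output n) = numNonzero x := by
    rw [ho]
    simp [numNonzero, hφ0]
  rw [h0, Set.ncard_empty] at hc
  omega

/-! ### Reasoning about programs -/

section Semantics

variable (I : Input) (W : ℕ)

@[simp] theorem State.setNat_nat (s : State) (a i v b j : ℕ) :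
    (s.setNat a i v).nat b j = if b = a ∧ j = i then v else s.nat b j := rfl

@[simp] theorem State.setNat_real (s : State) (a i v : ℕ) : (s.setNat a i v).real = s.real := rfl

@[simp] theorem State.setReal_real (s : State) (a i : ℕ) (v : ℝ) (b j : ℕ) :
    (s.setReal a i v).real b j = if b = a ∧ j = i then v else s.real b j := rfl

@[simp] theorem State.setReal_nat (s : State) (a i : ℕ) (v : ℝ) :
    (s.setReal a i v).nat = s.nat := rfl

/-- Word expressions never read the real arrays, so addresses and counters survive every real
assignment. -/
theorem NExpr.eval_setReal (s : State) (a i : ℕ) (v : ℝ) (e : NExpr) :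
    e.eval I (s.setReal a i v) = e.eval I s := by
  induction e <;> simp [NExpr.eval, *]

/-- Programs without loops. -/
def Cmd.LoopFree : Cmd → Prop
  | .seq p q => p.LoopFree ∧ q.LoopFree
  | .ite _ p q => p.LoopFree ∧ q.LoopFree
  | .while _ _ => False
  | _ => True

open Classical in
/-- The memory after the run of a loop-free program. -/
def Cmd.run : Cmd → State → State
  | .skip, s => s
  | .setNat a i e, s => s.setNat a (i.eval I s) (min (e.eval I s) W)
  | .setReal a i e, s => s.setReal a (i.eval I s) (e.eval I s)
  | .setFloor a i e, s => s.setNat a (i.eval I s) (min ⌊e.eval I s⌋₊ W)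
  | .seq p q, s => q.run (p.run s)
  | .ite b p q, s => if b.holds I s then p.run s else q.run s
  | .while _ _, s => s

/-- A bound on the running time of a loop-free program. -/
def Cmd.bound : Cmd → ℕ
  | .skip => 1
  | .setNat _ i e => i.cost + e.cost + 1
  | .setReal _ i e => i.cost + e.cost + 1
  | .setFloor _ i e => i.cost + e.cost + 1
  | .seq p q => p.bound + q.bound
  | .ite b p q => b.cost + (p.bound + q.bound)
  | .while _ _ => 0

theorem Cmd.LoopFree.exec {p : Cmd} (hp : p.LoopFree) (s : State) :
    ∃ t ≤ p.bound, Exec I W p s t (p.run I W s) := by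
  induction p generalizing s with
  | skip => exact ⟨_, le_rfl, .skip s⟩
  | setNat a i e => exact ⟨_, le_rfl, .setNat a i e s⟩
  | setReal a i e => exact ⟨_, le_rfl, .setReal a i e s⟩
  | setFloor a i e => exact ⟨_, le_rfl, .setFloor a i e s⟩
  | seq p q ihp ihq =>
    obtain ⟨t, ht, h⟩ := ihp hp.1 s
    obtain ⟨t', ht', h'⟩ := ihq hp.2 (p.run I W s)
    exact ⟨t + t', by simp only [Cmd.bound]; omega, .seq h h'⟩
  | ite b p q ihp ihq =>
    by_cases hb : b.holds I s
    · obtain ⟨t, ht, h⟩ := ihp hp.1 s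
      refine ⟨b.cost + t, by simp only [Cmd.bound]; omega, ?_⟩
      simpa [Cmd.run, hb] using Exec.iteTrue hb h
    · obtain ⟨t, ht, h⟩ := ihq hp.2 s
      refine ⟨b.cost + t, by simp only [Cmd.bound]; omega, ?_⟩
      simpa [Cmd.run, hb] using Exec.iteFalse hb h
  | _ => exact hp.elim

/-- The rule for loops: an invariant with a bound on the number of rounds. -/
theorem exec_while {b : Test} {p : Cmd} (hp : p.LoopFree) (N : ℕ) (inv : ℕ → State → Prop)
    (hstep : ∀ i s, inv i s → b.holds I s → inv (i + 1) (p.run I W s))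
    (hN : ∀ i s, inv i s → b.holds I s → i < N) {s : State} (hs : inv 0 s) :
    ∃ t s' i, t ≤ (N + 1) * (b.cost + p.bound) ∧ Exec I W (.while b p) s t s' ∧ inv i s' ∧
      ¬ b.holds I s' := by
  suffices h : ∀ (d i : ℕ) (s : State), N ≤ i + d → inv i s →
      ∃ t s' i, t ≤ (d + 1) * (b.cost + p.bound) ∧ Exec I W (.while b p) s t s' ∧ inv i s' ∧
        ¬ b.holds I s' from h N 0 s (by omega) hs
  intro d
  induction d with
  | zero =>
    intro i s hd hi
    have hb : ¬ b.holds I s := fun hb => by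
      have := hN i s hi hb
      omega
    exact ⟨_, s, i, by omega, .whileFalse hb, hi, hb⟩
  | succ d ih =>
    intro i s hd hi
    by_cases hb : b.holds I s
    · obtain ⟨t, ht, h⟩ := hp.exec I W s
      obtain ⟨t', s', i', ht', h', hi', hb'⟩ := ih (i + 1) _ (by omega) (hstep i s hi hb)
      refine ⟨_, s', i', ?_, .whileTrue hb h h', hi', hb'⟩
      rw [add_mul, one_mul]
      omega
    · refine ⟨_, s, i, ?_, .whileFalse hb, hi, hb⟩
      rw [add_mul, one_mul]
      omega

/-- The programs of a list, one after the other. -/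
def seqList : List Cmd → Cmd
  | [] => .skip
  | p :: ps => .seq p (seqList ps)

theorem loopFree_seqList {ps : List Cmd} (h : ∀ p ∈ ps, p.LoopFree) : (seqList ps).LoopFree := by
  induction ps with
  | nil => trivial
  | cons p ps ih =>
    exact ⟨h p (by simp), ih fun q hq => h q (by simp [hq])⟩

variable {I W}

theorem run_seqList_induction {ps : List Cmd} {inv : State → Prop}
    (h : ∀ p ∈ ps, ∀ s, inv s → inv (p.run I W s)) {s : State} (hs : inv s) :
    inv ((seqList ps).run I W s) := by
  induction ps generalizing s with
  | nil => exact hs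
  | cons p ps ih => exact ih (fun q hq => h q (by simp [hq])) (h p (by simp) s hs)

/-- What one program of a list achieves holds at the end if the others preserve it. -/
theorem run_seqList_of_mem {ps : List Cmd} {inv goal : State → Prop}
    (h : ∀ p ∈ ps, ∀ s, inv s → inv (p.run I W s))
    (hg : ∀ p ∈ ps, ∀ s, inv s → goal s → goal (p.run I W s))
    {p : Cmd} (hp : p ∈ ps) (hpg : ∀ s, inv s → goal (p.run I W s)) {s : State} (hs : inv s) :
    goal ((seqList ps).run I W s) := by
  induction ps generalizing s with
  | nil => simp at hp
  | cons q ps ih =>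
    have h' : ∀ p ∈ ps, ∀ s, inv s → inv (p.run I W s) := fun r hr => h r (by simp [hr])
    have hg' : ∀ p ∈ ps, ∀ s, inv s → goal s → goal (p.run I W s) :=
      fun r hr => hg r (by simp [hr])
    have hq := h q (by simp) s hs
    rcases List.mem_cons.1 hp with rfl | hp
    · exact (run_seqList_induction (inv := fun s => inv s ∧ goal s)
        (fun r hr s hs => ⟨h' r hr s hs.1, hg' r hr s hs.1 hs.2⟩) ⟨hq, hpg s hs⟩).2
    · exact ih h' hg' hp hq

end Semantics

/-! ### The decoding program -/

section Program

/-- A word expression with the value `0`. -/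
abbrev z0 : NExpr := .const 0

/-- The real part of the linear measurement whose magnitudes stand in the rows `i`, `i + 1` and
`i + 2`, relative to the reference measurement in row `0`. -/
def reExpr (i : NExpr) : RExpr :=
  .div (.sub (.sub (.mul (.meas (.add i (.const 1))) (.meas (.add i (.const 1))))
    (.mul (.meas i) (.meas i))) (.mul (.meas z0) (.meas z0)))
    (.mul (.const 2) (.meas z0))

/-- The imaginary part of the same linear measurement. -/
def imExpr (i : NExpr) : RExpr :=
  .div (.sub (.sub (.mul (.meas (.add i (.const 2))) (.meas (.add i (.const 2))))
    (.mul (.meas i) (.meas i))) (.mul (.meas z0) (.meas z0)))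
    (.mul (.const 2) (.meas z0))

/-- The value of the linear measurement that starts in row `i`. -/
def Input.value (I : Input) (i : ℕ) : ℂ :=
  ⟨(I.meas (i + 1) * I.meas (i + 1) - I.meas i * I.meas i - I.meas 0 * I.meas 0) /
      (2 * I.meas 0),
    (I.meas (i + 2) * I.meas (i + 2) - I.meas i * I.meas i - I.meas 0 * I.meas 0) /
      (2 * I.meas 0)⟩

/-- The linear combination `c 0 * E 0 + ... + c (k - 1) * E (k - 1)`. -/
def linComb (c : ℕ → ℤ) (E : ℕ → RExpr) : ℕ → RExpr
  | 0 => .const 0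
  | k + 1 => .add (linComb c E k) (.mul (.const (c k)) (E k))

theorem eval_linComb (I : Input) (s : State) (c : ℕ → ℤ) (E : ℕ → RExpr) (k : ℕ) :
    (linComb c E k).eval I s = ∑ i ∈ Finset.range k, (c i : ℝ) * (E i).eval I s := by
  induction k with
  | zero => simp [linComb, RExpr.eval]
  | succ k ih => simp [linComb, RExpr.eval, Finset.sum_range_succ, ih]

variable (s₀ a Q p : ℕ)

/-- The number of groups. -/
def groupsExpr : NExpr := .add (.div .paramK (.const s₀)) (.const 1)

/-- The number of buckets of a table. -/
def bucketsExpr : NExpr := .add (.div .paramK (.const p)) (.const 1)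

/-- The loop counter. -/
def counter : NExpr := .load 4 z0

/-- The row of the part `w` of the measurement `e`. -/
def rowExpr (e : NExpr) (w : ℕ) : NExpr := .add (.const (5 + 3 * w)) (.mul (.const 6) e)

/-- The measurement `k` of the current group. -/
def groupRow (w k : ℕ) : NExpr := rowExpr (.add (.mul counter (.const (a + 1))) (.const k)) w

/-- The measurement of the current bucket. -/
def bucketRow (w : ℕ) : NExpr :=
  rowExpr (.add (.mul (groupsExpr s₀) (.const (a + 1))) counter) w

/-- Put four reals into the registers of `decodeCmd`. -/
def loadCmd (e₀ e₁ e₂ e₃ : RExpr) : Cmd :=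
  .seq (.setReal 2 (.const 0) e₀) (.seq (.setReal 2 (.const 1) e₁)
    (.seq (.setReal 2 (.const 2) e₂) (.setReal 2 (.const 3) e₃)))

/-- A register of `decodeCmd`. -/
abbrev reg (i : ℕ) : RExpr := .load 2 (.const i)

/-- The test of `decodeCmd`. -/
def decodeTest : Test :=
  -- The candidate is the position plus one, so the value `0` is free to signal that nothing was
  -- found. The upper bound on it keeps the coefficients small enough for genericity. The last
  -- clause rejects positions already listed.
  .and (.not (.natEq (.load 3 z0) z0)) (.and (.natLt (.load 3 z0) (.add .paramN (.const 1)))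
    (.and (.realEq (reg 2) (.mul (.ofNat (.load 3 z0)) (reg 0)))
    (.and (.realEq (reg 3) (.mul (.ofNat (.load 3 z0)) (reg 1)))
    (.natEq (.load 2 (.sub (.load 3 z0) (.const 1))) z0))))

/-- Add the entry at the position found, with its value, to the output. -/
def appendCmd (κ : ℤ) : Cmd :=
  .seq (.setNat 2 (.sub (.load 3 z0) (.const 1)) (.const 1))
    (.seq (.setNat 1 (.load 0 z0) (.sub (.load 3 z0) (.const 1)))
    (.seq (.setReal 0 (.load 0 z0) (.div (reg 0)
      (.mul (.const κ) (.entryRe z0 (.sub (.load 3 z0) (.const 1))))))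
    (.seq (.setReal 1 (.load 0 z0) (.div (reg 1)
      (.mul (.const κ) (.entryRe z0 (.sub (.load 3 z0) (.const 1))))))
    (.setNat 0 z0 (.add (.load 0 z0) (.const 1))))))

/-- Given a sum `V` of some entries in the registers `0` and `1`, and the sum of the same entries
weighted by their positions in the registers `2` and `3`, find out whether the sum has a single
entry, and if it is new, add it to the output. -/
def decodeCmd (κ : ℤ) : Cmd :=
  -- If `W = N V` as complex numbers, the real inner product of `V` and `W` divided by `|V|²` is
  -- `N`; this avoids choosing between real and imaginary parts, one of which may vanish.
  .seq (.setFloor 3 z0 (.div (.add (.mul (reg 0) (reg 2)) (.mul (reg 1) (reg 3)))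
    (.add (.mul (reg 0) (reg 0)) (.mul (reg 1) (reg 1)))))
    (.ite decodeTest (appendCmd κ) .skip)

open Polynomial in
/-- The polynomial with the given roots. -/
def rootPoly (T : Finset ℕ) : ℤ[X] := ∏ t ∈ T, (X - C (t : ℤ))

/-- The real part of the combination of the measurements of a group with a polynomial. -/
def groupRe (f : Polynomial ℤ) (w : ℕ) : RExpr :=
  linComb f.coeff (fun k => reExpr (groupRow a w k)) (a + 1)

/-- The imaginary part of the combination of the measurements of a group with a polynomial. -/
def groupIm (f : Polynomial ℤ) (w : ℕ) : RExpr :=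
  linComb f.coeff (fun k => imExpr (groupRow a w k)) (a + 1)

/-- Decode the entry with label `q` of a group, if the labels are among `T`. -/
def labelCmd (T : Finset ℕ) (q : ℕ) : Cmd :=
  .seq (loadCmd (groupRe a (rootPoly (T.erase q)) 0) (groupIm a (rootPoly (T.erase q)) 0)
    (groupRe a (rootPoly (T.erase q)) 1) (groupIm a (rootPoly (T.erase q)) 1))
    (decodeCmd ((rootPoly (T.erase q)).eval (q : ℤ)))

/-- Decode a group if its labels are among `T`. -/
def labelsCmd (T : Finset ℕ) : Cmd :=
  .ite (.and (.realEq (groupRe a (rootPoly T) 0) (.const 0))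
    (.realEq (groupIm a (rootPoly T) 0) (.const 0)))
    (seqList (T.toList.map (labelCmd a T))) .skip

/-- Increase the loop counter. -/
def nextCmd : Cmd := .setNat 4 z0 (.add counter (.const 1))

/-- Decode the current group. -/
def groupCmd : Cmd :=
  .seq (seqList (((Finset.range Q).powersetCard a).toList.map (labelsCmd a))) nextCmd

/-- The cells of the current bucket, which is `idx`, into the registers of `decodeCmd`. -/
def loadBucketCmd (idx : NExpr) : Cmd :=
  loadCmd (.load 3 idx) (.load 4 idx) (.load 5 idx) (.load 6 idx)

/-- Read the measurements of the current bucket and decode it. -/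
def bucketCmd : Cmd :=
  .seq (.setReal 3 counter (reExpr (bucketRow s₀ a 0)))
    (.seq (.setReal 4 counter (imExpr (bucketRow s₀ a 0)))
    (.seq (.setReal 5 counter (reExpr (bucketRow s₀ a 1)))
    (.seq (.setReal 6 counter (imExpr (bucketRow s₀ a 1)))
    (.seq (loadBucketCmd counter) (.seq (decodeCmd 1) nextCmd)))))

/-- The position that the loop over the output has reached. -/
def curPos : NExpr := .load 1 counter

/-- The bucket of the current position in a table. -/
def curBucket (t : ℕ) : NExpr := .add (.mul (.const t) (bucketsExpr p)) (.load 5 z0)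

/-- Remove the current entry from its bucket in the table `t`, and decode the bucket. -/
def peelCmd (t : ℕ) : Cmd :=
  .seq (.setFloor 5 z0 (.entryRe (.const (1 + t)) curPos))
    (.seq (.setReal 3 (curBucket p t) (.sub (.load 3 (curBucket p t))
      (.mul (.entryRe z0 curPos) (.load 0 counter))))
    (.seq (.setReal 4 (curBucket p t) (.sub (.load 4 (curBucket p t))
      (.mul (.entryRe z0 curPos) (.load 1 counter))))
    (.seq (.setReal 5 (curBucket p t) (.sub (.load 5 (curBucket p t))
      (.mul (.add (.ofNat curPos) (.const 1)) (.mul (.entryRe z0 curPos) (.load 0 counter)))))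
    (.seq (.setReal 6 (curBucket p t) (.sub (.load 6 (curBucket p t))
      (.mul (.add (.ofNat curPos) (.const 1)) (.mul (.entryRe z0 curPos) (.load 1 counter)))))
    (.seq (loadBucketCmd (curBucket p t)) (decodeCmd 1))))))

/-- Remove the current entry from its buckets. -/
def entryCmd : Cmd := .seq (peelCmd p 0) (.seq (peelCmd p 1) (.seq (peelCmd p 2)
  (.seq (peelCmd p 3) nextCmd)))

/-- The loop over the groups. -/
def groupLoop : Cmd := .while (.natLt counter (groupsExpr s₀)) (groupCmd a Q)

/-- The loop over the buckets. -/
def bucketLoop : Cmd :=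
  .while (.natLt counter (.mul (.const 4) (bucketsExpr p))) (bucketCmd s₀ a)

/-- The loop over the output. -/
def peelLoop : Cmd := .while (.natLt counter (.load 0 z0)) (entryCmd p)

/-- Set the loop counter to zero. -/
def resetCmd : Cmd := .setNat 4 z0 z0

/-- The decoder. -/
def decoder : Cmd :=
  .seq (groupLoop s₀ a Q) (.seq resetCmd (.seq (bucketLoop s₀ a p) (.seq resetCmd (peelLoop p))))

theorem loopFree_decodeCmd (κ : ℤ) : (decodeCmd κ).LoopFree := by
  simp [decodeCmd, appendCmd, Cmd.LoopFree]

theorem loopFree_groupCmd : (groupCmd a Q).LoopFree := by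
  refine ⟨loopFree_seqList fun c hc => ?_, trivial⟩
  obtain ⟨T, -, rfl⟩ := List.mem_map.1 hc
  refine ⟨loopFree_seqList fun c hc => ?_, trivial⟩
  obtain ⟨q, -, rfl⟩ := List.mem_map.1 hc
  exact ⟨by simp [loadCmd, Cmd.LoopFree], loopFree_decodeCmd _⟩

theorem loopFree_bucketCmd : (bucketCmd s₀ a).LoopFree := by
  simp [bucketCmd, loadBucketCmd, loadCmd, nextCmd, Cmd.LoopFree, loopFree_decodeCmd]

theorem loopFree_peelCmd (t : ℕ) : (peelCmd p t).LoopFree := by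
  simp [peelCmd, loadBucketCmd, loadCmd, Cmd.LoopFree, loopFree_decodeCmd]

theorem loopFree_entryCmd : (entryCmd p).LoopFree := by
  simp [entryCmd, nextCmd, Cmd.LoopFree, loopFree_peelCmd]

end Program

/-! ### Correctness of the decoder -/

/-- The number of groups, and of buckets in a table, as functions of `K`. -/
def parts (K d : ℕ) : ℕ := K / d + 1

/-- The entries in the bucket `i`; the bucket `t * B + b` is the bucket `b` of table `t`. -/
def bucket (supp : Finset ℕ) (bk : ℕ → ℕ → ℕ) (B i : ℕ) : Finset ℕ :=
  supp.filter fun j => bk (i / B) j = i % B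

/-- What the decoder relies on: the input holds the measurements of the signal `x` with the
support `supp`, scaled by `u`, hashed by `grp` and `lab` into groups with labels and by `bk` into
buckets, and the scaled components are in general position. -/
structure Decodable (I : Input) (W s₀ a Q p : ℕ) (supp : Finset ℕ) (x : ℕ → ℂ) (u grp lab : ℕ → ℕ)
    (bk : ℕ → ℕ → ℕ) : Prop where
  word : 4 * I.K + I.n + 8 ≤ W
  card_le : supp.card ≤ I.K
  lt_n : ∀ j ∈ supp, j < I.n
  x_ne : ∀ j ∈ supp, x j ≠ 0
  u_ne : ∀ j ∈ supp, u j ≠ 0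
  entry_u : ∀ j ∈ supp, (I.entry 0 j).re = u j
  entry_bk : ∀ t < 4, ∀ j ∈ supp, (I.entry (1 + t) j).re = bk t j
  bk_lt : ∀ t < 4, ∀ j ∈ supp, bk t j < parts I.K p
  grp_lt : ∀ j ∈ supp, grp j < parts I.K s₀
  lab_lt : ∀ j ∈ supp, lab j < Q
  group_value : ∀ g < parts I.K s₀, ∀ k ≤ a, ∀ w < 2,
    I.value (5 + 3 * w + 6 * (g * (a + 1) + k)) =
      ∑ j ∈ supp with grp j = g, (lab j : ℂ) ^ k * ((j + 1 : ℂ) ^ w * (u j * x j))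
  bucket_value : ∀ i < 4 * parts I.K p, ∀ w < 2,
    I.value (5 + 3 * w + 6 * (parts I.K s₀ * (a + 1) + i)) =
      ∑ j ∈ bucket supp bk (parts I.K p) i, (j + 1 : ℂ) ^ w * (u j * x j)
  generic : ∀ c : ℕ → ℤ, (∀ j ∈ supp, |c j| ≤ (Q : ℤ) ^ a + I.n) →
    ∑ j ∈ supp, (c j : ℂ) * (u j * x j) = 0 → ∀ j ∈ supp, c j = 0

/-- The positions in the output. -/
def State.listed (s : State) : Finset ℕ := (Finset.range (s.nat 0 0)).image (s.nat 1)

/-- The output is correct so far. -/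
structure Sound (supp : Finset ℕ) (x : ℕ → ℂ) (s : State) : Prop where
  mem : ∀ l < s.nat 0 0, s.nat 1 l ∈ supp
  val : ∀ l < s.nat 0 0, (⟨s.real 0 l, s.real 1 l⟩ : ℂ) = x (s.nat 1 l)
  inj : ∀ l < s.nat 0 0, ∀ l' < s.nat 0 0, s.nat 1 l = s.nat 1 l' → l = l'
  mark : ∀ j, s.nat 2 j ≠ 0 ↔ j ∈ s.listed

/-- `s'` arises from `s` by adding to the output. -/
structure Extends (s s' : State) : Prop where
  len : s.nat 0 0 ≤ s'.nat 0 0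
  pos : ∀ l < s.nat 0 0, s'.nat 1 l = s.nat 1 l
  nat : ∀ b, 4 ≤ b → s'.nat b = s.nat b
  real : ∀ b, 3 ≤ b → s'.real b = s.real b

theorem Extends.refl (s : State) : Extends s s :=
  ⟨le_rfl, fun _ _ => rfl, fun _ _ => rfl, fun _ _ => rfl⟩

theorem Extends.trans {s s' s'' : State} (h : Extends s s') (h' : Extends s' s'') :
    Extends s s'' where
  len := h.len.trans h'.len
  pos l hl := (h'.pos l (hl.trans_le h.len)).trans (h.pos l hl)
  nat b hb := (h'.nat b hb).trans (h.nat b hb)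
  real b hb := (h'.real b hb).trans (h.real b hb)

theorem State.mem_listed {s : State} {j : ℕ} :
    j ∈ s.listed ↔ ∃ l < s.nat 0 0, s.nat 1 l = j := by
  simp [State.listed]

theorem Extends.listed {s s' : State} (h : Extends s s') : s.listed ⊆ s'.listed := by
  intro j hj
  obtain ⟨l, hl, rfl⟩ := State.mem_listed.1 hj
  exact State.mem_listed.2 ⟨l, hl.trans_le h.len, h.pos l hl⟩

theorem Sound.listed_subset {supp : Finset ℕ} {x : ℕ → ℂ} {s : State} (h : Sound supp x s) :
    s.listed ⊆ supp := by
  intro j hj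
  obtain ⟨l, hl, rfl⟩ := State.mem_listed.1 hj
  exact h.mem l hl

theorem Sound.card_listed {supp : Finset ℕ} {x : ℕ → ℂ} {s : State} (h : Sound supp x s) :
    s.listed.card = s.nat 0 0 := by
  rw [State.listed, Finset.card_image_of_injOn, Finset.card_range]
  intro l hl l' hl' hll
  exact h.inj l (by simpa using hl) l' (by simpa using hl') hll

theorem Sound.length_le {supp : Finset ℕ} {x : ℕ → ℂ} {s : State} (h : Sound supp x s) :
    s.nat 0 0 ≤ supp.card :=
  h.card_listed ▸ Finset.card_le_card h.listed_subset

/-- A complete sound output is the signal. -/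
theorem Sound.output_eq {supp : Finset ℕ} {x : ℕ → ℂ} {s : State} (h : Sound supp x s)
    (hall : supp ⊆ s.listed) (hx : ∀ j ∉ supp, x j = 0) (n : ℕ) (j : Fin n) :
    s.output n j = x j := by
  unfold State.output
  by_cases hj : (j : ℕ) ∈ supp
  · obtain ⟨l, hl, hlj⟩ := State.mem_listed.1 (hall hj)
    rw [Finset.sum_eq_single l]
    · rw [if_pos hlj, h.val l hl, hlj]
    · intro l' hl' hne
      rw [if_neg]
      exact fun hc => hne (h.inj l' (by simpa using hl') l hl (hc.trans hlj.symm))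
    · intro hc
      simp [hl] at hc
  · rw [hx _ hj]
    refine Finset.sum_eq_zero fun l hl => if_neg ?_
    rintro hc
    exact hj (hc ▸ h.mem l (by simpa using hl))

/-! ### Decoding a sum that may have a single entry -/

section Correctness

variable {I : Input} {W s₀ a Q p : ℕ} {supp : Finset ℕ} {x : ℕ → ℂ} {u grp lab : ℕ → ℕ}
  {bk : ℕ → ℕ → ℕ}

/-- A relation on a subset is one on the whole support with coefficient `0` elsewhere. -/
theorem Decodable.generic_on (h : Decodable I W s₀ a Q p supp x u grp lab bk) {D : Finset ℕ}
    (hD : D ⊆ supp) (c : ℕ → ℤ) (hc : ∀ j ∈ D, |c j| ≤ (Q : ℤ) ^ a + I.n)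
    (h0 : ∑ j ∈ D, (c j : ℂ) * (u j * x j) = 0) : ∀ j ∈ D, c j = 0 := by
  intro j hj
  have := h.generic (fun j => if j ∈ D then c j else 0) ?_ ?_ j (hD hj)
  · simpa [hj] using this
  · intro j _
    by_cases hj : j ∈ D
    · simpa [hj] using hc j hj
    · simp only [hj, if_false, abs_zero]
      positivity
  · rw [← h0]
    refine (Finset.sum_subset_zero_on_sdiff hD (fun j hj => ?_) fun j hj => ?_).symm
    · simp [(Finset.mem_sdiff.1 hj).2]
    · simp [hj]

/-- Only a single entry passes the test. -/
theorem Decodable.eq_singleton (h : Decodable I W s₀ a Q p supp x u grp lab bk) {D : Finset ℕ}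
    (hD : D ⊆ supp) {N : ℕ} (hN : N ≤ I.n) {κ : ℂ} (hκ : κ ≠ 0)
    (hV : κ * ∑ j ∈ D, (u j * x j : ℂ) ≠ 0)
    (hW : κ * ∑ j ∈ D, (j + 1 : ℂ) * (u j * x j) = N * (κ * ∑ j ∈ D, (u j * x j : ℂ))) :
    D = {N - 1} ∧ 1 ≤ N := by
  have hsum : ∑ j ∈ D, (((j : ℤ) + 1 - N : ℤ) : ℂ) * (u j * x j) = 0 := by
    have h1 : ∑ j ∈ D, (j + 1 : ℂ) * (u j * x j) = N * ∑ j ∈ D, (u j * x j : ℂ) := by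
      apply mul_left_cancel₀ hκ
      rw [hW]
      ring
    rw [Finset.mul_sum] at h1
    rw [← sub_eq_zero.2 h1, ← Finset.sum_sub_distrib]
    refine Finset.sum_congr rfl fun j _ => ?_
    push_cast
    ring
  have hz := h.generic_on hD (fun j => (j : ℤ) + 1 - N) ?_ hsum
  · have hne : D.Nonempty := by
      rw [Finset.nonempty_iff_ne_empty]
      rintro rfl
      simp at hV
    have hj : ∀ j ∈ D, j + 1 = N := fun j hj => by have := hz j hj; omega
    obtain ⟨j, hjD⟩ := hne
    have hjN := hj j hjD
    refine ⟨Finset.eq_singleton_iff_unique_mem.2 ⟨?_, fun k hk => ?_⟩, by omega⟩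
    · rwa [← hjN, Nat.add_sub_cancel]
    · have := hj k hk
      omega
  · intro j hj
    have := h.lt_n j (hD hj)
    have hQ : (0 : ℤ) ≤ (Q : ℤ) ^ a := by positivity
    rw [abs_le]
    constructor <;> omega

/-- Soundness comes from genericity: whatever passes the test is a singleton, so its value and
position are right. Completeness is direct: a single entry passes the test unless it is already
marked. Both hold up to a known non-zero integer factor `κ`, as the group decoder isolates a label
only up to such a factor. -/
theorem decode_spec (h : Decodable I W s₀ a Q p supp x u grp lab bk)
    {s : State} (hs : Sound supp x s) {D : Finset ℕ} (hD : D ⊆ supp) {κ : ℤ} (hκ : κ ≠ 0)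
    (hV : (⟨s.real 2 0, s.real 2 1⟩ : ℂ) = κ * ∑ j ∈ D, (u j * x j : ℂ))
    (hW : (⟨s.real 2 2, s.real 2 3⟩ : ℂ) = κ * ∑ j ∈ D, (j + 1 : ℂ) * (u j * x j)) :
    Sound supp x ((decodeCmd κ).run I W s) ∧ Extends s ((decodeCmd κ).run I W s) ∧
      ∀ j, D = {j} → j ∈ ((decodeCmd κ).run I W s).listed := by
  classical
  have hκ' : (κ : ℂ) ≠ 0 := by exact_mod_cast hκ
  set v0 := s.real 2 0 with hv0
  set v1 := s.real 2 1 with hv1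
  set w0 := s.real 2 2 with hw0
  set w1 := s.real 2 3 with hw1
  set N := min ⌊(v0 * w0 + v1 * w1) / (v0 * v0 + v1 * v1)⌋₊ W with hNdef
  have hlen := hs.length_le.trans h.card_le
  have hword := h.word
  have htest : decodeTest.holds I (s.setNat 3 0 N) ↔
      N ≠ 0 ∧ N < I.n + 1 ∧ w0 = N * v0 ∧ w1 = N * v1 ∧ s.nat 2 (N - 1) = 0 := by
    simp [decodeTest, Test.holds, NExpr.eval, RExpr.eval, hv0, hv1, hw0, hw1]
  have hrun : (decodeCmd κ).run I W s = if decodeTest.holds I (s.setNat 3 0 N) then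
      (appendCmd κ).run I W (s.setNat 3 0 N) else s.setNat 3 0 N := by
    simp only [decodeCmd, Cmd.run, NExpr.eval, RExpr.eval]
    rfl
  rw [hrun]
  by_cases ht : decodeTest.holds I (s.setNat 3 0 N)
  · rw [if_pos ht]
    obtain ⟨hN0, hNn, hw0', hw1', hmark⟩ := htest.1 ht
    -- A vanishing sum gives the candidate `0`, since division by zero is `0`, and the test rejects
    -- it.
    have hne : (⟨v0, v1⟩ : ℂ) ≠ 0 := by
      intro hc
      have h0 : v0 = 0 := congrArg Complex.re hc
      have h1 : v1 = 0 := congrArg Complex.im hc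
      apply hN0
      rw [hNdef, h0, h1]
      simp
    have hWN : (⟨w0, w1⟩ : ℂ) = N * ⟨v0, v1⟩ := by
      apply Complex.ext <;> simp [hw0', hw1']
    rw [hV, hW] at hWN
    rw [hV] at hne
    obtain ⟨hDN, hN1⟩ := h.eq_singleton hD (by omega) hκ' hne hWN
    have hNs : N - 1 ∈ supp := hD (by simp [hDN])
    have hNot : N - 1 ∉ s.listed := fun hc => (hs.mark _).2 hc hmark
    have hu := h.u_ne _ hNs
    have hval : (⟨v0 / (κ * u (N - 1)), v1 / (κ * u (N - 1))⟩ : ℂ) = x (N - 1) := by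
      have h1 : (⟨v0, v1⟩ : ℂ) = κ * (u (N - 1) * x (N - 1)) := by
        rw [hV, hDN, Finset.sum_singleton]
      have h2 : (⟨v0 / (κ * u (N - 1)), v1 / (κ * u (N - 1))⟩ : ℂ) =
          ⟨v0, v1⟩ / ((κ * u (N - 1) : ℝ) : ℂ) := by
        apply Complex.ext
        · rw [Complex.div_ofReal_re]
        · rw [Complex.div_ofReal_im]
      rw [h2, h1]
      have hu' : (u (N - 1) : ℂ) ≠ 0 := by exact_mod_cast hu
      push_cast
      field_simp
    have hsupp : 1 ≤ I.K := by
      have := Finset.card_pos.2 ⟨_, hNs⟩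
      have := h.card_le
      omega
    have hnat : ((appendCmd κ).run I W (s.setNat 3 0 N)).nat = fun b i =>
        if b = 0 ∧ i = 0 then s.nat 0 0 + 1 else if b = 1 ∧ i = s.nat 0 0 then N - 1 else
          if b = 2 ∧ i = N - 1 then 1 else if b = 3 ∧ i = 0 then N else s.nat b i := by
      -- No stored word saturates, because positions and list lengths are far below `W`.
      have e1 : min (N - 1) W = N - 1 := by omega
      have e2 : min 1 W = 1 := by omega
      have e3 : min (s.nat 0 0 + 1) W = s.nat 0 0 + 1 := by omega
      funext b i
      simp [appendCmd, Cmd.run, NExpr.eval, e1, e2, e3]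
    have hreal : ((appendCmd κ).run I W (s.setNat 3 0 N)).real = fun b i =>
        if b = 1 ∧ i = s.nat 0 0 then v1 / (κ * u (N - 1)) else
          if b = 0 ∧ i = s.nat 0 0 then v0 / (κ * u (N - 1)) else s.real b i := by
      funext b i
      simp [appendCmd, Cmd.run, NExpr.eval, RExpr.eval, h.entry_u _ hNs, hv0, hv1]
    set s' := (appendCmd κ).run I W (s.setNat 3 0 N) with hs'
    have hlen' : s'.nat 0 0 = s.nat 0 0 + 1 := by simp [hnat]
    have hold : ∀ l < s.nat 0 0, s'.nat 1 l = s.nat 1 l := fun l hl => by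
      simp [hnat, hl.ne]
    have hnew : s'.nat 1 (s.nat 0 0) = N - 1 := by simp [hnat]
    have hlisted : s'.listed = insert (N - 1) s.listed := by
      ext j
      rw [State.mem_listed, Finset.mem_insert, State.mem_listed, hlen']
      constructor
      · rintro ⟨l, hl, rfl⟩
        rcases Nat.lt_succ_iff_lt_or_eq.1 hl with hl | rfl
        · exact Or.inr ⟨l, hl, (hold l hl).symm⟩
        · exact Or.inl hnew
      · rintro (rfl | ⟨l, hl, rfl⟩)
        · exact ⟨_, by omega, hnew⟩
        · exact ⟨l, by omega, hold l hl⟩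
    refine ⟨⟨?_, ?_, ?_, ?_⟩, ⟨by omega, hold, ?_, ?_⟩, ?_⟩
    · intro l hl
      rw [hlen'] at hl
      rcases Nat.lt_succ_iff_lt_or_eq.1 hl with hl | rfl
      · rw [hold l hl]
        exact hs.mem l hl
      · rwa [hnew]
    · intro l hl
      rw [hlen'] at hl
      rcases Nat.lt_succ_iff_lt_or_eq.1 hl with hl | rfl
      · rw [hold l hl, ← hs.val l hl]
        simp [hreal, hl.ne]
      · rw [hnew, ← hval]
        simp [hreal]
    · intro l hl l' hl' hll
      rw [hlen'] at hl hl'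
      rcases Nat.lt_succ_iff_lt_or_eq.1 hl with hl | rfl <;>
        rcases Nat.lt_succ_iff_lt_or_eq.1 hl' with hl' | rfl
      · rw [hold l hl, hold l' hl'] at hll
        exact hs.inj l hl l' hl' hll
      · rw [hold l hl, hnew] at hll
        exact absurd (State.mem_listed.2 ⟨l, hl, hll⟩) hNot
      · rw [hold l' hl', hnew] at hll
        exact absurd (State.mem_listed.2 ⟨l', hl', hll.symm⟩) hNot
      · rfl
    · intro j
      rw [hlisted, Finset.mem_insert, ← hs.mark j]
      by_cases hj : j = N - 1 <;> simp [hnat, hj]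
    · intro b hb
      funext i
      simp [hnat, show b ≠ 0 by omega, show b ≠ 1 by omega, show b ≠ 2 by omega,
        show b ≠ 3 by omega]
    · intro b hb
      funext i
      simp [hreal, show b ≠ 0 by omega, show b ≠ 1 by omega]
    · intro j hj
      rw [hlisted]
      have : N - 1 = j := by simpa [hj] using hDN.symm
      simp [this]
  · rw [if_neg ht]
    have hlisted : (s.setNat 3 0 N).listed = s.listed := by
      ext
      simp [State.mem_listed]
    refine ⟨⟨by simpa using hs.mem, by simpa using hs.val, by simpa using hs.inj, ?_⟩,
      ⟨by simp, by simp, ?_, by simp⟩, ?_⟩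
    · intro j
      rw [hlisted]
      simpa using hs.mark j
    · intro b hb
      funext i
      simp [show b ≠ 3 by omega]
    · intro j hj
      rw [hlisted, ← hs.mark]
      intro hm
      apply ht
      rw [htest]
      have hjs : j ∈ supp := hD (by simp [hj])
      have hjn := h.lt_n j hjs
      rw [hj, Finset.sum_singleton] at hV hW
      have hWV : (⟨w0, w1⟩ : ℂ) = ((j + 1 : ℝ) : ℂ) * ⟨v0, v1⟩ := by
        rw [hV, hW]
        push_cast
        ring
      have hw0' : w0 = (j + 1) * v0 := by
        have := congrArg Complex.re hWV
        rwa [Complex.re_ofReal_mul] at this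
      have hw1' : w1 = (j + 1) * v1 := by
        have := congrArg Complex.im hWV
        rwa [Complex.im_ofReal_mul] at this
      have hne : v0 * v0 + v1 * v1 ≠ 0 := by
        intro hc
        have h0 : v0 = 0 := by nlinarith [mul_self_nonneg v0, mul_self_nonneg v1]
        have h1 : v1 = 0 := by nlinarith [mul_self_nonneg v0, mul_self_nonneg v1]
        have hu : (u j : ℂ) ≠ 0 := by exact_mod_cast h.u_ne j hjs
        have : (⟨v0, v1⟩ : ℂ) = 0 := by rw [h0, h1]; rfl
        rw [hV] at this
        exact mul_ne_zero hκ' (mul_ne_zero hu (h.x_ne j hjs)) this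
      have hN : N = j + 1 := by
        have : (v0 * w0 + v1 * w1) / (v0 * v0 + v1 * v1) = ((j + 1 : ℕ) : ℝ) := by
          rw [div_eq_iff hne, hw0', hw1']
          push_cast
          ring
        rw [hNdef, this, Nat.floor_natCast]
        omega
      refine ⟨by omega, by omega, ?_, ?_, ?_⟩
      · rw [hN, hw0']
        push_cast
        ring
      · rw [hN, hw1']
        push_cast
        ring
      · rwa [hN, Nat.add_sub_cancel]

end Correctness

/-! ### Loading registers, and decoding the groups by power sums -/

section Correctness

variable {I : Input} {W s₀ a Q p : ℕ} {supp : Finset ℕ} {x : ℕ → ℂ} {u grp lab : ℕ → ℕ}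
  {bk : ℕ → ℕ → ℕ}

theorem Sound.congr {s s' : State} (h : Sound supp x s) (hn : ∀ b ≤ 2, s'.nat b = s.nat b)
    (hr : ∀ b ≤ 1, s'.real b = s.real b) : Sound supp x s' := by
  have h0 := hn 0 (by norm_num)
  have h1 := hn 1 (by norm_num)
  have h2 := hn 2 (by norm_num)
  have hl : s'.listed = s.listed := by simp [State.listed, h0, h1]
  refine ⟨?_, ?_, ?_, ?_⟩
  · simpa [h0, h1] using h.mem
  · simpa [h0, h1, hr 0 (by norm_num), hr 1 le_rfl] using h.val
  · simpa [h0, h1] using h.inj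
  · intro j
    rw [hl, h2]
    exact h.mark j

/-- The expression does not read the registers of `decodeCmd`. -/
def RExpr.RegFree (e : RExpr) : Prop :=
  ∀ (I : Input) (s : State) (i : ℕ) (v : ℝ), e.eval I (s.setReal 2 i v) = e.eval I s

/-- The four registers are filled one after the other, so the later expressions must not read the
earlier ones; the cells that decoding may not disturb are outside the register array. -/
theorem load_decode_spec (h : Decodable I W s₀ a Q p supp x u grp lab bk) {s : State}
    (hs : Sound supp x s) {D : Finset ℕ} (hD : D ⊆ supp) {κ : ℤ} (hκ : κ ≠ 0)
    {e₀ e₁ e₂ e₃ : RExpr} (h₁ : e₁.RegFree) (h₂ : e₂.RegFree) (h₃ : e₃.RegFree)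
    (hV : (⟨e₀.eval I s, e₁.eval I s⟩ : ℂ) = κ * ∑ j ∈ D, (u j * x j : ℂ))
    (hW : (⟨e₂.eval I s, e₃.eval I s⟩ : ℂ) = κ * ∑ j ∈ D, (j + 1 : ℂ) * (u j * x j)) :
    Sound supp x ((Cmd.seq (loadCmd e₀ e₁ e₂ e₃) (decodeCmd κ)).run I W s) ∧
      Extends s ((Cmd.seq (loadCmd e₀ e₁ e₂ e₃) (decodeCmd κ)).run I W s) ∧
      ∀ j, D = {j} → j ∈ ((Cmd.seq (loadCmd e₀ e₁ e₂ e₃) (decodeCmd κ)).run I W s).listed := by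
  have hn : ((loadCmd e₀ e₁ e₂ e₃).run I W s).nat = s.nat := by simp [loadCmd, Cmd.run]
  have hr : ∀ b i, ((loadCmd e₀ e₁ e₂ e₃).run I W s).real b i =
      if b = 2 ∧ i = 3 then e₃.eval I s else if b = 2 ∧ i = 2 then e₂.eval I s else
        if b = 2 ∧ i = 1 then e₁.eval I s else if b = 2 ∧ i = 0 then e₀.eval I s else
          s.real b i := by
    intro b i
    simp [loadCmd, Cmd.run, NExpr.eval, h₁ _ _, h₂ _ _, h₃ _ _]
  have hr' : ∀ b, b ≠ 2 → ((loadCmd e₀ e₁ e₂ e₃).run I W s).real b = s.real b := by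
    intro b hb
    funext i
    simp [hr, hb]
  have hs' : Sound supp x ((loadCmd e₀ e₁ e₂ e₃).run I W s) :=
    hs.congr (fun b _ => by rw [hn]) fun b hb => hr' b (by omega)
  have he : Extends s ((loadCmd e₀ e₁ e₂ e₃).run I W s) :=
    ⟨by rw [hn], fun l _ => by rw [hn], fun b _ => by rw [hn], fun b hb => hr' b (by omega)⟩
  obtain ⟨k₁, k₂, k₃⟩ := decode_spec h hs' hD hκ (by simpa [hr] using hV) (by simpa [hr] using hW)
  exact ⟨k₁, he.trans k₂, k₃⟩

theorem eval_reExpr (s : State) (i : NExpr) :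
    (reExpr i).eval I s = (I.value (i.eval I s)).re := by
  simp [reExpr, RExpr.eval, NExpr.eval, Input.value]

theorem eval_imExpr (s : State) (i : NExpr) :
    (imExpr i).eval I s = (I.value (i.eval I s)).im := by
  simp [imExpr, RExpr.eval, NExpr.eval, Input.value]

/-! #### The groups -/

theorem eval_groupRow (s : State) (w k : ℕ) :
    (groupRow a w k).eval I s = 5 + 3 * w + 6 * (s.nat 4 0 * (a + 1) + k) := by
  simp [groupRow, rowExpr, counter, NExpr.eval]

theorem regFree_groupRe (f : Polynomial ℤ) (w : ℕ) : (groupRe a f w).RegFree := by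
  intro I s i v
  simp [groupRe, eval_linComb, eval_reExpr, eval_groupRow]

theorem regFree_groupIm (f : Polynomial ℤ) (w : ℕ) : (groupIm a f w).RegFree := by
  intro I s i v
  simp [groupIm, eval_linComb, eval_imExpr, eval_groupRow]

/-- Exchanging the sums over powers and over entries assembles `f (lab j)` from the power sums;
those up to `a` suffice for degree at most `a`. -/
theorem Decodable.eval_group (h : Decodable I W s₀ a Q p supp x u grp lab bk) {s : State}
    (hg : s.nat 4 0 < parts I.K s₀) {f : Polynomial ℤ} (hf : f.natDegree ≤ a) {w : ℕ}
    (hw : w < 2) :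
    (⟨(groupRe a f w).eval I s, (groupIm a f w).eval I s⟩ : ℂ) =
      ∑ j ∈ supp with grp j = s.nat 4 0, ((f.eval (lab j : ℤ) : ℤ) : ℂ) *
        ((j + 1 : ℂ) ^ w * (u j * x j)) := by
  have h1 : (⟨(groupRe a f w).eval I s, (groupIm a f w).eval I s⟩ : ℂ) =
      ∑ k ∈ Finset.range (a + 1), (f.coeff k : ℂ) *
        I.value (5 + 3 * w + 6 * (s.nat 4 0 * (a + 1) + k)) := by
    apply Complex.ext
    · simp [groupRe, eval_linComb, eval_reExpr, eval_groupRow]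
    · simp [groupIm, eval_linComb, eval_imExpr, eval_groupRow]
  rw [h1]
  have h2 : ∀ k ∈ Finset.range (a + 1), (f.coeff k : ℂ) *
      I.value (5 + 3 * w + 6 * (s.nat 4 0 * (a + 1) + k)) =
      ∑ j ∈ supp with grp j = s.nat 4 0, (f.coeff k * (lab j : ℂ) ^ k) *
        ((j + 1 : ℂ) ^ w * (u j * x j)) := by
    intro k hk
    rw [h.group_value _ hg k (by simpa [Nat.lt_succ_iff] using hk) w hw, Finset.mul_sum]
    exact Finset.sum_congr rfl fun j _ => by ring
  rw [Finset.sum_congr rfl h2, Finset.sum_comm]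
  refine Finset.sum_congr rfl fun j _ => ?_
  rw [← Finset.sum_mul, Polynomial.eval_eq_sum_range' (Nat.lt_succ_of_le hf)]
  push_cast
  rfl

theorem eval_rootPoly (T : Finset ℕ) (y : ℤ) : (rootPoly T).eval y = ∏ t ∈ T, (y - t) := by
  simp [rootPoly, Polynomial.eval_prod]

theorem eval_rootPoly_eq_zero_iff (T : Finset ℕ) (q : ℕ) :
    (rootPoly T).eval (q : ℤ) = 0 ↔ q ∈ T := by
  rw [eval_rootPoly, Finset.prod_eq_zero_iff]
  constructor
  · rintro ⟨t, ht, h⟩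
    have : q = t := by omega
    rwa [this]
  · exact fun h => ⟨q, h, by simp⟩

theorem natDegree_rootPoly (T : Finset ℕ) : (rootPoly T).natDegree = T.card :=
  Polynomial.natDegree_finsetProd_X_sub_C_eq_card T _

/-- Each factor is a difference of two labels below `Q`. This accounts for the summand `Q ^ a` in
the range of coefficients for which genericity is required. -/
theorem abs_eval_rootPoly_le {T : Finset ℕ} (hT : T ⊆ Finset.range Q) {q : ℕ} (hq : q < Q) :
    |(rootPoly T).eval (q : ℤ)| ≤ (Q : ℤ) ^ T.card := by
  rw [eval_rootPoly, Finset.abs_prod]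
  rw [← Finset.prod_const]
  refine Finset.prod_le_prod (fun t _ => abs_nonneg _) fun t ht => ?_
  have := Finset.mem_range.1 (hT ht)
  rw [abs_le]
  constructor <;> omega

/-- The polynomial with roots `T.erase q` kills every label of the group except `q`, where its value
is the non-zero factor `κ`. -/
theorem label_spec (h : Decodable I W s₀ a Q p supp x u grp lab bk) {s : State}
    (hs : Sound supp x s) (hg : s.nat 4 0 < parts I.K s₀) {T : Finset ℕ} (hTa : T.card = a)
    (hT : ∀ j ∈ supp, grp j = s.nat 4 0 → lab j ∈ T) (q : ℕ) :
    Sound supp x ((labelCmd a T q).run I W s) ∧ Extends s ((labelCmd a T q).run I W s) ∧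
      ∀ j, (supp.filter fun j => grp j = s.nat 4 0 ∧ lab j = q) = {j} →
        j ∈ ((labelCmd a T q).run I W s).listed := by
  have hdeg : (rootPoly (T.erase q)).natDegree ≤ a := by
    rw [natDegree_rootPoly, ← hTa]
    exact Finset.card_le_card (Finset.erase_subset _ _)
  have hκ : (rootPoly (T.erase q)).eval (q : ℤ) ≠ 0 := by
    rw [Ne, eval_rootPoly_eq_zero_iff]
    simp
  have key : ∀ w < 2, (⟨(groupRe a (rootPoly (T.erase q)) w).eval I s,
      (groupIm a (rootPoly (T.erase q)) w).eval I s⟩ : ℂ) =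
      (((rootPoly (T.erase q)).eval (q : ℤ) : ℤ) : ℂ) *
        ∑ j ∈ supp with grp j = s.nat 4 0 ∧ lab j = q, (j + 1 : ℂ) ^ w * (u j * x j) := by
    intro w hw
    rw [h.eval_group hg hdeg hw, Finset.mul_sum, ← Finset.filter_filter]
    rw [Finset.sum_filter (p := fun j => lab j = q)]
    refine Finset.sum_congr rfl fun j hj => ?_
    obtain ⟨hj, hjg⟩ := Finset.mem_filter.1 hj
    by_cases hjq : lab j = q
    · rw [if_pos hjq, hjq]
    · rw [if_neg hjq, (eval_rootPoly_eq_zero_iff _ _).2, Int.cast_zero, zero_mul]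
      exact Finset.mem_erase.2 ⟨hjq, hT j hj hjg⟩
  exact load_decode_spec h hs (Finset.filter_subset _ _) hκ (regFree_groupIm _ _)
    (regFree_groupRe _ _) (regFree_groupIm _ _) (by simpa using key 0 (by norm_num))
    (by simpa using key 1 (by norm_num))

/-- The test combination weights each entry by the value of `rootPoly T` at its label. By genericity
it vanishes only if all these weights do, so a wrong guess `T` is always detected and leaves the
memory alone. -/
theorem labels_spec (h : Decodable I W s₀ a Q p supp x u grp lab bk) {s : State}
    (hs : Sound supp x s) (hg : s.nat 4 0 < parts I.K s₀) {T : Finset ℕ}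
    (hTQ : T ⊆ Finset.range Q) (hTa : T.card = a) :
    Sound supp x ((labelsCmd a T).run I W s) ∧ Extends s ((labelsCmd a T).run I W s) ∧
      ((∀ j ∈ supp, grp j = s.nat 4 0 → lab j ∈ T) → ∀ j ∈ supp, grp j = s.nat 4 0 →
        (∀ k ∈ supp, grp k = grp j → lab k = lab j → k = j) →
        j ∈ ((labelsCmd a T).run I W s).listed) := by
  classical
  have hsum := h.eval_group hg (f := rootPoly T) (by rw [natDegree_rootPoly, hTa]) (w := 0)
    (by norm_num)
  simp only [pow_zero, one_mul] at hsum
  have htest : (∀ j ∈ supp, grp j = s.nat 4 0 → lab j ∈ T) ↔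
      (Test.and (.realEq (groupRe a (rootPoly T) 0) (.const 0))
        (.realEq (groupIm a (rootPoly T) 0) (.const 0))).holds I s := by
    have h1 : (Test.and (.realEq (groupRe a (rootPoly T) 0) (.const 0))
        (.realEq (groupIm a (rootPoly T) 0) (.const 0))).holds I s ↔
        (⟨(groupRe a (rootPoly T) 0).eval I s, (groupIm a (rootPoly T) 0).eval I s⟩ : ℂ) = 0 := by
      simp [Test.holds, RExpr.eval, Complex.ext_iff]
    rw [h1, hsum]
    constructor
    · intro hT
      refine Finset.sum_eq_zero fun j hj => ?_
      obtain ⟨hj, hjg⟩ := Finset.mem_filter.1 hj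
      rw [(eval_rootPoly_eq_zero_iff _ _).2 (hT j hj hjg), Int.cast_zero, zero_mul]
    · intro h0 j hj hjg
      have := h.generic_on (Finset.filter_subset _ _) (fun j => (rootPoly T).eval (lab j : ℤ)) ?_ h0
        j (Finset.mem_filter.2 ⟨hj, hjg⟩)
      · exact (eval_rootPoly_eq_zero_iff _ _).1 this
      · intro j hj
        refine (abs_eval_rootPoly_le hTQ (h.lab_lt j (Finset.filter_subset _ _ hj))).trans ?_
        rw [hTa]
        omega
  by_cases hT : ∀ j ∈ supp, grp j = s.nat 4 0 → lab j ∈ T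
  · have hrun : (labelsCmd a T).run I W s =
        (seqList (T.toList.map (labelCmd a T))).run I W s := by
      rw [labelsCmd, Cmd.run, if_pos (htest.1 hT)]
    rw [hrun]
    have hstep : ∀ c ∈ T.toList.map (labelCmd a T), ∀ s', (Sound supp x s' ∧ Extends s s') →
        (Sound supp x (c.run I W s') ∧ Extends s (c.run I W s')) := by
      intro c hc s' hs'
      obtain ⟨q, -, rfl⟩ := List.mem_map.1 hc
      have e : s'.nat 4 0 = s.nat 4 0 := by rw [hs'.2.nat 4 le_rfl]
      obtain ⟨k₁, k₂, -⟩ := label_spec h hs'.1 (by rwa [e]) hTa (by rwa [e]) q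
      exact ⟨k₁, hs'.2.trans k₂⟩
    obtain ⟨k₁, k₂⟩ := run_seqList_induction (inv := fun s' => Sound supp x s' ∧ Extends s s')
      hstep ⟨hs, Extends.refl s⟩
    refine ⟨k₁, k₂, fun _ j hj hjg hjs => ?_⟩
    refine run_seqList_of_mem (inv := fun s' => Sound supp x s' ∧ Extends s s')
      (goal := fun s' => j ∈ s'.listed) hstep ?_
      (List.mem_map.2 ⟨lab j, Finset.mem_toList.2 (hT j hj hjg), rfl⟩) ?_ ⟨hs, Extends.refl s⟩
    · intro c hc s' hs' hj'
      obtain ⟨q, -, rfl⟩ := List.mem_map.1 hc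
      have e : s'.nat 4 0 = s.nat 4 0 := by rw [hs'.2.nat 4 le_rfl]
      exact (label_spec h hs'.1 (by rwa [e]) hTa (by rwa [e]) q).2.1.listed hj'
    · intro s' hs'
      have e : s'.nat 4 0 = s.nat 4 0 := by rw [hs'.2.nat 4 le_rfl]
      refine (label_spec h hs'.1 (by rwa [e]) hTa (by rwa [e]) (lab j)).2.2 j ?_
      ext k
      rw [Finset.mem_filter, Finset.mem_singleton, e, ← hjg]
      constructor
      · rintro ⟨hk, hkg, hkl⟩
        exact hjs k hk hkg hkl
      · rintro rfl
        exact ⟨hj, rfl, rfl⟩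
  · have hrun : (labelsCmd a T).run I W s = s := by
      rw [labelsCmd, Cmd.run, if_neg (fun hc => hT (htest.2 hc)), Cmd.run]
    rw [hrun]
    exact ⟨hs, Extends.refl s, fun hc => absurd hc hT⟩

/-- The entry has a label of its own in a group with at most `a` labels. -/
def Easy (supp : Finset ℕ) (grp lab : ℕ → ℕ) (a j : ℕ) : Prop :=
  (∀ k ∈ supp, grp k = grp j → lab k = lab j → k = j) ∧
    ((supp.filter fun k => grp k = grp j).image lab).card ≤ a

theorem parts_le (K d : ℕ) : parts K d ≤ K + 1 := by
  have := Nat.div_le_self K d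
  unfold parts
  omega

theorem next_spec {s : State} (hs : Sound supp x s) (hW : s.nat 4 0 < W) :
    Sound supp x (nextCmd.run I W s) ∧ (nextCmd.run I W s).nat 4 0 = s.nat 4 0 + 1 ∧
      (nextCmd.run I W s).listed = s.listed ∧ (nextCmd.run I W s).real = s.real ∧
      (nextCmd.run I W s).nat 0 = s.nat 0 ∧ (nextCmd.run I W s).nat 1 = s.nat 1 := by
  have hn : ∀ b, b ≠ 4 → (nextCmd.run I W s).nat b = s.nat b := by
    intro b hb
    funext i
    simp [nextCmd, Cmd.run, hb]
  refine ⟨hs.congr (fun b hb => hn b (by omega)) fun b _ => rfl, ?_, ?_, rfl, hn 0 (by norm_num),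
    hn 1 (by norm_num)⟩
  · simp [nextCmd, Cmd.run, counter, NExpr.eval]
    omega
  · rw [State.listed, State.listed, hn 0 (by norm_num), hn 1 (by norm_num)]

theorem group_spec (h : Decodable I W s₀ a Q p supp x u grp lab bk) (haQ : a ≤ Q) {s : State}
    (hs : Sound supp x s) (hg : s.nat 4 0 < parts I.K s₀) :
    Sound supp x ((groupCmd a Q).run I W s) ∧
      ((groupCmd a Q).run I W s).nat 4 0 = s.nat 4 0 + 1 ∧
      s.listed ⊆ ((groupCmd a Q).run I W s).listed ∧
      ∀ j ∈ supp, grp j = s.nat 4 0 → Easy supp grp lab a j →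
        j ∈ ((groupCmd a Q).run I W s).listed := by
  have hrun : (groupCmd a Q).run I W s = nextCmd.run I W ((seqList
    (((Finset.range Q).powersetCard a).toList.map (labelsCmd a))).run I W s) := rfl
  have hstep : ∀ c ∈ ((Finset.range Q).powersetCard a).toList.map (labelsCmd a), ∀ s',
      (Sound supp x s' ∧ Extends s s') →
      (Sound supp x (c.run I W s') ∧ Extends s (c.run I W s')) := by
    intro c hc s' hs'
    obtain ⟨T, hT, rfl⟩ := List.mem_map.1 hc
    obtain ⟨hTQ, hTa⟩ := Finset.mem_powersetCard.1 (Finset.mem_toList.1 hT)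
    have e : s'.nat 4 0 = s.nat 4 0 := by rw [hs'.2.nat 4 le_rfl]
    obtain ⟨k₁, k₂, -⟩ := labels_spec h hs'.1 (by rwa [e]) hTQ hTa
    exact ⟨k₁, hs'.2.trans k₂⟩
  obtain ⟨k₁, k₂⟩ := run_seqList_induction (inv := fun s' => Sound supp x s' ∧ Extends s s')
    hstep ⟨hs, Extends.refl s⟩
  have hcnt := congrFun (k₂.nat 4 le_rfl) 0
  have hlt := parts_le I.K s₀
  have hword := h.word
  obtain ⟨n₁, n₂, n₃, -⟩ := next_spec (I := I) (W := W) k₁ (by omega)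
  rw [hrun, n₂, n₃, hcnt]
  refine ⟨n₁, rfl, k₂.listed, fun j hj hjg hje => ?_⟩
  have hlabels : (supp.filter fun k => grp k = grp j).image lab ⊆ Finset.range Q := by
    intro q hq
    obtain ⟨k, hk, rfl⟩ := Finset.mem_image.1 hq
    exact Finset.mem_range.2 (h.lab_lt k (Finset.filter_subset _ _ hk))
  -- Only sets of size exactly `a` are tried, so the label set is padded to that size; `a ≤ Q`
  -- leaves room for it.
  obtain ⟨T, hT₁, hT₂, hTa⟩ := Finset.exists_subsuperset_card_eq hlabels hje.2
    (by rwa [Finset.card_range])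
  have hT : ∀ k ∈ supp, grp k = s.nat 4 0 → lab k ∈ T := fun k hk hkg =>
    hT₁ (Finset.mem_image_of_mem _ (Finset.mem_filter.2 ⟨hk, hkg.trans hjg.symm⟩))
  refine run_seqList_of_mem (inv := fun s' => Sound supp x s' ∧ Extends s s')
    (goal := fun s' => j ∈ s'.listed) hstep ?_
    (List.mem_map.2 ⟨T, Finset.mem_toList.2 (Finset.mem_powersetCard.2 ⟨hT₂, hTa⟩), rfl⟩) ?_
    ⟨hs, Extends.refl s⟩
  · intro c hc s' hs' hj'
    obtain ⟨T', hT', rfl⟩ := List.mem_map.1 hc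
    obtain ⟨hTQ, hTa⟩ := Finset.mem_powersetCard.1 (Finset.mem_toList.1 hT')
    have e : s'.nat 4 0 = s.nat 4 0 := by rw [hs'.2.nat 4 le_rfl]
    exact (labels_spec h hs'.1 (by rwa [e]) hTQ hTa).2.1.listed hj'
  · intro s' hs'
    have e : s'.nat 4 0 = s.nat 4 0 := by rw [hs'.2.nat 4 le_rfl]
    exact (labels_spec h hs'.1 (by rwa [e]) hT₂ hTa).2.2 (by rwa [e]) j hj (by rwa [e]) hje.1

theorem groupLoop_spec (h : Decodable I W s₀ a Q p supp x u grp lab bk) (haQ : a ≤ Q) {s : State}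
    (hs : Sound supp x s) (h0 : s.nat 4 0 = 0) :
    ∃ t s', t ≤ (parts I.K s₀ + 1) *
        ((Test.natLt counter (groupsExpr s₀)).cost + (groupCmd a Q).bound) ∧
      Exec I W (groupLoop s₀ a Q) s t s' ∧ Sound supp x s' ∧
      ∀ j ∈ supp, Easy supp grp lab a j → j ∈ s'.listed := by
  have htest : ∀ s : State, (Test.natLt counter (groupsExpr s₀)).holds I s ↔
      s.nat 4 0 < parts I.K s₀ := fun s => by
    simp [Test.holds, counter, groupsExpr, parts, NExpr.eval]
  have hloop := exec_while I W
    (b := .natLt counter (groupsExpr s₀)) (loopFree_groupCmd a Q) (parts I.K s₀)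
    (fun i s => Sound supp x s ∧ s.nat 4 0 = i ∧
      ∀ j ∈ supp, grp j < i → Easy supp grp lab a j → j ∈ s.listed) ?_ ?_
    (s := s) ⟨hs, h0, fun j _ hj => absurd hj (by omega)⟩
  · obtain ⟨t, s', i, ht, hex, ⟨hs', hi, hlist⟩, hend⟩ := hloop
    refine ⟨t, s', ht, hex, hs', fun j hj hje => hlist j hj ?_ hje⟩
    rw [htest, hi] at hend
    have := h.grp_lt j hj
    omega
  · rintro i s ⟨hs, rfl, hl⟩ hb
    obtain ⟨k₁, k₂, k₃, k₄⟩ := group_spec h haQ hs ((htest s).1 hb)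
    refine ⟨k₁, k₂, fun j hj hji hje => ?_⟩
    rcases Nat.lt_succ_iff_lt_or_eq.1 hji with hlt | heq
    · exact k₃ (hl j hj hlt hje)
    · exact k₄ j hj heq hje
  · rintro i s ⟨hs, rfl, hl⟩ hb
    exact (htest s).1 hb

end Correctness

section Correctness

variable {I : Input} {W s₀ a Q p : ℕ} {supp : Finset ℕ} {x : ℕ → ℂ} {u grp lab : ℕ → ℕ}
  {bk : ℕ → ℕ → ℕ}

/-! #### The buckets -/

/-- The cells of the bucket `i` hold the sums over the entries in `R`, and if `R` has a single
entry, then it has been found. -/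
structure Tracks (x : ℕ → ℂ) (u : ℕ → ℕ) (s : State) (i : ℕ) (R : Finset ℕ) : Prop where
  sum : (⟨s.real 3 i, s.real 4 i⟩ : ℂ) = ∑ j ∈ R, (u j * x j : ℂ)
  sumPos : (⟨s.real 5 i, s.real 6 i⟩ : ℂ) = ∑ j ∈ R, (j + 1 : ℂ) * (u j * x j)
  single : ∀ j, R = {j} → j ∈ s.listed

theorem Tracks.mono {s s' : State} {i : ℕ} {R : Finset ℕ} (h : Tracks x u s i R)
    (hr : ∀ b, 3 ≤ b → b ≤ 6 → s'.real b i = s.real b i) (hl : s.listed ⊆ s'.listed) :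
    Tracks x u s' i R := by
  refine ⟨?_, ?_, fun j hj => hl (h.single j hj)⟩
  · rw [hr 3 le_rfl (by norm_num), hr 4 (by norm_num) (by norm_num), h.sum]
  · rw [hr 5 (by norm_num) (by norm_num), hr 6 (by norm_num) le_rfl, h.sumPos]

theorem eval_bucketRow (s : State) (w : ℕ) :
    (bucketRow s₀ a w).eval I s = 5 + 3 * w + 6 * (parts I.K s₀ * (a + 1) + s.nat 4 0) := by
  simp [bucketRow, rowExpr, counter, groupsExpr, parts, NExpr.eval]

/-- The bucket is stored with all its entries, including those already found in the groups; they are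
subtracted later, when the peeling loop reaches them in the list. -/
theorem bucket_spec (h : Decodable I W s₀ a Q p supp x u grp lab bk) {s : State}
    (hs : Sound supp x s) (hi : s.nat 4 0 < 4 * parts I.K p) :
    Sound supp x ((bucketCmd s₀ a).run I W s) ∧
      ((bucketCmd s₀ a).run I W s).nat 4 0 = s.nat 4 0 + 1 ∧
      s.listed ⊆ ((bucketCmd s₀ a).run I W s).listed ∧
      (∀ b, 3 ≤ b → ∀ i, i ≠ s.nat 4 0 →
        ((bucketCmd s₀ a).run I W s).real b i = s.real b i) ∧
      Tracks x u ((bucketCmd s₀ a).run I W s) (s.nat 4 0)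
        (bucket supp bk (parts I.K p) (s.nat 4 0)) := by
  set D := bucket supp bk (parts I.K p) (s.nat 4 0) with hD
  set v : ℂ := I.value (5 + 3 * 0 + 6 * (parts I.K s₀ * (a + 1) + s.nat 4 0)) with hv
  set w : ℂ := I.value (5 + 3 * 1 + 6 * (parts I.K s₀ * (a + 1) + s.nat 4 0)) with hw
  set s₁ : State := (((s.setReal 3 (s.nat 4 0) v.re).setReal 4 (s.nat 4 0) v.im).setReal 5
    (s.nat 4 0) w.re).setReal 6 (s.nat 4 0) w.im with hs₁
  have hrun : (bucketCmd s₀ a).run I W s = nextCmd.run I W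
      ((Cmd.seq (loadBucketCmd counter) (decodeCmd 1)).run I W s₁) := by
    simp only [bucketCmd, Cmd.run, hs₁, hv, hw, eval_reExpr, eval_imExpr, eval_bucketRow]
    simp [counter, NExpr.eval]
  have hv' : v = ∑ j ∈ D, (u j * x j : ℂ) := by
    simpa using h.bucket_value _ hi 0 (by norm_num)
  have hw' : w = ∑ j ∈ D, (j + 1 : ℂ) * (u j * x j) := by
    simpa using h.bucket_value _ hi 1 (by norm_num)
  have hsound : Sound supp x s₁ := hs.congr (fun b _ => rfl) fun b hb => by
    funext i
    simp [hs₁, show b ≠ 3 by omega, show b ≠ 4 by omega, show b ≠ 5 by omega,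
      show b ≠ 6 by omega]
  have hreg : ∀ b, 3 ≤ b → (RExpr.load b counter).RegFree := by
    intro b hb I s i v
    simp [RExpr.eval, counter, NExpr.eval, show b ≠ 2 by omega]
  obtain ⟨k₁, k₂, k₃⟩ := load_decode_spec h hsound (D := D) (Finset.filter_subset _ _)
    (κ := 1) one_ne_zero (e₀ := .load 3 counter) (hreg 4 (by norm_num)) (hreg 5 (by norm_num))
    (hreg 6 (by norm_num))
    (by rw [Int.cast_one, one_mul, ← hv']; simp [RExpr.eval, counter, NExpr.eval, hs₁])
    (by rw [Int.cast_one, one_mul, ← hw']; simp [RExpr.eval, counter, NExpr.eval, hs₁])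
  have hcnt := congrFun (k₂.nat 4 le_rfl) 0
  have hcnt' : s₁.nat 4 0 = s.nat 4 0 := rfl
  have hlt := parts_le I.K p
  have hword := h.word
  obtain ⟨n₁, n₂, n₃, n₄, -⟩ := next_spec (I := I) (W := W) k₁ (by rw [hcnt, hcnt']; omega)
  rw [hrun]
  have hr : ∀ b, 3 ≤ b → (nextCmd.run I W ((Cmd.seq (loadCmd (.load 3 counter) (.load 4 counter)
      (.load 5 counter) (.load 6 counter)) (decodeCmd 1)).run I W s₁)).real b = s₁.real b := by
    intro b hb
    rw [n₄]
    exact k₂.real b hb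
  refine ⟨n₁, ?_, ?_, ?_, ?_, ?_, ?_⟩
  · rw [← hcnt', ← hcnt]
    exact n₂
  · exact (show s.listed = s₁.listed from rfl) ▸ n₃ ▸ k₂.listed
  · intro b hb i hi
    refine (congrFun (hr b hb) i).trans ?_
    simp [hs₁, hi]
  · refine Eq.trans ?_ hv'
    apply Complex.ext
    · exact (congrFun (hr 3 le_rfl) _).trans (by simp [hs₁])
    · exact (congrFun (hr 4 (by norm_num)) _).trans (by simp [hs₁])
  · refine Eq.trans ?_ hw'
    apply Complex.ext
    · exact (congrFun (hr 5 (by norm_num)) _).trans (by simp [hs₁])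
    · exact (congrFun (hr 6 (by norm_num)) _).trans (by simp [hs₁])
  · intro j hj
    exact n₃ ▸ k₃ j hj

theorem bucketLoop_spec (h : Decodable I W s₀ a Q p supp x u grp lab bk) {s : State}
    (hs : Sound supp x s) (h0 : s.nat 4 0 = 0) :
    ∃ t s', t ≤ (4 * parts I.K p + 1) *
        ((Test.natLt counter (.mul (.const 4) (bucketsExpr p))).cost + (bucketCmd s₀ a).bound) ∧
      Exec I W (bucketLoop s₀ a p) s t s' ∧ Sound supp x s' ∧ s.listed ⊆ s'.listed ∧
      ∀ i < 4 * parts I.K p, Tracks x u s' i (bucket supp bk (parts I.K p) i) := by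
  have htest : ∀ s : State,
      (Test.natLt counter (.mul (.const 4) (bucketsExpr p))).holds I s ↔
      s.nat 4 0 < 4 * parts I.K p := fun s => by
    simp [Test.holds, counter, bucketsExpr, parts, NExpr.eval]
  have hloop := exec_while I W
    (b := .natLt counter (.mul (.const 4) (bucketsExpr p))) (loopFree_bucketCmd s₀ a)
    (4 * parts I.K p)
    (fun i s' => Sound supp x s' ∧ s'.nat 4 0 = i ∧ s.listed ⊆ s'.listed ∧
      ∀ k < i, Tracks x u s' k (bucket supp bk (parts I.K p) k)) ?_ ?_
    (s := s) ⟨hs, h0, subset_rfl, fun j hj => absurd hj (by omega)⟩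
  · obtain ⟨t, s', i, ht, hex, ⟨hs', hi, hl, htr⟩, hend⟩ := hloop
    rw [htest, hi] at hend
    exact ⟨t, s', ht, hex, hs', hl, fun k hk => htr k (by omega)⟩
  · rintro i s' ⟨hs', rfl, hl, htr⟩ hb
    obtain ⟨k₁, k₂, k₃, k₄, k₅⟩ := bucket_spec h hs' ((htest s').1 hb)
    refine ⟨k₁, k₂, hl.trans k₃, fun k hk => ?_⟩
    rcases Nat.lt_succ_iff_lt_or_eq.1 hk with hlt | rfl
    · exact (htr k hlt).mono (fun b hb _ => k₄ b hb k hlt.ne) k₃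
    · exact k₅
  · rintro i s' ⟨hs', rfl, -⟩ hb
    exact (htest s').1 hb

/-! #### Peeling -/

/-- The list is extended, and the loop counter is kept. -/
structure Grows (s s' : State) : Prop where
  len : s.nat 0 0 ≤ s'.nat 0 0
  pos : ∀ l < s.nat 0 0, s'.nat 1 l = s.nat 1 l
  counter : s'.nat 4 0 = s.nat 4 0

theorem Grows.trans {s s' s'' : State} (h : Grows s s') (h' : Grows s' s'') : Grows s s'' :=
  ⟨h.len.trans h'.len, fun l hl => (h'.pos l (hl.trans_le h.len)).trans (h.pos l hl),
    h'.counter.trans h.counter⟩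

/-- The stored sums are linear, so subtracting the known term of the current entry deletes it from
its bucket, which is then decoded again. Other buckets keep their contents, and their single entries
stay listed as the list only grows. -/
theorem peel_spec (h : Decodable I W s₀ a Q p supp x u grp lab bk) {s : State}
    (hs : Sound supp x s) (hc : s.nat 4 0 < s.nat 0 0) {t : ℕ} (ht : t < 4)
    {R : ℕ → Finset ℕ} (hR : ∀ i, R i ⊆ supp)
    (htr : ∀ i < 4 * parts I.K p, Tracks x u s i (R i))
    (hmem : s.nat 1 (s.nat 4 0) ∈ R (t * parts I.K p + bk t (s.nat 1 (s.nat 4 0)))) :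
    Sound supp x ((peelCmd p t).run I W s) ∧ Grows s ((peelCmd p t).run I W s) ∧
      ∀ i < 4 * parts I.K p, Tracks x u ((peelCmd p t).run I W s) i
        (if i = t * parts I.K p + bk t (s.nat 1 (s.nat 4 0)) then
          (R i).erase (s.nat 1 (s.nat 4 0)) else R i) := by
  set c := s.nat 4 0 with hcdef
  set j := s.nat 1 c with hj
  set B := parts I.K p with hB
  set i₀ := t * B + bk t j with hi₀
  have hjs : j ∈ supp := hs.mem c hc
  have hlt := parts_le I.K p
  have hword := h.word
  have hbk := h.bk_lt t ht j hjs
  have hi₀lt : i₀ < 4 * B := by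
    have : (t + 1) * B ≤ 4 * B := Nat.mul_le_mul_right _ ht
    rw [add_mul, one_mul] at this
    omega
  have hfloor : min ⌊(I.entry (1 + t) j).re⌋₊ W = bk t j := by
    rw [h.entry_bk t ht j hjs, Nat.floor_natCast]
    omega
  set z : ℂ := u j * x j with hz
  have hxj : x j = ⟨s.real 0 c, s.real 1 c⟩ := (hs.val c hc).symm
  have hzre : z.re = (I.entry 0 j).re * s.real 0 c := by
    rw [hz, h.entry_u j hjs, hxj, ← Complex.ofReal_natCast, Complex.re_ofReal_mul]
  have hzim : z.im = (I.entry 0 j).re * s.real 1 c := by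
    rw [hz, h.entry_u j hjs, hxj, ← Complex.ofReal_natCast, Complex.im_ofReal_mul]
  set s₁ : State := ((((s.setNat 5 0 (bk t j)).setReal 3 i₀ (s.real 3 i₀ - z.re)).setReal 4 i₀
    (s.real 4 i₀ - z.im)).setReal 5 i₀ (s.real 5 i₀ - (j + 1) * z.re)).setReal 6 i₀
    (s.real 6 i₀ - (j + 1) * z.im) with hs₁
  have hrun : (peelCmd p t).run I W s =
      (Cmd.seq (loadBucketCmd (curBucket p t)) (decodeCmd 1)).run I W s₁ := by
    have e2 : (curBucket p t).eval I (s.setNat 5 0 (bk t j)) = i₀ := by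
      simp [curBucket, NExpr.eval, bucketsExpr, hi₀, hB, parts]
    have e3 : curPos.eval I (s.setNat 5 0 (bk t j)) = j := by
      simp [curPos, NExpr.eval, counter, hj, hcdef]
    have e4 : counter.eval I (s.setNat 5 0 (bk t j)) = c := by
      simp [NExpr.eval, counter, hcdef]
    have e5 : (Cmd.setFloor 5 z0 (.entryRe (.const (1 + t)) curPos)).run I W s =
        s.setNat 5 0 (bk t j) := by
      simp [Cmd.run, RExpr.eval, NExpr.eval, curPos, counter, ← hcdef, ← hj, hfloor]
    rw [peelCmd, Cmd.run, e5]
    simp only [Cmd.run, RExpr.eval, NExpr.eval_setReal, e2, e3, e4, hs₁, hzre, hzim]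
    simp [NExpr.eval, State.setReal_real]
  have hsound : Sound supp x s₁ := by
    refine hs.congr (fun b hb => ?_) fun b hb => ?_
    · funext i
      simp [hs₁, show b ≠ 5 by omega]
    · funext i
      simp [hs₁, show b ≠ 3 by omega, show b ≠ 4 by omega, show b ≠ 5 by omega,
        show b ≠ 6 by omega]
  have hreg : ∀ b, 3 ≤ b → (RExpr.load b (curBucket p t)).RegFree := by
    intro b hb I s i v
    simp [RExpr.eval, curBucket, bucketsExpr, NExpr.eval, show b ≠ 2 by omega]
  have hidx : (curBucket p t).eval I s₁ = i₀ := by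
    simp [curBucket, NExpr.eval, bucketsExpr, hs₁, hi₀, hB, parts]
  have htr₀ := htr i₀ hi₀lt
  have hV : (⟨s₁.real 3 i₀, s₁.real 4 i₀⟩ : ℂ) = ∑ k ∈ (R i₀).erase j, (u k * x k : ℂ) := by
    rw [Finset.sum_erase_eq_sub hmem, ← htr₀.sum]
    apply Complex.ext <;> simp [hs₁, hz]
  have hW : (⟨s₁.real 5 i₀, s₁.real 6 i₀⟩ : ℂ) =
      ∑ k ∈ (R i₀).erase j, (k + 1 : ℂ) * (u k * x k) := by
    rw [Finset.sum_erase_eq_sub hmem, ← htr₀.sumPos, ← hz]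
    have : (j + 1 : ℂ) = ((j + 1 : ℝ) : ℂ) := by push_cast; rfl
    apply Complex.ext
    · rw [Complex.sub_re, this, Complex.re_ofReal_mul]
      simp [hs₁]
    · rw [Complex.sub_im, this, Complex.im_ofReal_mul]
      simp [hs₁]
  obtain ⟨k₁, k₂, k₃⟩ := load_decode_spec h hsound (D := (R i₀).erase j)
    ((Finset.erase_subset _ _).trans (hR _)) (κ := 1) one_ne_zero (e₀ := .load 3 (curBucket p t))
    (hreg 4 (by norm_num)) (hreg 5 (by norm_num)) (hreg 6 (by norm_num))
    (by simpa [RExpr.eval, hidx] using hV) (by simpa [RExpr.eval, hidx] using hW)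
  rw [hrun]
  have hl : s.listed ⊆ s₁.listed := by
    intro k hk
    simpa [State.mem_listed, hs₁] using hk
  refine ⟨k₁, ⟨k₂.len, k₂.pos, congrFun (k₂.nat 4 le_rfl) 0⟩, fun i hi => ?_⟩
  by_cases hii : i = i₀
  · rw [if_pos hii, hii]
    refine ⟨?_, ?_, fun k hk => k₃ k hk⟩
    · rw [← hV]
      apply Complex.ext
      · exact congrFun (k₂.real 3 le_rfl) _
      · exact congrFun (k₂.real 4 (by norm_num)) _
    · rw [← hW]
      apply Complex.ext
      · exact congrFun (k₂.real 5 (by norm_num)) _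
      · exact congrFun (k₂.real 6 (by norm_num)) _
  · rw [if_neg hii]
    refine (htr i hi).mono (fun b hb _ => ?_) (hl.trans k₂.listed)
    refine (congrFun (k₂.real b hb) i).trans ?_
    simp [hs₁, hii]

end Correctness

/-! ### The peeling loop and the whole decoder -/

section Correctness

variable {I : Input} {W s₀ a Q p : ℕ} {supp : Finset ℕ} {x : ℕ → ℂ} {u grp lab : ℕ → ℕ}
  {bk : ℕ → ℕ → ℕ}

/-- What is left in the buckets when the positions `P` have been removed from all tables, and the
position `j` from the first `t` tables. -/
def peelRest (supp : Finset ℕ) (bk : ℕ → ℕ → ℕ) (B : ℕ) (P : Finset ℕ) (j t i : ℕ) : Finset ℕ :=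
  if i / B < t then bucket supp bk B i \ insert j P else bucket supp bk B i \ P

/-- The bucket index divided by the table size is the table, so among the buckets of table `t` only
the one that contains `j` has to change. -/
theorem peel_step (h : Decodable I W s₀ a Q p supp x u grp lab bk) {s : State}
    (hs : Sound supp x s) (hc : s.nat 4 0 < s.nat 0 0) {j : ℕ} (hj : s.nat 1 (s.nat 4 0) = j)
    {P : Finset ℕ} (hjP : j ∉ P) {t : ℕ} (ht : t < 4)
    (htr : ∀ i < 4 * parts I.K p, Tracks x u s i (peelRest supp bk (parts I.K p) P j t i)) :
    Sound supp x ((peelCmd p t).run I W s) ∧ Grows s ((peelCmd p t).run I W s) ∧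
      ∀ i < 4 * parts I.K p, Tracks x u ((peelCmd p t).run I W s) i
        (peelRest supp bk (parts I.K p) P j (t + 1) i) := by
  have hjs : j ∈ supp := hj ▸ hs.mem _ hc
  have hbk := h.bk_lt t ht j hjs
  have hB : 0 < parts I.K p := Nat.succ_pos _
  have hdiv : (t * parts I.K p + bk t j) / parts I.K p = t := by
    rw [mul_comm, Nat.mul_add_div hB, Nat.div_eq_of_lt hbk, add_zero]
  have hmod : (t * parts I.K p + bk t j) % parts I.K p = bk t j := by
    rw [mul_comm, Nat.mul_add_mod, Nat.mod_eq_of_lt hbk]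
  have hspec := peel_spec h hs hc ht
    (R := peelRest supp bk (parts I.K p) P j t) ?_ htr ?_
  · obtain ⟨k₁, k₂, k₃⟩ := hspec
    refine ⟨k₁, k₂, fun i hi => ?_⟩
    have := k₃ i hi
    rw [hj] at this
    convert this using 1
    have hmem : j ∈ bucket supp bk (parts I.K p) i ↔ bk (i / parts I.K p) j = i % parts I.K p := by
      simp [bucket, hjs]
    by_cases hii : i = t * parts I.K p + bk t j
    · have hit : i / parts I.K p = t := by rw [hii, hdiv]
      rw [if_pos hii, peelRest, peelRest, hit, if_pos (Nat.lt_succ_self t),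
        if_neg (lt_irrefl t)]
      ext k
      simp only [Finset.mem_sdiff, Finset.mem_insert, Finset.mem_erase]
      tauto
    · rw [if_neg hii, peelRest, peelRest]
      rcases lt_trichotomy (i / parts I.K p) t with hlt | heq | hgt
      · rw [if_pos (by omega), if_pos hlt]
      -- In the other buckets of table `t`, removing `j` in addition to `P` makes no difference.
      · have hnm : j ∉ bucket supp bk (parts I.K p) i := by
          rw [hmem, heq]
          intro hc
          apply hii
          rw [hc, ← heq, mul_comm]
          exact (Nat.div_add_mod i (parts I.K p)).symm
        rw [if_pos (by omega), if_neg (by omega)]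
        ext k
        simp only [Finset.mem_sdiff, Finset.mem_insert]
        constructor
        · tauto
        · rintro ⟨h1, h2⟩
          refine ⟨h1, ?_⟩
          rintro (rfl | h3)
          · exact hnm h1
          · exact h2 h3
      · rw [if_neg (by omega), if_neg (by omega)]
  · intro i
    unfold peelRest
    split_ifs <;> exact Finset.sdiff_subset.trans (Finset.filter_subset _ _)
  · rw [hj, peelRest, hdiv, if_neg (lt_irrefl t)]
    simp [bucket, hjs, hjP, hdiv, hmod]

/-- The output list doubles as the work queue: the processed prefix is the set removed from the
buckets. Positions in the list are distinct, so no entry is removed twice. -/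
theorem entry_spec (h : Decodable I W s₀ a Q p supp x u grp lab bk) {s : State}
    (hs : Sound supp x s) (hc : s.nat 4 0 < s.nat 0 0)
    (htr : ∀ i < 4 * parts I.K p, Tracks x u s i
      (bucket supp bk (parts I.K p) i \ (Finset.range (s.nat 4 0)).image (s.nat 1))) :
    Sound supp x ((entryCmd p).run I W s) ∧
      ((entryCmd p).run I W s).nat 4 0 = s.nat 4 0 + 1 ∧
      s.nat 4 0 + 1 ≤ ((entryCmd p).run I W s).nat 0 0 ∧
      s.listed ⊆ ((entryCmd p).run I W s).listed ∧
      ∀ i < 4 * parts I.K p, Tracks x u ((entryCmd p).run I W s) i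
        (bucket supp bk (parts I.K p) i \
          (Finset.range (s.nat 4 0 + 1)).image (((entryCmd p).run I W s).nat 1)) := by
  obtain ⟨j, hj⟩ : ∃ j, s.nat 1 (s.nat 4 0) = j := ⟨_, rfl⟩
  set P := (Finset.range (s.nat 4 0)).image (s.nat 1) with hP
  have hjP : j ∉ P := by
    intro hmem
    obtain ⟨l, hl, hlj⟩ := Finset.mem_image.1 hmem
    rw [Finset.mem_range] at hl
    exact hl.ne (hs.inj l (hl.trans hc) _ hc (hlj.trans hj.symm))
  have htr₀ : ∀ i < 4 * parts I.K p, Tracks x u s i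
      (peelRest supp bk (parts I.K p) P j 0 i) := by
    intro i hi
    rw [peelRest, if_neg (Nat.not_lt_zero _)]
    exact htr i hi
  have move : ∀ {s' : State}, Grows s s' → s'.nat 4 0 < s'.nat 0 0 ∧
      s'.nat 1 (s'.nat 4 0) = j := by
    intro s' hg
    rw [hg.counter, hg.pos _ hc]
    exact ⟨hc.trans_le hg.len, hj⟩
  obtain ⟨a₁, g₁, t₁⟩ := peel_step h hs hc hj hjP (by norm_num) htr₀
  obtain ⟨a₂, g₂, t₂⟩ := peel_step h a₁ (move g₁).1 (move g₁).2 hjP (by norm_num) t₁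
  have g₂' := g₁.trans g₂
  obtain ⟨a₃, g₃, t₃⟩ := peel_step h a₂ (move g₂').1 (move g₂').2 hjP (by norm_num) t₂
  have g₃' := g₂'.trans g₃
  obtain ⟨a₄, g₄, t₄⟩ := peel_step h a₃ (move g₃').1 (move g₃').2 hjP (by norm_num) t₃
  have g₄' := g₃'.trans g₄
  have hlen := hs.length_le.trans h.card_le
  have hword := h.word
  obtain ⟨n₁, n₂, n₃, n₄, n₅, n₆⟩ := next_spec (I := I) (W := W) a₄
    (by rw [g₄'.counter]; omega)
  have hrun : (entryCmd p).run I W s = nextCmd.run I W ((peelCmd p 3).run I W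
    ((peelCmd p 2).run I W ((peelCmd p 1).run I W ((peelCmd p 0).run I W s)))) := rfl
  rw [hrun]
  refine ⟨n₁, n₂.trans (by rw [g₄'.counter]), ?_, ?_, ?_⟩
  · rw [n₅]
    exact (Nat.succ_le_of_lt hc).trans g₄'.len
  · rw [n₃]
    intro k hk
    obtain ⟨l, hl, rfl⟩ := State.mem_listed.1 hk
    exact State.mem_listed.2 ⟨l, hl.trans_le g₄'.len, g₄'.pos l hl⟩
  · intro i hi
    have him : (Finset.range (s.nat 4 0 + 1)).image ((nextCmd.run I W ((peelCmd p 3).run I W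
        ((peelCmd p 2).run I W ((peelCmd p 1).run I W ((peelCmd p 0).run I W s))))).nat 1) =
        insert j P := by
      rw [n₆, Finset.range_add_one, Finset.image_insert, g₄'.pos _ hc, hj, hP]
      congr 1
      refine Finset.image_congr fun l hl => g₄'.pos l ?_
      have : l < s.nat 4 0 := by simpa using hl
      exact this.trans hc
    rw [him]
    have := t₄ i hi
    rw [peelRest, if_pos (Nat.div_lt_of_lt_mul (by rw [mul_comm]; exact hi))] at this
    exact this.mono (fun b _ _ => by rw [n₄]) n₃.symm.subset

/-- The loop ends when the counter has caught up with the list, which never exceeds the support.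
Every listed entry has then been removed, and a bucket with a single remaining entry would have had
it listed. -/
theorem peelLoop_spec (h : Decodable I W s₀ a Q p supp x u grp lab bk) {s : State}
    (hs : Sound supp x s) (h0 : s.nat 4 0 = 0)
    (htr : ∀ i < 4 * parts I.K p, Tracks x u s i (bucket supp bk (parts I.K p) i)) :
    ∃ t s', t ≤ (I.K + 1) *
        ((Test.natLt counter (.load 0 z0)).cost + (entryCmd p).bound) ∧
      Exec I W (peelLoop p) s t s' ∧ Sound supp x s' ∧ s.listed ⊆ s'.listed ∧
      ∀ i < 4 * parts I.K p, ∀ j, bucket supp bk (parts I.K p) i \ s'.listed ≠ {j} := by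
  have htest : ∀ s : State, (Test.natLt counter (.load 0 z0)).holds I s ↔
      s.nat 4 0 < s.nat 0 0 := fun s => by
    simp [Test.holds, counter, NExpr.eval]
  have hloop := exec_while I W
    (b := .natLt counter (.load 0 z0)) (loopFree_entryCmd p) I.K
    (fun c s' => Sound supp x s' ∧ s'.nat 4 0 = c ∧ c ≤ s'.nat 0 0 ∧ s.listed ⊆ s'.listed ∧
      ∀ i < 4 * parts I.K p, Tracks x u s' i
        (bucket supp bk (parts I.K p) i \ (Finset.range c).image (s'.nat 1))) ?_ ?_
    (s := s) ⟨hs, h0, Nat.zero_le _, subset_rfl, by simpa using htr⟩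
  · obtain ⟨t, s', c, ht, hex, ⟨hs', hc, hcl, hl, htr'⟩, hend⟩ := hloop
    refine ⟨t, s', ht, hex, hs', hl, fun i hi j hij => ?_⟩
    rw [htest, hc] at hend
    have hc' : c = s'.nat 0 0 := by omega
    have hsingle := (htr' i hi).single j
    rw [hc'] at hsingle
    have hjl := hsingle hij
    have : j ∈ bucket supp bk (parts I.K p) i \ s'.listed := by simp [hij]
    exact (Finset.mem_sdiff.1 this).2 hjl
  · rintro c s' ⟨hs', rfl, hcl, hl, htr'⟩ hb
    obtain ⟨k₁, k₂, k₃, k₄, k₅⟩ := entry_spec h hs' ((htest s').1 hb) htr'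
    exact ⟨k₁, k₂, k₃, hl.trans k₄, k₅⟩
  · rintro c s' ⟨hs', rfl, -⟩ hb
    exact ((htest s').1 hb).trans_le (hs'.length_le.trans h.card_le)

/-- The constant in the running time of the decoder. -/
def timeConst (s₀ a Q p : ℕ) : ℕ :=
  3 * ((Test.natLt counter (groupsExpr s₀)).cost + (groupCmd a Q).bound) +
    9 * ((Test.natLt counter (.mul (.const 4) (bucketsExpr p))).cost + (bucketCmd s₀ a).bound) +
    2 * ((Test.natLt counter (.load 0 z0)).cost + (entryCmd p).bound) + 6

theorem reset_spec {s : State} (hs : Sound supp x s) :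
    Sound supp x (s.setNat 4 0 0) ∧ (s.setNat 4 0 0).nat 4 0 = 0 ∧
      (s.setNat 4 0 0).listed = s.listed ∧ Exec I W resetCmd s 3 (s.setNat 4 0 0) := by
  refine ⟨hs.congr (fun b hb => ?_) fun b _ => rfl, by simp, ?_, ?_⟩
  · funext i
    simp [show b ≠ 4 by omega]
  · ext
    simp [State.mem_listed]
  · simpa [resetCmd, NExpr.eval, NExpr.cost] using Exec.setNat (I := I) (W := W) 4 z0 z0 s

/-- The decoder finds the signal, if no set of entries that are not easy meets every bucket in
none or in at least two entries. -/
theorem decoder_spec (h : Decodable I W s₀ a Q p supp x u grp lab bk) (haQ : a ≤ Q)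
    (hK : 1 ≤ I.K) (hx : ∀ j ∉ supp, x j = 0)
    (hpeel : ∀ D ⊆ supp, D.Nonempty → (∀ j ∈ D, ¬ Easy supp grp lab a j) →
      ∃ i < 4 * parts I.K p, ∃ j,
        (D.filter fun k => bk (i / parts I.K p) k = i % parts I.K p) = {j}) :
    ∃ t s, t ≤ timeConst s₀ a Q p * I.K ∧ Exec I W (decoder s₀ a Q p) State.init t s ∧
      ∀ j : Fin I.n, s.output I.n j = x j := by
  have hinit : Sound supp x State.init := by
    refine ⟨?_, ?_, ?_, ?_⟩ <;> simp [State.init, State.listed]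
  obtain ⟨t₁, s₁, ht₁, e₁, hs₁, heasy⟩ := groupLoop_spec h haQ hinit rfl
  obtain ⟨r₁, r₂, r₃, r₄⟩ := reset_spec (I := I) (W := W) hs₁
  obtain ⟨t₂, s₂, ht₂, e₂, hs₂, hl₂, htr₂⟩ := bucketLoop_spec h r₁ r₂
  obtain ⟨q₁, q₂, q₃, q₄⟩ := reset_spec (I := I) (W := W) hs₂
  obtain ⟨t₃, s₃, ht₃, e₃, hs₃, hl₃, hend⟩ := peelLoop_spec h q₁ q₂ fun i hi =>
    (htr₂ i hi).mono (fun _ _ _ => rfl) q₃.symm.subset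
  refine ⟨_, s₃, ?_, .seq e₁ (.seq r₄ (.seq e₂ (.seq q₄ e₃))), fun j => ?_⟩
  · have hG := parts_le I.K s₀
    have hB := parts_le I.K p
    -- The factors `3`, `9` and `2` of `timeConst` come from `K + 2 ≤ 3K`, `4 (K + 1) + 1 ≤ 9K` and
    -- `K + 1 ≤ 2K` for `K ≥ 1`; the two resets cost `3` each.
    have h1 := ht₁.trans (Nat.mul_le_mul_right _ (show parts I.K s₀ + 1 ≤ I.K * 3 by omega))
    have h2 := ht₂.trans (Nat.mul_le_mul_right _ (show 4 * parts I.K p + 1 ≤ I.K * 9 by omega))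
    have h3 := ht₃.trans (Nat.mul_le_mul_right _ (show I.K + 1 ≤ I.K * 2 by omega))
    calc _ ≤ _ := add_le_add h1 (add_le_add (show 3 ≤ I.K * 3 by omega)
          (add_le_add h2 (add_le_add (show 3 ≤ I.K * 3 by omega) h3)))
      _ = _ := by
        rw [timeConst]
        ring
  · refine hs₃.output_eq ?_ hx _ j
    by_contra hcon
    have hD : (supp \ s₃.listed).Nonempty := by
      rwa [Finset.nonempty_iff_ne_empty, Ne, Finset.sdiff_eq_empty_iff_subset]
    -- The missing entries contain no easy one, as those were found in the groups. If any were
    -- missing, the peeling hypothesis would provide a bucket with exactly one of them, contrary to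
    -- the end state of the loop.
    have hres := hpeel (supp \ s₃.listed) Finset.sdiff_subset hD ?_
    · obtain ⟨i, hi, k, hk⟩ := hres
      refine hend i hi k ?_
      rw [← hk]
      ext l
      simp only [bucket, Finset.mem_sdiff, Finset.mem_filter]
      tauto
    · intro l hl hle
      obtain ⟨hls, hln⟩ := Finset.mem_sdiff.1 hl
      exact hln (hl₃ (q₃.symm ▸ hl₂ (r₃.symm ▸ heasy l hls hle)))

end Correctness

/-! ### The measurement matrix -/

/-- The coefficient of the position `j` in the linear measurement `e`: the measurements
`g * (a + 1) + k` with `g < G` and `k ≤ a` belong to the group `g`, the further ones to buckets. -/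
def designCoeff (G a B : ℕ) (grp lab : ℕ → ℕ) (bk : ℕ → ℕ → ℕ) (e j : ℕ) : ℂ :=
  if e < G * (a + 1) then if grp j = e / (a + 1) then (lab j : ℂ) ^ (e % (a + 1)) else 0
  else if bk ((e - G * (a + 1)) / B) j = (e - G * (a + 1)) % B then 1 else 0

/-- The entry of the measurement matrix at `(i, j)`.  Row `0` is the reference measurement, the
rows `1` to `4` hold the buckets of the positions, and then each linear measurement, and the
same measurement weighted by the positions, has three rows: itself, and itself with the reference
measurement and with its rotation added. -/
def designEntry (G a B : ℕ) (u grp lab : ℕ → ℕ) (bk : ℕ → ℕ → ℕ) (i j : ℕ) : ℂ :=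
  if i = 0 then u j else if i < 5 then bk (i - 1) j else
    u j * (designCoeff G a B grp lab bk ((i - 5) / 6) j * (j + 1 : ℂ) ^ ((i - 5) / 3 % 2) +
      if (i - 5) % 3 = 0 then 0 else if (i - 5) % 3 = 1 then 1 else Complex.I)

/-- The measurement matrix. -/
def design (G a B : ℕ) (u grp lab : ℕ → ℕ) (bk : ℕ → ℕ → ℕ) (m n : ℕ) :
    Matrix (Fin m) (Fin n) ℂ :=
  fun i j => designEntry G a B u grp lab bk i j

/-- The signal, continued by zero. -/
def extend {n : ℕ} (x : Fin n → ℂ) (j : ℕ) : ℂ := if h : j < n then x ⟨j, h⟩ else 0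

/-- The positions of the non-zero components. -/
def support {n : ℕ} (x : Fin n → ℂ) : Finset ℕ :=
  ((Finset.univ.filter fun j => x j ≠ 0).image Fin.val)

theorem extend_val {n : ℕ} (x : Fin n → ℂ) (j : Fin n) : extend x j = x j := by
  simp [extend]

theorem card_support {n : ℕ} (x : Fin n → ℂ) : (support x).card = numNonzero x := by
  classical
  rw [support, Finset.card_image_of_injective _ Fin.val_injective, numNonzero]

theorem mem_support {n : ℕ} {x : Fin n → ℂ} {j : ℕ} : j ∈ support x ↔ extend x j ≠ 0 := by
  constructor
  · intro hj
    obtain ⟨k, hk, rfl⟩ := Finset.mem_image.1 hj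
    rw [extend_val]
    exact (Finset.mem_filter.1 hk).2
  · intro hj
    by_cases h : j < n
    · refine Finset.mem_image.2 ⟨⟨j, h⟩, Finset.mem_filter.2 ⟨Finset.mem_univ _, ?_⟩, rfl⟩
      simpa [extend, h] using hj
    · simp [extend, h] at hj

theorem lt_of_mem_support {n : ℕ} {x : Fin n → ℂ} {j : ℕ} (h : j ∈ support x) : j < n := by
  obtain ⟨k, -, rfl⟩ := Finset.mem_image.1 h
  exact k.2

theorem sum_mul_eq_sum_support {n : ℕ} (x : Fin n → ℂ) (f : ℕ → ℂ) :
    ∑ j : Fin n, f j * x j = ∑ j ∈ support x, f j * extend x j := by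
  have h1 : ∑ j : Fin n, f j * x j = ∑ j : Fin n, (fun j => f j * extend x j) (j : ℕ) := by
    refine Finset.sum_congr rfl fun j _ => ?_
    simp only [extend_val]
  rw [h1, Fin.sum_univ_eq_sum_range (fun j => f j * extend x j)]
  refine (Finset.sum_subset (fun j hj => Finset.mem_range.2 (lt_of_mem_support hj)) ?_).symm
  intro j _ hj
  rw [mem_support, not_not] at hj
  rw [hj, mul_zero]

/-- Polarization against a reference `R`, which is rotated to the positive axis. -/
theorem polarization_re {v R φ : ℂ} (hφ : ‖φ‖ = 1) (hR : φ * R = ‖R‖) (hR0 : R ≠ 0) :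
    (‖v + R‖ * ‖v + R‖ - ‖v‖ * ‖v‖ - ‖R‖ * ‖R‖) / (2 * ‖R‖) = (φ * v).re := by
  have h1 : ‖v + R‖ = ‖φ * v + ‖R‖‖ := by
    rw [← hR, ← mul_add, norm_mul, hφ, one_mul]
  have h2 : ‖v‖ = ‖φ * v‖ := by rw [norm_mul, hφ, one_mul]
  have h3 : ‖R‖ ≠ 0 := norm_ne_zero_iff.2 hR0
  rw [h1, h2, Complex.norm_mul_self_eq_normSq, Complex.norm_mul_self_eq_normSq,
    Complex.normSq_apply, Complex.normSq_apply, Complex.add_re, Complex.add_im,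
    Complex.ofReal_re, Complex.ofReal_im, div_eq_iff (by positivity)]
  ring

/-- The imaginary part of a number is the real part of `-i` times it, so the real case applies to
`-i v`. -/
theorem polarization_im {v R φ : ℂ} (hφ : ‖φ‖ = 1) (hR : φ * R = ‖R‖) (hR0 : R ≠ 0) :
    (‖v + Complex.I * R‖ * ‖v + Complex.I * R‖ - ‖v‖ * ‖v‖ - ‖R‖ * ‖R‖) / (2 * ‖R‖) =
      (φ * v).im := by
  have h1 : v + Complex.I * R = Complex.I * (-Complex.I * v + R) := by
    linear_combination v * Complex.I_mul_I
  have h2 : ‖v‖ = ‖-Complex.I * v‖ := by simp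
  rw [h1, norm_mul, Complex.norm_I, one_mul, h2, polarization_re hφ hR hR0]
  simp [add_comm]

theorem exists_rotation (R : ℂ) : ∃ φ : ℂ, ‖φ‖ = 1 ∧ φ * R = ‖R‖ := by
  by_cases hR : R = 0
  · exact ⟨1, by simp, by simp [hR]⟩
  · have h : (‖R‖ : ℂ) ≠ 0 := by exact_mod_cast norm_ne_zero_iff.2 hR
    refine ⟨‖R‖ / R, ?_, div_mul_cancel₀ _ hR⟩
    rw [norm_div, Complex.norm_real, norm_norm, div_self (norm_ne_zero_iff.2 hR)]

/-! ### What the decoder reads from the design -/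

section Design

variable {K n m s₀ a Q p : ℕ} {u grp lab : ℕ → ℕ} {bk : ℕ → ℕ → ℕ} {x : Fin n → ℂ}

theorem meas_design {G B : ℕ} {i : ℕ} (hi : i < m) :
    (⟨K, n, m, design G a B u grp lab bk m n,
      magnitudes (design G a B u grp lab bk m n) x⟩ : Input).meas i =
      ‖∑ j ∈ support x, designEntry G a B u grp lab bk i j * extend x j‖ := by
  rw [Input.meas, dif_pos hi]
  show ‖∑ j : Fin n, design G a B u grp lab bk m n ⟨i, hi⟩ j * x j‖ = _
  rw [← sum_mul_eq_sum_support]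
  rfl

/-- The reference measurement. -/
def reference (u : ℕ → ℕ) (x : Fin n → ℂ) : ℂ := ∑ j ∈ support x, (u j : ℂ) * extend x j

/-- The three rows of a functional have coefficients `v`, `v + R` and `v + iR`, as required by
polarization. The rotation `φ` depends on `R` only, so all functionals see the same signal `φ x`. -/
theorem value_design {G B : ℕ} {φ : ℂ} (hφ : ‖φ‖ = 1)
    (hR : φ * reference u x = ‖reference u x‖)
    (hR0 : reference u x = 0 → support x = ∅) {e w : ℕ} (hw : w < 2) (hm : 6 * e + 11 ≤ m) :
    (⟨K, n, m, design G a B u grp lab bk m n,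
      magnitudes (design G a B u grp lab bk m n) x⟩ : Input).value (5 + 3 * w + 6 * e) =
      ∑ j ∈ support x, designCoeff G a B grp lab bk e j *
        ((j + 1 : ℂ) ^ w * (u j * (φ * extend x j))) := by
  set I : Input := ⟨K, n, m, design G a B u grp lab bk m n,
    magnitudes (design G a B u grp lab bk m n) x⟩ with hI
  set R := reference u x with hRdef
  set v := ∑ j ∈ support x, (u j * (designCoeff G a B grp lab bk e j * (j + 1 : ℂ) ^ w)) *
    extend x j with hv
  have e0 : I.meas 0 = ‖R‖ := by
    rw [meas_design (by omega), hRdef, reference]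
    simp [designEntry]
  have row : ∀ r < 3, I.meas (5 + 3 * w + 6 * e + r) =
      ‖v + (if r = 0 then 0 else if r = 1 then 1 else Complex.I) * R‖ := by
    intro r hr
    rw [meas_design (by omega), hv, hRdef, reference, Finset.mul_sum, ← Finset.sum_add_distrib]
    congr 1
    refine Finset.sum_congr rfl fun j _ => ?_
    rw [designEntry, if_neg (by omega), if_neg (by omega),
      show (5 + 3 * w + 6 * e + r - 5) / 6 = e by omega,
      show (5 + 3 * w + 6 * e + r - 5) / 3 % 2 = w by omega,
      show (5 + 3 * w + 6 * e + r - 5) % 3 = r by omega]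
    ring
  have r0 : I.meas (5 + 3 * w + 6 * e) = ‖v‖ := by simpa using row 0 (by norm_num)
  have r1 : I.meas (5 + 3 * w + 6 * e + 1) = ‖v + R‖ := by simpa using row 1 (by norm_num)
  have r2 : I.meas (5 + 3 * w + 6 * e + 2) = ‖v + Complex.I * R‖ := by
    simpa using row 2 (by norm_num)
  have hval : I.value (5 + 3 * w + 6 * e) = φ * v := by
    rw [Input.value, e0, r0, r1, r2]
    -- A vanishing reference means a zero signal; the decoder then divides by zero and obtains the
    -- correct value `0`.
    by_cases hR' : R = 0
    · have hv0 : v = 0 := by rw [hv, hR0 hR', Finset.sum_empty]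
      rw [hR', hv0]
      apply Complex.ext <;> simp
    · rw [polarization_re hφ hR hR', polarization_im hφ hR hR']
  rw [hval, hv, Finset.mul_sum]
  refine Finset.sum_congr rfl fun j _ => ?_
  ring

theorem entry_design {G B : ℕ} {i j : ℕ} (hi : i < m) (hj : j < n) :
    (⟨K, n, m, design G a B u grp lab bk m n,
      magnitudes (design G a B u grp lab bk m n) x⟩ : Input).entry i j =
      designEntry G a B u grp lab bk i j := by
  rw [Input.entry, dif_pos ⟨hi, hj⟩]
  rfl

/-- The decoder recovers the signal from the measurements, if the hash values and the multipliers
are suited to it. -/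
theorem recovers_design (hK : 1 ≤ K) (hx : numNonzero x ≤ K) (haQ : a ≤ Q)
    (hm : 6 * (parts K s₀ * (a + 1) + 4 * parts K p) + 5 ≤ m)
    (hu : ∀ j < n, u j ≠ 0) (hgrp : ∀ j < n, grp j < parts K s₀) (hlab : ∀ j < n, lab j < Q)
    (hbk : ∀ t < 4, ∀ j < n, bk t j < parts K p)
    (hgen : ∀ c : ℕ → ℤ, (∀ j ∈ support x, |c j| ≤ (Q : ℤ) ^ a + n) →
      ∑ j ∈ support x, (c j : ℂ) * (u j * extend x j) = 0 → ∀ j ∈ support x, c j = 0)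
    (hpeel : ∀ D ⊆ support x, D.Nonempty → (∀ j ∈ D, ¬ Easy (support x) grp lab a j) →
      ∃ i < 4 * parts K p, ∃ j,
        (D.filter fun k => bk (i / parts K p) k = i % parts K p) = {j}) :
    ∃ t, t ≤ timeConst s₀ a Q p * K ∧ RecoversIn (decoder s₀ a Q p) 3 K
      (design (parts K s₀) a (parts K p) u grp lab bk m n) x t := by
  obtain ⟨φ, hφ, hφR⟩ := exists_rotation (reference u x)
  have hφ0 : φ ≠ 0 := by
    rintro rfl
    simp at hφ
  -- The reference is the relation with all coefficients `1`, so genericity keeps it away from zero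
  -- for a non-zero signal.
  have hR0 : reference u x = 0 → support x = ∅ := by
    intro h0
    by_contra hne
    obtain ⟨j, hj⟩ := Finset.nonempty_iff_ne_empty.2 hne
    have := hgen (fun _ => 1) (fun k hk => ?_) (by simpa [reference] using h0) j hj
    · simp at this
    · have := lt_of_mem_support hk
      have hQ : (0 : ℤ) ≤ (Q : ℤ) ^ a := by positivity
      rw [abs_one]
      omega
  have hB : 0 < parts K p := Nat.succ_pos _
  set I : Input := ⟨K, n, m, design (parts K s₀) a (parts K p) u grp lab bk m n,
    magnitudes (design (parts K s₀) a (parts K p) u grp lab bk m n) x⟩ with hI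
  have hval : ∀ e w : ℕ, w < 2 → 6 * e + 11 ≤ m → I.value (5 + 3 * w + 6 * e) =
      ∑ j ∈ support x, designCoeff (parts K s₀) a (parts K p) grp lab bk e j *
        ((j + 1 : ℂ) ^ w * (u j * (φ * extend x j))) := fun e w hw he =>
    value_design hφ hφR hR0 hw he
  -- The decoder works on the rotated signal `φ x` throughout; genericity does not change under this
  -- factor.
  have hdec : Decodable I (I.wordBound 3) s₀ a Q p (support x) (fun j => φ * extend x j) u grp
      lab bk := by
    refine ⟨?_, ?_, fun j => lt_of_mem_support, ?_, fun j hj => hu j (lt_of_mem_support hj), ?_,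
      ?_, fun t ht j hj => hbk t ht j (lt_of_mem_support hj),
      fun j hj => hgrp j (lt_of_mem_support hj), fun j hj => hlab j (lt_of_mem_support hj),
      ?_, ?_, ?_⟩
    · show 4 * K + n + 8 ≤ (K + n + m + 2) ^ 3
      have h1 : 2 ^ 2 ≤ (K + n + m + 2) ^ 2 := Nat.pow_le_pow_left (by omega) 2
      calc 4 * K + n + 8 ≤ 2 ^ 2 * (K + n + m + 2) := by omega
        _ ≤ (K + n + m + 2) ^ 2 * (K + n + m + 2) := Nat.mul_le_mul_right _ h1
        _ = (K + n + m + 2) ^ 3 := by ring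
    · rw [card_support]
      exact hx
    · exact fun j hj => mul_ne_zero hφ0 (mem_support.1 hj)
    · intro j hj
      rw [hI, entry_design (by omega) (lt_of_mem_support hj)]
      simp [designEntry]
    · intro t ht j hj
      rw [hI, entry_design (by omega) (lt_of_mem_support hj), designEntry,
        if_neg (by omega), if_pos (by omega), Nat.add_sub_cancel_left]
      simp
    · intro g hg k hk w hw
      have hlt : g * (a + 1) + k < parts K s₀ * (a + 1) := by
        have : (g + 1) * (a + 1) ≤ parts K s₀ * (a + 1) := Nat.mul_le_mul_right _ hg
        rw [add_mul g 1, one_mul] at this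
        omega
      have hdiv : (g * (a + 1) + k) / (a + 1) = g := by
        rw [mul_comm, Nat.mul_add_div (Nat.succ_pos a), Nat.div_eq_of_lt (by omega), add_zero]
      have hmod : (g * (a + 1) + k) % (a + 1) = k := by
        rw [mul_comm, Nat.mul_add_mod, Nat.mod_eq_of_lt (by omega)]
      rw [hval _ _ hw (by omega), Finset.sum_filter]
      refine Finset.sum_congr rfl fun j _ => ?_
      rw [designCoeff, if_pos hlt, hdiv, hmod, ite_mul, zero_mul]
    · intro i hi w hw
      have hi' : i < 4 * parts K p := hi
      show I.value (5 + 3 * w + 6 * (parts K s₀ * (a + 1) + i)) = _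
      rw [hval _ _ hw (by omega), bucket, Finset.sum_filter]
      refine Finset.sum_congr rfl fun j _ => ?_
      rw [designCoeff, if_neg (by omega), Nat.add_sub_cancel_left, ite_mul, zero_mul, one_mul]
    · intro c hc h0
      refine hgen c hc ?_
      apply mul_left_cancel₀ hφ0
      rw [mul_zero, ← h0, Finset.mul_sum]
      exact Finset.sum_congr rfl fun j _ => by ring
  obtain ⟨t, s, ht, hex, hout⟩ := decoder_spec hdec haQ hK
    (fun j hj => by rw [mem_support, not_not] at hj; rw [hj, mul_zero]) hpeel
  refine ⟨t, ht, s, hex, φ, hφ, ?_⟩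
  funext j
  exact (hout j).trans (by rw [extend_val]; rfl)

end Design

/-! ### Counting -/

section Resampling

variable {ι α : Type*} [Fintype ι] [DecidableEq ι] [Fintype α]

/-- Drawing one coordinate again does not change the average. -/
theorem sum_sum_update (i : ι) (F : (ι → α) → ℝ) :
    ∑ h : ι → α, ∑ b : α, F (Function.update h i b) = Fintype.card α * ∑ h, F h := by
  classical
  -- Exchanging the coordinate `i` with the fresh value is an involution on pairs, so it preserves
  -- the sum.
  let σ : (ι → α) × α → (ι → α) × α := fun q => (Function.update q.1 i q.2, q.1 i)
  have hσ : Function.Involutive σ := by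
    rintro ⟨h, b⟩
    simp [σ]
  have h1 : ∑ q : (ι → α) × α, F (σ q).1 = ∑ q : (ι → α) × α, F q.1 :=
    Equiv.sum_comp hσ.toPerm (fun q => F q.1)
  rw [Fintype.sum_prod_type, Fintype.sum_prod_type] at h1
  simpa [σ, Finset.mul_sum] using h1

end Resampling

/-! ### Genericity of the random multipliers -/

section General

open scoped Classical

/-- Few multipliers satisfy a given non-trivial linear equation. -/
theorem card_linear_eq_zero {n M : ℕ} {z : Fin n → ℂ} {j : Fin n} (hj : z j ≠ 0) :
    ((Finset.univ.filter fun u : Fin n → Fin M => ∑ k, z k * ((u k : ℂ) + 1) = 0).card : ℝ) * M ≤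
      (M : ℝ) ^ n := by
  have h1 : ((Finset.univ.filter fun u : Fin n → Fin M =>
      ∑ k, z k * ((u k : ℂ) + 1) = 0).card : ℝ) =
      ∑ u : Fin n → Fin M, if ∑ k, z k * ((u k : ℂ) + 1) = 0 then 1 else 0 := by
    rw [Finset.sum_boole]
  have h2 := sum_sum_update (α := Fin M) j
    (fun u => if ∑ k, z k * ((u k : ℂ) + 1) = 0 then (1 : ℝ) else 0)
  rw [Fintype.card_fin] at h2
  rw [h1, mul_comm, ← h2]
  -- With the other multipliers fixed, the equation is linear in `u j` with the non-zero coefficient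
  -- `z j`, so at most one value solves it.
  have h3 : ∀ u : Fin n → Fin M, (∑ b : Fin M,
      if ∑ k, z k * ((Function.update u j b k : ℂ) + 1) = 0 then (1 : ℝ) else 0) ≤ 1 := by
    intro u
    rw [Finset.sum_boole]
    have : (Finset.univ.filter fun b : Fin M =>
        ∑ k, z k * ((Function.update u j b k : ℂ) + 1) = 0).card ≤ 1 := by
      rw [Finset.card_le_one]
      intro b hb c hc
      have hb' := (Finset.mem_filter.1 hb).2
      have hc' := (Finset.mem_filter.1 hc).2
      rw [← Finset.add_sum_erase _ _ (Finset.mem_univ j)] at hb' hc'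
      have he : ∑ k ∈ Finset.univ.erase j, z k * ((Function.update u j b k : ℂ) + 1) =
          ∑ k ∈ Finset.univ.erase j, z k * ((Function.update u j c k : ℂ) + 1) := by
        refine Finset.sum_congr rfl fun k hk => ?_
        rw [Function.update_of_ne (Finset.ne_of_mem_erase hk),
          Function.update_of_ne (Finset.ne_of_mem_erase hk)]
      rw [he] at hb'
      have hz : z j * ((b : ℂ) + 1) = z j * ((c : ℂ) + 1) := by
        simpa using add_right_cancel (hb'.trans hc'.symm)
      have hbc := add_right_cancel (mul_left_cancel₀ hj hz)
      exact Fin.ext (by exact_mod_cast hbc)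
    exact_mod_cast this
  calc _ ≤ ∑ u : Fin n → Fin M, (1 : ℝ) := Finset.sum_le_sum fun u _ => h3 u
    _ = _ := by simp

/-- The multipliers satisfy a non-trivial linear equation with small integer coefficients. -/
def Degenerate (b : ℕ) {n M : ℕ} (x : Fin n → ℂ) (u : Fin n → Fin M) : Prop :=
  ∃ c : Fin n → Fin (2 * b + 1), (∃ j, (((c j : ℤ) - b : ℤ) : ℂ) * x j ≠ 0) ∧
    ∑ k, (((c k : ℤ) - b : ℤ) : ℂ) * x k * ((u k : ℂ) + 1) = 0

/-- Few multipliers satisfy any non-trivial linear equation with small integer coefficients. -/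
theorem card_not_generic {n M b : ℕ} (y : Fin n → ℂ) :
    ((Finset.univ.filter fun u : Fin n → Fin M => Degenerate b y u).card : ℝ) * M ≤
      (2 * b + 1 : ℝ) ^ n * (M : ℝ) ^ n := by
  -- Union bound over all coefficient vectors in `[-b, b]`, encoded with the shift `b`.
  let E : (Fin n → Fin (2 * b + 1)) → Finset (Fin n → Fin M) := fun c =>
    Finset.univ.filter fun u => (∃ j, (((c j : ℤ) - b : ℤ) : ℂ) * y j ≠ 0) ∧
        ∑ k, (((c k : ℤ) - b : ℤ) : ℂ) * y k * ((u k : ℂ) + 1) = 0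
  have hE : ∀ c, ((E c).card : ℝ) * M ≤ (M : ℝ) ^ n := by
    intro c
    by_cases hc : ∃ j, (((c j : ℤ) - b : ℤ) : ℂ) * y j ≠ 0
    · obtain ⟨j, hj⟩ := hc
      refine le_trans ?_ (card_linear_eq_zero
        (z := fun k => (((c k : ℤ) - b : ℤ) : ℂ) * y k) hj)
      exact mul_le_mul_of_nonneg_right (Nat.cast_le.2 (Finset.card_le_card fun u hu =>
        Finset.mem_filter.2 ⟨Finset.mem_univ _, (Finset.mem_filter.1 hu).2.2⟩)) (Nat.cast_nonneg _)
    · have : E c = ∅ := by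
        apply Finset.filter_eq_empty_iff.2
        intro u _ h
        exact hc h.1
      rw [this]
      simp
  have hsub : (Finset.univ.filter fun u : Fin n → Fin M => Degenerate b y u) ⊆
      Finset.univ.biUnion E := by
    intro u hu
    obtain ⟨c, hc⟩ := (Finset.mem_filter.1 hu).2
    exact Finset.mem_biUnion.2 ⟨c, Finset.mem_univ _, Finset.mem_filter.2 ⟨Finset.mem_univ _, hc⟩⟩
  have hcard : ((Finset.univ.filter fun u : Fin n → Fin M => Degenerate b y u).card : ℝ) ≤
      ∑ c, ((E c).card : ℝ) := by
    exact_mod_cast (Finset.card_le_card hsub).trans Finset.card_biUnion_le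
  calc _ ≤ (∑ c, ((E c).card : ℝ)) * M := by gcongr
    _ = ∑ c, ((E c).card : ℝ) * M := Finset.sum_mul _ _ _
    _ ≤ ∑ c : Fin n → Fin (2 * b + 1), (M : ℝ) ^ n := Finset.sum_le_sum fun c _ => hE c
    _ = _ := by simp

/-! #### Collisions -/

variable {ι α β : Type*} [Fintype β]

/-- The indicator of a collision, centred. -/
def collision (f : α → β) (i j : ι) (h : ι → α) : ℝ :=
  (if f (h i) = f (h j) then 1 else 0) - (Fintype.card β : ℝ)⁻¹

theorem collision_comm (f : α → β) (i j : ι) (h : ι → α) :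
    collision f i j h = collision f j i h := by
  simp only [collision, eq_comm]

variable [DecidableEq ι] [Fintype α]

/-- For fixed `h j`, the equal fibres of `f` make `f (h i)` uniform, so the centred indicator
averages to zero over the coordinate `i` alone. -/
theorem sum_collision_update {f : α → β} [Nonempty β]
    (hf : ∀ b, (Finset.univ.filter fun x => f x = b).card * Fintype.card β = Fintype.card α)
    {i j : ι} (hij : i ≠ j) (h : ι → α) :
    ∑ b, collision f i j (Function.update h i b) = 0 := by
  have hβ : (Fintype.card β : ℝ) ≠ 0 := by exact_mod_cast Fintype.card_ne_zero
  have h1 : ((Finset.univ.filter fun x => f x = f (h j)).card : ℝ) * Fintype.card β =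
      Fintype.card α := by exact_mod_cast hf (f (h j))
  simp only [collision, Function.update_self, Function.update_of_ne hij.symm,
    Finset.sum_sub_distrib, Finset.sum_boole, Finset.sum_const, Finset.card_univ, nsmul_eq_mul]
  rw [← h1]
  field_simp
  ring

variable [Fintype ι]

theorem sum_collision {f : α → β} [Nonempty α] [Nonempty β]
    (hf : ∀ b, (Finset.univ.filter fun x => f x = b).card * Fintype.card β = Fintype.card α)
    {i j : ι} (hij : i ≠ j) : ∑ h : ι → α, collision f i j h = 0 := by
  have h1 := sum_sum_update (α := α) i (collision f i j)
  simp only [sum_collision_update hf hij, Finset.sum_const_zero] at h1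
  have hα : (Fintype.card α : ℝ) ≠ 0 := by exact_mod_cast Fintype.card_ne_zero
  exact (mul_eq_zero.1 h1.symm).resolve_left hα

/-- Resampling a coordinate that the second factor does not read averages the first one to zero;
thus different pairs are uncorrelated even if they share an index. -/
theorem sum_collision_mul {f : α → β} [Nonempty α] [Nonempty β]
    (hf : ∀ b, (Finset.univ.filter fun x => f x = b).card * Fintype.card β = Fintype.card α)
    {i j k l : ι} (hij : i ≠ j) (hik : i ≠ k) (hil : i ≠ l) :
    ∑ h : ι → α, collision f i j h * collision f k l h = 0 := by
  have h1 := sum_sum_update (α := α) i (fun h => collision f i j h * collision f k l h)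
  have h2 : ∀ (h : ι → α) b, collision f k l (Function.update h i b) = collision f k l h := by
    intro h b
    simp [collision, Function.update_of_ne hik.symm, Function.update_of_ne hil.symm]
  simp only [h2, ← Finset.sum_mul, sum_collision_update hf hij, zero_mul,
    Finset.sum_const_zero] at h1
  have hα : (Fintype.card α : ℝ) ≠ 0 := by exact_mod_cast Fintype.card_ne_zero
  exact (mul_eq_zero.1 h1.symm).resolve_left hα

/-- The square of a centred indicator of mean `c` is a multiple of itself plus `c - c²`, and the
first part sums to zero. -/
theorem sum_collision_sq {f : α → β} [Nonempty α] [Nonempty β]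
    (hf : ∀ b, (Finset.univ.filter fun x => f x = b).card * Fintype.card β = Fintype.card α)
    {i j : ι} (hij : i ≠ j) :
    ∑ h : ι → α, collision f i j h * collision f i j h ≤
      Fintype.card (ι → α) * (Fintype.card β : ℝ)⁻¹ := by
  set c : ℝ := (Fintype.card β : ℝ)⁻¹ with hc
  have h1 : ∀ h : ι → α, collision f i j h * collision f i j h =
      (1 - 2 * c) * collision f i j h + (c - c * c) := by
    intro h
    unfold collision
    split_ifs <;> ring
  simp only [h1, Finset.sum_add_distrib, ← Finset.mul_sum, sum_collision hf hij, mul_zero,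
    zero_add, Finset.sum_const, Finset.card_univ, nsmul_eq_mul]
  gcongr
  nlinarith [mul_self_nonneg c]

/-- The variance of the number of collisions. -/
theorem sum_sq_collisions_le {f : α → β} [Nonempty α] [Nonempty β]
    (hf : ∀ b, (Finset.univ.filter fun x => f x = b).card * Fintype.card β = Fintype.card α)
    (S : Finset ι) :
    ∑ h : ι → α, (∑ q ∈ S.offDiag, collision f q.1 q.2 h) ^ 2 ≤
      2 * (S.card : ℝ) ^ 2 * (Fintype.card (ι → α) * (Fintype.card β : ℝ)⁻¹) := by
  set V : ℝ := Fintype.card (ι → α) * (Fintype.card β : ℝ)⁻¹ with hV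
  have hV0 : 0 ≤ V := by positivity
  have h1 : ∀ q ∈ S.offDiag, ∑ q' ∈ S.offDiag,
      ∑ h : ι → α, collision f q.1 q.2 h * collision f q'.1 q'.2 h ≤ 2 * V := by
    rintro ⟨i, j⟩ hq
    obtain ⟨hi, hj, hij⟩ := Finset.mem_offDiag.1 hq
    -- Unless the two unordered pairs agree, `i` or `j` is missing from the second one and can be
    -- resampled. Each ordered pair therefore correlates only with itself and its reversal, whence
    -- the factor `2`.
    have hzero : ∀ q' ∈ S.offDiag, q' ∉ ({(i, j), (j, i)} : Finset (ι × ι)) →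
        ∑ h : ι → α, collision f i j h * collision f q'.1 q'.2 h = 0 := by
      rintro ⟨k, l⟩ hq' hne
      obtain ⟨hk, hl, hkl⟩ := Finset.mem_offDiag.1 hq'
      dsimp only at hkl ⊢
      simp only [Finset.mem_insert, Finset.mem_singleton, Prod.mk.injEq, not_or, not_and] at hne
      by_cases hi' : i ≠ k ∧ i ≠ l
      · exact sum_collision_mul hf hij hi'.1 hi'.2
      · have hj' : j ≠ k ∧ j ≠ l := by
          by_cases hik : i = k
          · exact ⟨fun h => hij (hik.trans h.symm), fun h => hne.1 hik.symm h.symm⟩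
          · have hil : i = l := by
              by_contra hil
              exact hi' ⟨hik, hil⟩
            exact ⟨fun h => hne.2 h.symm hil.symm, fun h => hij (hil.trans h.symm)⟩
        simp only [collision_comm f i j]
        exact sum_collision_mul hf hij.symm hj'.1 hj'.2
    have hsub : ({(i, j), (j, i)} : Finset (ι × ι)) ⊆ S.offDiag := by
      intro q' hq'
      rcases Finset.mem_insert.1 hq' with rfl | hq'
      · exact hq
      · rw [Finset.mem_singleton.1 hq']
        exact Finset.mem_offDiag.2 ⟨hj, hi, hij.symm⟩
    rw [← Finset.sum_subset hsub hzero, Finset.sum_pair (by simp [hij])]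
    simp only [collision_comm f j i]
    have := sum_collision_sq hf hij (f := f)
    linarith
  calc _ = ∑ h : ι → α, ∑ q ∈ S.offDiag, ∑ q' ∈ S.offDiag,
        collision f q.1 q.2 h * collision f q'.1 q'.2 h := by
        refine Finset.sum_congr rfl fun h _ => ?_
        rw [sq, Finset.sum_mul_sum]
    _ = ∑ q ∈ S.offDiag, ∑ q' ∈ S.offDiag, ∑ h : ι → α,
        collision f q.1 q.2 h * collision f q'.1 q'.2 h := by
        rw [Finset.sum_comm]
        refine Finset.sum_congr rfl fun q _ => Finset.sum_comm
    _ ≤ ∑ q ∈ S.offDiag, 2 * V := Finset.sum_le_sum h1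
    _ = (S.offDiag.card : ℝ) * (2 * V) := by rw [Finset.sum_const, nsmul_eq_mul]
    _ ≤ (S.card : ℝ) ^ 2 * (2 * V) := by
        gcongr
        rw [Finset.offDiag_card, sq]
        exact_mod_cast Nat.sub_le _ _
    _ = _ := by ring

/-- The number of ordered pairs of elements of `S` that collide. -/
def collisions (f : α → β) (S : Finset ι) (h : ι → α) : ℕ :=
  (S.offDiag.filter fun q => f (h q.1) = f (h q.2)).card

/-- Chebyshev's inequality for the number of collisions. -/
theorem card_collisions_gt {f : α → β} [Nonempty α] [Nonempty β]
    (hf : ∀ b, (Finset.univ.filter fun x => f x = b).card * Fintype.card β = Fintype.card α)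
    (S : Finset ι) {τ : ℝ} (hτ : 0 < τ) :
    ((Finset.univ.filter fun h : ι → α =>
      (S.card : ℝ) ^ 2 / Fintype.card β + τ < collisions f S h).card : ℝ) * τ ^ 2 ≤
      2 * (S.card : ℝ) ^ 2 / Fintype.card β * Fintype.card (ι → α) := by
  have h1 : ∀ h : ι → α, ∑ q ∈ S.offDiag, collision f q.1 q.2 h =
      collisions f S h - S.offDiag.card / (Fintype.card β : ℝ) := by
    intro h
    simp only [collision, Finset.sum_sub_distrib, Finset.sum_boole, Finset.sum_const,
      nsmul_eq_mul, collisions, div_eq_mul_inv]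
  have h2 : (S.offDiag.card : ℝ) ≤ (S.card : ℝ) ^ 2 := by
    rw [Finset.offDiag_card, sq]
    exact_mod_cast Nat.sub_le _ _
  calc _ = ∑ h ∈ Finset.univ.filter fun h : ι → α =>
        (S.card : ℝ) ^ 2 / Fintype.card β + τ < collisions f S h, τ ^ 2 := by
        rw [Finset.sum_const, nsmul_eq_mul]
    _ ≤ ∑ h ∈ Finset.univ.filter fun h : ι → α =>
        (S.card : ℝ) ^ 2 / Fintype.card β + τ < collisions f S h,
        (∑ q ∈ S.offDiag, collision f q.1 q.2 h) ^ 2 := by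
        refine Finset.sum_le_sum fun h hh => ?_
        have h3 := (Finset.mem_filter.1 hh).2
        have h4 : (S.offDiag.card : ℝ) / Fintype.card β ≤ (S.card : ℝ) ^ 2 / Fintype.card β := by
          gcongr
        rw [h1]
        gcongr
        linarith
    _ ≤ ∑ h : ι → α, (∑ q ∈ S.offDiag, collision f q.1 q.2 h) ^ 2 :=
        Finset.sum_le_sum_of_subset_of_nonneg (Finset.filter_subset _ _) fun _ _ _ => sq_nonneg _
    _ ≤ _ := sum_sq_collisions_le hf S
    _ = _ := by ring

end General

/-! #### Stopping sets -/

section Stopping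

open scoped Classical

variable {ι α : Type*} [Fintype ι] [DecidableEq ι] [Fintype α]

/-- No value is taken exactly once on `D`. -/
def NoSingle (D : Finset ι) (b : ι → α) : Prop := ∀ y, (D.filter fun i => b i = y).card ≠ 1

/-- Every value taken on `D` is taken at least twice, so `D` is mapped into some set of `D.card / 2`
values; the bound is the union over these sets. -/
theorem card_noSingle_le (D : Finset ι) (hD : D.card / 2 ≤ Fintype.card α) :
    (Finset.univ.filter fun b : ι → α => NoSingle D b).card ≤
      (Fintype.card α).choose (D.card / 2) *
        ((D.card / 2) ^ D.card * Fintype.card α ^ (Fintype.card ι - D.card)) := by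
  set f := D.card / 2 with hf
  let E : Finset α → Finset (ι → α) := fun T =>
    Fintype.piFinset fun i => if i ∈ D then T else Finset.univ
  have hsub : (Finset.univ.filter fun b : ι → α => NoSingle D b) ⊆
      (Finset.univ.powersetCard f).biUnion E := by
    intro b hb
    have hb' : NoSingle D b := (Finset.mem_filter.1 hb).2
    have himg : (D.image b).card ≤ f := by
      have h1 : D.card = ∑ y ∈ D.image b, (D.filter fun i => b i = y).card :=
        Finset.card_eq_sum_card_image b D
      have h2 : (D.image b).card * 2 ≤ D.card := by
        rw [h1, ← smul_eq_mul]
        refine Finset.card_nsmul_le_sum _ (fun y => (D.filter fun i => b i = y).card) 2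
          fun y hy => ?_
        obtain ⟨i, hi, rfl⟩ := Finset.mem_image.1 hy
        have h3 : 0 < (D.filter fun k => b k = b i).card :=
          Finset.card_pos.2 ⟨i, Finset.mem_filter.2 ⟨hi, rfl⟩⟩
        have h4 := hb' (b i)
        omega
      omega
    obtain ⟨T, hT, -, hTc⟩ := Finset.exists_subsuperset_card_eq (Finset.subset_univ (D.image b))
      himg (by rwa [Finset.card_univ])
    refine Finset.mem_biUnion.2 ⟨T, Finset.mem_powersetCard.2 ⟨Finset.subset_univ _, hTc⟩, ?_⟩
    rw [Fintype.mem_piFinset]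
    intro i
    split_ifs with hi
    · exact hT (Finset.mem_image_of_mem _ hi)
    · exact Finset.mem_univ _
  have hbi := Finset.card_biUnion_le_card_mul (Finset.univ.powersetCard f) E
    (f ^ D.card * Fintype.card α ^ (Fintype.card ι - D.card)) ?_
  · rw [Finset.card_powersetCard, Finset.card_univ] at hbi
    exact (Finset.card_le_card hsub).trans hbi
  · intro T hT
    have hTc := (Finset.mem_powersetCard.1 hT).2
    rw [Fintype.card_piFinset]
    have h1 : ∀ i, (if i ∈ D then T else Finset.univ).card =
        if i ∈ D then f else Fintype.card α := by
      intro i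
      split_ifs
      · exact hTc
      · exact Finset.card_univ
    simp only [h1]
    rw [Finset.prod_ite, Finset.prod_const, Finset.prod_const]
    have h2 : (Finset.univ.filter fun i => i ∈ D) = D := by ext; simp
    have h3 : (Finset.univ.filter fun i => i ∉ D) = Dᶜ := by ext; simp
    rw [h2, h3, Finset.card_compl]

theorem pow_div_factorial_le_exp_pow (n : ℕ) : (n : ℝ) ^ n / n.factorial ≤ Real.exp 1 ^ n := by
  rw [← Real.exp_nat_mul, mul_one]
  exact Real.pow_div_factorial_le_exp _ (Nat.cast_nonneg n) n

/-- The probability that a table has no bucket with a single element of a set of size `d`. -/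
theorem choose_mul_pow_sq_le {B d : ℕ} (hB : 0 < B) (hd : d / 2 ≤ B) :
    ((B.choose (d / 2) : ℝ) * ((d / 2 : ℕ) / (B : ℝ)) ^ d) ^ 2 ≤
      (Real.exp 1 * (d / (2 * B))) ^ d := by
  set f := d / 2 with hf
  have hB' : (0 : ℝ) < B := by exact_mod_cast hB
  set q : ℝ := (f : ℝ) / B with hq
  have hq0 : 0 ≤ q := by positivity
  have hq1 : q ≤ 1 := by
    rw [hq, div_le_one hB']
    exact_mod_cast hd
  have hqd : q ≤ d / (2 * B) := by
    rw [hq, div_le_div_iff₀ hB' (by positivity)]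
    have : ((2 * f : ℕ) : ℝ) ≤ d := by
      exact_mod_cast (show 2 * f ≤ d by omega)
    push_cast at this
    nlinarith
  have h1 : (B.choose f : ℝ) * q ^ f ≤ Real.exp 1 ^ f := by
    calc (B.choose f : ℝ) * q ^ f ≤ (B : ℝ) ^ f / f.factorial * q ^ f := by
          gcongr
          exact Nat.choose_le_pow_div f B
      _ = (f : ℝ) ^ f / f.factorial := by
          rw [hq, div_pow]
          field_simp
      _ ≤ _ := pow_div_factorial_le_exp_pow f
  have he : (1 : ℝ) ≤ Real.exp 1 := Real.one_le_exp (by norm_num)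
  -- Squaring accommodates odd `d`: only `2 f ≤ d ≤ 2 (d - f)` is used, with `e ≥ 1` and `q ≤ 1`.
  calc ((B.choose f : ℝ) * q ^ d) ^ 2 = ((B.choose f : ℝ) * q ^ f) ^ 2 * q ^ (2 * (d - f)) := by
        rw [show q ^ d = q ^ f * q ^ (d - f) by rw [← pow_add]; congr 1; omega]
        ring
    _ ≤ (Real.exp 1 ^ f) ^ 2 * q ^ (2 * (d - f)) := by gcongr
    _ ≤ Real.exp 1 ^ d * q ^ d := by
        rw [← pow_mul]
        refine mul_le_mul (pow_le_pow_right₀ he (by omega))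
          (pow_le_pow_of_le_one hq0 hq1 (by omega)) (by positivity) (by positivity)
    _ ≤ Real.exp 1 ^ d * (d / (2 * B)) ^ d := by gcongr
    _ = _ := (mul_pow _ _ _).symm

/-- The union bound for four tables and the sets of size `d` among `K` elements. -/
theorem choose_mul_choose_pow_le {K B d p : ℕ} (hB : 0 < B) (hd : d / 2 ≤ B)
    (hKB : K ≤ p * B) (hK : 0 < K) :
    (K.choose d : ℝ) * ((B.choose (d / 2) : ℝ) * ((d / 2 : ℕ) / (B : ℝ)) ^ d) ^ 4 ≤
      (6 * p ^ 2 * d / K : ℝ) ^ d := by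
  have hB' : (0 : ℝ) < B := by exact_mod_cast hB
  have hK' : (0 : ℝ) < K := by exact_mod_cast hK
  have hKB' : (K : ℝ) ≤ p * B := by exact_mod_cast hKB
  have h1 : (K.choose d : ℝ) * (d : ℝ) ^ d ≤ (Real.exp 1 * K) ^ d := by
    calc (K.choose d : ℝ) * (d : ℝ) ^ d ≤ (K : ℝ) ^ d / d.factorial * (d : ℝ) ^ d := by
          gcongr
          exact Nat.choose_le_pow_div d K
      _ = (K : ℝ) ^ d * ((d : ℝ) ^ d / d.factorial) := by ring
      _ ≤ (K : ℝ) ^ d * Real.exp 1 ^ d := by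
          gcongr
          exact pow_div_factorial_le_exp_pow d
      _ = _ := by rw [mul_pow]; ring
  -- One factor `e` comes from choosing the set and two from the four tables. Dividing `24` by the
  -- `4` in `4 * B ^ 2` gives the constant `6`.
  have he : Real.exp 1 ^ 3 ≤ 24 := by
    calc Real.exp 1 ^ 3 ≤ 2.7182818286 ^ 3 := by
          gcongr
          exact Real.exp_one_lt_d9.le
      _ ≤ 24 := by norm_num
  calc _ = (K.choose d : ℝ) *
        (((B.choose (d / 2) : ℝ) * ((d / 2 : ℕ) / (B : ℝ)) ^ d) ^ 2) ^ 2 := by ring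
    _ ≤ (K.choose d : ℝ) * ((Real.exp 1 * (d / (2 * B))) ^ d) ^ 2 := by
        gcongr
        exact choose_mul_pow_sq_le hB hd
    _ = (K.choose d : ℝ) * (d : ℝ) ^ d * (Real.exp 1 ^ 2 * d / (4 * B ^ 2)) ^ d := by
        rw [← pow_mul, mul_comm d 2, pow_mul, mul_assoc, ← mul_pow]
        congr 2
        ring
    _ ≤ (Real.exp 1 * K) ^ d * (Real.exp 1 ^ 2 * d / (4 * B ^ 2)) ^ d := by gcongr
    _ = (Real.exp 1 ^ 3 * K * d / (4 * B ^ 2)) ^ d := by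
        rw [← mul_pow]
        ring
    _ ≤ (6 * p ^ 2 * d / K : ℝ) ^ d := by
        refine pow_le_pow_left₀ (by positivity) ?_ d
        rw [div_le_div_iff₀ (by positivity) hK']
        calc (Real.exp 1 ^ 3 * K * d * K : ℝ) = Real.exp 1 ^ 3 * ((K : ℝ) ^ 2 * d) := by ring
          _ ≤ 24 * (((p : ℝ) * B) ^ 2 * d) := by gcongr
          _ = _ := by ring

/-- One factor `c d` is at most `c 2 ^ (d - 1)` and the other `d - 1` are at most `1 / 4`, so the
terms are dominated by a geometric series with ratio `1 / 2`. -/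
theorem sum_pow_le {c : ℝ} (hc : 0 ≤ c) (N : ℕ) (hN : c * N ≤ 1 / 4) :
    ∑ d ∈ Finset.Icc 1 N, (c * d) ^ d ≤ 2 * c := by
  have h1 : ∀ d ∈ Finset.Icc 1 N, (c * d) ^ d ≤ c * (1 / 2) ^ (d - 1) := by
    intro d hd
    obtain ⟨hd1, hdN⟩ := Finset.mem_Icc.1 hd
    obtain ⟨e, rfl⟩ := Nat.exists_eq_add_of_le' hd1
    have h2 : c * ((e + 1 : ℕ) : ℝ) ≤ 1 / 4 := by
      refine le_trans ?_ hN
      gcongr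
    have h3 : ((e + 1 : ℕ) : ℝ) ≤ 2 ^ e := by
      exact_mod_cast Nat.lt_two_pow_self (n := e)
    rw [Nat.add_sub_cancel, pow_succ]
    calc (c * ((e + 1 : ℕ) : ℝ)) ^ e * (c * ((e + 1 : ℕ) : ℝ)) ≤ (1 / 4) ^ e * (c * 2 ^ e) := by
          gcongr
      _ = c * ((1 / 4) ^ e * 2 ^ e) := by ring
      _ = c * (1 / 2) ^ e := by
          rw [← mul_pow]
          norm_num
  refine (Finset.sum_le_sum h1).trans ?_
  rw [← Finset.mul_sum]
  have h4 : ∑ d ∈ Finset.Icc 1 N, (1 / 2 : ℝ) ^ (d - 1) ≤ 2 := by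
    have : Finset.Icc 1 N = Finset.Ico 1 (N + 1) := by ext; simp
    rw [this, Finset.sum_Ico_eq_sum_range]
    simp only [Nat.add_sub_cancel_left, Nat.add_sub_cancel]
    exact (summable_geometric_two.sum_le_tsum _ fun i _ => by positivity).trans_eq
      tsum_geometric_two
  nlinarith

/-- There is a small stopping set. -/
def Stuck {n B : ℕ} (N : ℕ) (S : Finset (Fin n)) (b : Fin 4 → Fin n → Fin B) : Prop :=
  ∃ D ⊆ S, D.Nonempty ∧ D.card ≤ N ∧ ∀ t, NoSingle D (b t)

/-- Few choices of four tables have a non-empty small stopping set in `S`. -/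
theorem card_stopping_le {n B p : ℕ} (S : Finset (Fin n)) (hB : 0 < B) (hS : 0 < S.card)
    (hSB : S.card ≤ p * B) {N : ℕ} (hNB : N ≤ B) (hN : 24 * p ^ 2 * N ≤ S.card) :
    ((Finset.univ.filter fun b : Fin 4 → Fin n → Fin B => Stuck N S b).card : ℝ) ≤
      12 * p ^ 2 / S.card * Fintype.card (Fin 4 → Fin n → Fin B) := by
  set K := S.card with hK
  have hB' : (0 : ℝ) < B := by exact_mod_cast hB
  have hK' : (0 : ℝ) < K := by exact_mod_cast hS
  let E : Finset (Fin n) → Finset (Fin 4 → Fin n → Fin B) := fun D =>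
    Finset.univ.filter fun b => ∀ t, NoSingle D (b t)
  have hE : ∀ D ⊆ S, D.card ≤ N → ((E D).card : ℝ) ≤
      ((B.choose (D.card / 2) : ℝ) * ((D.card / 2 : ℕ) / (B : ℝ)) ^ D.card) ^ 4 *
        Fintype.card (Fin 4 → Fin n → Fin B) := by
    intro D hDS hDN
    have h1 : E D = Fintype.piFinset fun _ : Fin 4 =>
        Finset.univ.filter fun b : Fin n → Fin B => NoSingle D b := by
      ext b
      simp [E]
    have h2 := card_noSingle_le (α := Fin B) D (by rw [Fintype.card_fin]; omega)
    have hDn : D.card ≤ n := by simpa using Finset.card_le_univ D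
    rw [Fintype.card_fin, Fintype.card_fin] at h2
    have h3 : ((Finset.univ.filter fun b : Fin n → Fin B => NoSingle D b).card : ℝ) ≤
        ((B.choose (D.card / 2) : ℝ) * ((D.card / 2 : ℕ) / (B : ℝ)) ^ D.card) * (B : ℝ) ^ n := by
      calc _ ≤ (B.choose (D.card / 2) : ℝ) *
            (((D.card / 2 : ℕ) : ℝ) ^ D.card * (B : ℝ) ^ (n - D.card)) := by exact_mod_cast h2
        _ = _ := by
          rw [div_pow, show (B : ℝ) ^ n = (B : ℝ) ^ D.card * (B : ℝ) ^ (n - D.card) by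
            rw [← pow_add]; congr 1; omega]
          field_simp
    rw [h1, Fintype.card_piFinset_const]
    simp only [Fintype.card_fun, Fintype.card_fin]
    push_cast
    rw [← mul_pow]
    gcongr
  have hsub : (Finset.univ.filter fun b : Fin 4 → Fin n → Fin B => Stuck N S b) ⊆
      (Finset.Icc 1 N).biUnion fun d => (S.powersetCard d).biUnion E := by
    intro b hb
    obtain ⟨D, hDS, hDne, hDN, hD⟩ := (Finset.mem_filter.1 hb).2
    refine Finset.mem_biUnion.2 ⟨D.card, Finset.mem_Icc.2 ⟨Finset.card_pos.2 hDne, hDN⟩, ?_⟩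
    exact Finset.mem_biUnion.2 ⟨D, Finset.mem_powersetCard.2 ⟨hDS, rfl⟩,
      Finset.mem_filter.2 ⟨Finset.mem_univ _, hD⟩⟩
  set T : ℝ := (Fintype.card (Fin 4 → Fin n → Fin B) : ℝ) with hT
  have hT0 : 0 ≤ T := by positivity
  have h4 : ∀ d ∈ Finset.Icc 1 N, (((S.powersetCard d).biUnion E).card : ℝ) ≤
      (6 * p ^ 2 / K * d : ℝ) ^ d * T := by
    intro d hd
    have hdN := (Finset.mem_Icc.1 hd).2
    calc (((S.powersetCard d).biUnion E).card : ℝ) ≤ ∑ D ∈ S.powersetCard d, ((E D).card : ℝ) := by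
          exact_mod_cast Finset.card_biUnion_le
      _ ≤ ∑ D ∈ S.powersetCard d,
          ((B.choose (d / 2) : ℝ) * ((d / 2 : ℕ) / (B : ℝ)) ^ d) ^ 4 * T := by
          refine Finset.sum_le_sum fun D hD => ?_
          obtain ⟨hDS, hDd⟩ := Finset.mem_powersetCard.1 hD
          have := hE D hDS (hDd.trans_le hdN)
          rwa [hDd] at this
      _ = (K.choose d : ℝ) * ((B.choose (d / 2) : ℝ) * ((d / 2 : ℕ) / (B : ℝ)) ^ d) ^ 4 * T := by
          rw [Finset.sum_const, Finset.card_powersetCard, nsmul_eq_mul, mul_assoc]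
      _ ≤ (6 * p ^ 2 * d / K : ℝ) ^ d * T := by
          gcongr
          exact choose_mul_choose_pow_le hB (by omega) hSB hS
      _ = _ := by
          congr 2
          ring
  calc _ ≤ ∑ d ∈ Finset.Icc 1 N, (((S.powersetCard d).biUnion E).card : ℝ) := by
        exact_mod_cast (Finset.card_le_card hsub).trans Finset.card_biUnion_le
    _ ≤ ∑ d ∈ Finset.Icc 1 N, (6 * p ^ 2 / K * d : ℝ) ^ d * T := Finset.sum_le_sum h4
    _ = (∑ d ∈ Finset.Icc 1 N, (6 * p ^ 2 / K * d : ℝ) ^ d) * T := (Finset.sum_mul _ _ _).symm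
    _ ≤ 2 * (6 * p ^ 2 / K) * T := by
        gcongr
        refine sum_pow_le (by positivity) N ?_
        rw [div_mul_eq_mul_div, div_le_iff₀ hK']
        have : ((24 * p ^ 2 * N : ℕ) : ℝ) ≤ K := by exact_mod_cast hN
        push_cast at this
        linarith
    _ = _ := by ring

end Stopping

/-! #### Overloaded groups -/

section Overload

open scoped Classical

/-- If there are few collisions, then few elements are in overloaded groups. -/
theorem card_overloaded_le {ι γ : Type*} [Fintype γ] (S : Finset ι) (g : ι → γ)
    {s r p : ℕ} (hs : s = p * r) (hcol : ((S.offDiag.filter fun q => g q.1 = g q.2).card : ℝ) ≤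
      s * S.card + S.card) (hγ : (Fintype.card γ : ℝ) * s ≤ S.card + s)
    (hS : s ^ 2 ≤ S.card) :
    (r : ℝ) * (S.filter fun i => s + r < (S.filter fun k => g k = g i).card).card ≤
      3 * (p + 1) * S.card := by
  set N : γ → ℕ := fun y => (S.filter fun k => g k = y).card with hN
  have hsum : (S.card : ℝ) = ∑ y, (N y : ℝ) := by
    exact_mod_cast Finset.card_eq_sum_card_fiberwise (f := g) (t := Finset.univ)
      fun i _ => Finset.mem_coe.2 (Finset.mem_univ _)
  have hsq : ∑ y, (N y : ℝ) ^ 2 = S.card +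
      ((S.offDiag.filter fun q => g q.1 = g q.2).card : ℝ) := by
    have h1 : ((S ×ˢ S).filter fun q => g q.1 = g q.2).card = ∑ y, N y ^ 2 := by
      rw [Finset.card_eq_sum_card_fiberwise (f := fun q => g q.1) (t := Finset.univ)
        fun i _ => Finset.mem_coe.2 (Finset.mem_univ _)]
      refine Finset.sum_congr rfl fun y _ => ?_
      rw [sq, hN, ← Finset.card_product]
      congr 1
      ext ⟨i, j⟩
      simp only [Finset.mem_filter, Finset.mem_product]
      constructor
      · rintro ⟨⟨⟨hi, hj⟩, h⟩, h'⟩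
        exact ⟨⟨hi, h'⟩, hj, h ▸ h'⟩
      · rintro ⟨⟨hi, h⟩, hj, h'⟩
        exact ⟨⟨⟨hi, hj⟩, h.trans h'.symm⟩, h⟩
    have h2 : ((S ×ˢ S).filter fun q => g q.1 = g q.2).card =
        S.card + (S.offDiag.filter fun q => g q.1 = g q.2).card := by
      rw [← Finset.diag_union_offDiag, Finset.filter_union, Finset.card_union_of_disjoint
        (Finset.disjoint_filter_filter (Finset.disjoint_diag_offDiag S)), Finset.filter_true_of_mem,
        Finset.diag_card]
      rintro ⟨i, j⟩ hij
      rw [(Finset.mem_diag.1 hij).2]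
    exact_mod_cast h1.symm.trans h2
  have hover : ((S.filter fun i => s + r < (S.filter fun k => g k = g i).card).card : ℝ) =
      ∑ y, if s + r < N y then (N y : ℝ) else 0 := by
    rw [Finset.card_eq_sum_card_fiberwise (f := g) (t := Finset.univ)
        fun i _ => Finset.mem_coe.2 (Finset.mem_univ _)]
    push_cast
    refine Finset.sum_congr rfl fun y _ => ?_
    rw [Finset.filter_filter]
    split_ifs with h
    · congr 2
      ext i
      simp only [Finset.mem_filter]
      constructor
      · rintro ⟨hi, -, h'⟩
        exact ⟨hi, h'⟩
      · rintro ⟨hi, h'⟩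
        exact ⟨hi, by rw [h']; exact h, h'⟩
    · rw [Nat.cast_eq_zero, Finset.card_eq_zero, Finset.filter_eq_empty_iff]
      rintro i hi ⟨h1, h2⟩
      rw [h2] at h1
      exact h h1
  -- With `d = N - s ≥ r` and `s = p r`, one has `r N = p r² + r d ≤ (p + 1) d²`: overloading is
  -- controlled by the squared deviation from `s`.
  have hpoint : ∀ y, (r : ℝ) * (if s + r < N y then (N y : ℝ) else 0) ≤
      (p + 1) * ((N y : ℝ) ^ 2 - 2 * s * N y + (s : ℝ) ^ 2) := by
    intro y
    have hsq' : (N y : ℝ) ^ 2 - 2 * s * N y + (s : ℝ) ^ 2 = ((N y : ℝ) - s) ^ 2 := by ring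
    rw [hsq']
    split_ifs with h
    · have h1 : (s : ℝ) + r ≤ N y := by exact_mod_cast h.le
      have h2 : (s : ℝ) = p * r := by exact_mod_cast hs
      have hp : (0 : ℝ) ≤ p := Nat.cast_nonneg p
      have hr : (0 : ℝ) ≤ r := Nat.cast_nonneg r
      set d : ℝ := (N y : ℝ) - s with hd
      have hNd : (N y : ℝ) = p * r + d := by rw [hd, ← h2]; ring
      have hdr : (r : ℝ) ≤ d := by rw [hd]; linarith
      have h3 : (r : ℝ) * r ≤ d ^ 2 := by nlinarith
      have h4 : (r : ℝ) * d ≤ d ^ 2 := by nlinarith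
      rw [hNd]
      nlinarith [mul_le_mul_of_nonneg_left h3 hp]
    · rw [mul_zero]
      positivity
  rw [hover, Finset.mul_sum]
  refine (Finset.sum_le_sum fun y _ => hpoint y).trans ?_
  rw [← Finset.mul_sum, Finset.sum_add_distrib, Finset.sum_sub_distrib, ← Finset.mul_sum, ← hsum,
    hsq, Finset.sum_const, Finset.card_univ, nsmul_eq_mul]
  have h5 : (s : ℝ) ^ 2 ≤ S.card := by exact_mod_cast hS
  have h6 : (Fintype.card γ : ℝ) * (s : ℝ) ^ 2 ≤ (S.card + s) * s := by
    rw [sq, ← mul_assoc]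
    gcongr
  have hp : (0 : ℝ) ≤ p := Nat.cast_nonneg p
  -- The main terms `s * S.card` cancel: the squared deviations sum to at most `2 * S.card + s²`,
  -- and `s² ≤ S.card`.
  calc _ ≤ ((p : ℝ) + 1) * (3 * S.card) := by
        gcongr
        nlinarith
    _ = _ := by ring

/-- Every shared element is the first component of a colliding ordered pair. -/
theorem card_shared_le {ι γ : Type*} (S : Finset ι) (g : ι → γ) :
    (S.filter fun i => ∃ k ∈ S, g k = g i ∧ k ≠ i).card ≤
      (S.offDiag.filter fun q => g q.1 = g q.2).card := by
  have hsub : (S.filter fun i => ∃ k ∈ S, g k = g i ∧ k ≠ i) ⊆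
      (S.offDiag.filter fun q => g q.1 = g q.2).image Prod.fst := by
    intro i hi
    obtain ⟨hiS, k, hk, hg, hne⟩ := Finset.mem_filter.1 hi
    exact Finset.mem_image.2 ⟨(i, k), Finset.mem_filter.2
      ⟨Finset.mem_offDiag.2 ⟨hiS, hk, hne.symm⟩, hg.symm⟩, rfl⟩
  exact (Finset.card_le_card hsub).trans Finset.card_image_le

end Overload

/-! ### The random measurement matrix -/

section Uniform

open scoped Classical

/-- The law of a random element that is the image of a uniform one. -/
def uniformLaw {Ω X : Type*} [Fintype Ω] [MeasurableSpace X] (A : Ω → X) :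
    MeasureTheory.Measure X :=
  (Fintype.card Ω : ENNReal)⁻¹ • ∑ ω, MeasureTheory.Measure.dirac (A ω)

theorem isProbabilityMeasure_uniformLaw {Ω X : Type*} [Fintype Ω] [Nonempty Ω]
    [MeasurableSpace X] (A : Ω → X) : MeasureTheory.IsProbabilityMeasure (uniformLaw A) := by
  refine ⟨?_⟩
  rw [uniformLaw, MeasureTheory.Measure.smul_apply, MeasureTheory.Measure.finsetSum_apply]
  simp only [MeasureTheory.measure_univ, Finset.sum_const, Finset.card_univ, nsmul_eq_mul,
    mul_one, smul_eq_mul]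
  exact ENNReal.inv_mul_cancel (by exact_mod_cast Fintype.card_ne_zero) (ENNReal.natCast_ne_top _)

/-- For Dirac measures on a space with measurable singletons the value of any set is an indicator,
so the failure event need not be measurable. -/
theorem uniformLaw_apply_le {Ω X : Type*} [Fintype Ω] [Nonempty Ω] [MeasurableSpace X]
    [MeasurableSingletonClass X] (A : Ω → X) {E : Set X} {bad : Ω → Prop}
    (hE : ∀ ω, A ω ∈ E → bad ω) {c : ℝ}
    (hc : ((Finset.univ.filter bad).card : ℝ) ≤ c * Fintype.card Ω) :
    uniformLaw A E ≤ ENNReal.ofReal c := by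
  have hΩ : (0 : ℝ) < Fintype.card Ω := by exact_mod_cast Fintype.card_pos
  rw [uniformLaw, MeasureTheory.Measure.smul_apply, MeasureTheory.Measure.finsetSum_apply]
  have h1 : ∑ ω, MeasureTheory.Measure.dirac (A ω) E ≤
      ((Finset.univ.filter bad).card : ENNReal) := by
    rw [← Finset.sum_boole]
    refine Finset.sum_le_sum fun ω _ => ?_
    rw [MeasureTheory.Measure.dirac_apply, Set.indicator_apply]
    by_cases h : A ω ∈ E
    · simp [h, hE ω h]
    · simp [h]
  rw [smul_eq_mul, mul_comm, ← div_eq_mul_inv]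
  refine ENNReal.div_le_of_le_mul (h1.trans ?_)
  rw [← ENNReal.ofReal_natCast (Fintype.card Ω), ← ENNReal.ofReal_natCast,
    ← ENNReal.ofReal_mul' hΩ.le]
  exact ENNReal.ofReal_le_ofReal hc

theorem card_filter_or_le {A B C : Type*} [Fintype A] [Fintype B] [Fintype C] {P : A → Prop}
    {Q : B → Prop} {R : C → Prop} {c₁ c₂ c₃ : ℝ}
    (h₁ : ((Finset.univ.filter P).card : ℝ) ≤ c₁ * Fintype.card A)
    (h₂ : ((Finset.univ.filter Q).card : ℝ) ≤ c₂ * Fintype.card B)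
    (h₃ : ((Finset.univ.filter R).card : ℝ) ≤ c₃ * Fintype.card C) :
    ((Finset.univ.filter fun ω : A × B × C => P ω.1 ∨ Q ω.2.1 ∨ R ω.2.2).card : ℝ) ≤
      (c₁ + c₂ + c₃) * Fintype.card (A × B × C) := by
  have hsub : (Finset.univ.filter fun ω : A × B × C => P ω.1 ∨ Q ω.2.1 ∨ R ω.2.2) ⊆
      (Finset.univ.filter P ×ˢ Finset.univ) ∪ ((Finset.univ ×ˢ (Finset.univ.filter Q ×ˢ
        Finset.univ)) ∪ (Finset.univ ×ˢ (Finset.univ ×ˢ Finset.univ.filter R))) := by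
    rintro ⟨x, y, z⟩ h
    simpa using h
  have hle := (Finset.card_le_card hsub).trans ((Finset.card_union_le _ _).trans
    (Nat.add_le_add_left (Finset.card_union_le _ _) _))
  simp only [Finset.card_product, Finset.card_univ, Fintype.card_prod] at hle
  have hle' : ((Finset.univ.filter fun ω : A × B × C => P ω.1 ∨ Q ω.2.1 ∨ R ω.2.2).card : ℝ) ≤
      (Finset.univ.filter P).card * (Fintype.card B * Fintype.card C) +
        (Fintype.card A * ((Finset.univ.filter Q).card * Fintype.card C) +
          Fintype.card A * (Fintype.card B * (Finset.univ.filter R).card)) := by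
    exact_mod_cast hle
  refine hle'.trans ?_
  rw [Fintype.card_prod, Fintype.card_prod]
  push_cast
  calc _ ≤ (c₁ * Fintype.card A) * (Fintype.card B * Fintype.card C) +
        (Fintype.card A * ((c₂ * Fintype.card B) * Fintype.card C) +
          Fintype.card A * (Fintype.card B * (c₃ * Fintype.card C))) := by gcongr
    _ = _ := by ring

end Uniform

/-! ### The random choices and their exceptional events -/

section RandomDesign

open scoped Classical

/-- A vector of natural numbers, continued by zero. -/
def extendNat {n : ℕ} (f : Fin n → ℕ) (j : ℕ) : ℕ := if h : j < n then f ⟨j, h⟩ else 0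

theorem extendNat_val {n : ℕ} (f : Fin n → ℕ) (j : Fin n) : extendNat f j = f j := by
  simp [extendNat]

/-- The range of the multipliers. -/
def multipliers (K n a Q : ℕ) : ℕ := (K + 1) * (2 * (Q ^ a + n) + 1) ^ n

/-- The random choices: the multipliers, the groups and labels, and the buckets. -/
abbrev Sample (K n s₀ a Q p : ℕ) : Type :=
  (Fin n → Fin (multipliers K n a Q)) × (Fin n → Fin (parts K s₀) × Fin Q) ×
    (Fin 4 → Fin n → Fin (parts K p))

variable {K n s₀ a Q p : ℕ}

/-- The multiplier of a position. -/
def Sample.mult (ω : Sample K n s₀ a Q p) : ℕ → ℕ := extendNat fun i => (ω.1 i : ℕ) + 1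

/-- The group of a position. -/
def Sample.group (ω : Sample K n s₀ a Q p) : ℕ → ℕ := extendNat fun i => ((ω.2.1 i).1 : ℕ)

/-- The label of a position. -/
def Sample.label (ω : Sample K n s₀ a Q p) : ℕ → ℕ := extendNat fun i => ((ω.2.1 i).2 : ℕ)

/-- The bucket of a position in a table. -/
def Sample.table (ω : Sample K n s₀ a Q p) (t : ℕ) : ℕ → ℕ :=
  if ht : t < 4 then extendNat fun i => (ω.2.2 ⟨t, ht⟩ i : ℕ) else fun _ => 0

/-- The measurement matrix that belongs to the random choices. -/
def Sample.matrix (ω : Sample K n s₀ a Q p) (m : ℕ) : Matrix (Fin m) (Fin n) ℂ :=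
  design (parts K s₀) a (parts K p) ω.mult ω.group ω.label ω.table m n

/-- A relation on the support is encoded by shifting its coefficients by `b`; positions off the
support receive the code `b`, that is the coefficient `0`. -/
theorem generic_of_not_degenerate {b : ℕ} {x : Fin n → ℂ} {ω : Sample K n s₀ a Q p}
    (h : ¬ Degenerate b x ω.1) (c : ℕ → ℤ) (hc : ∀ j ∈ support x, |c j| ≤ b)
    (h0 : ∑ j ∈ support x, (c j : ℂ) * (ω.mult j * extend x j) = 0) :
    ∀ j ∈ support x, c j = 0 := by
  intro j hj
  by_contra hne
  apply h
  have hc' : ∀ k ∈ support x, 0 ≤ c k + b ∧ c k + b ≤ 2 * b := by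
    intro k hk
    have := abs_le.1 (hc k hk)
    omega
  let d : Fin n → Fin (2 * b + 1) := fun k =>
    if hk : (k : ℕ) ∈ support x then ⟨(c k + b).toNat, by have := hc' k hk; omega⟩
    else ⟨b, by omega⟩
  have hd : ∀ k : Fin n, ((d k : ℤ) - b : ℤ) = if (k : ℕ) ∈ support x then c k else 0 := by
    intro k
    by_cases hk : (k : ℕ) ∈ support x
    · have := hc' k hk
      simp only [d, hk, dif_pos, if_pos]
      omega
    · simp [d, hk]
  refine ⟨d, ⟨⟨j, lt_of_mem_support hj⟩, ?_⟩, ?_⟩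
  · rw [hd, if_pos hj, show x ⟨j, lt_of_mem_support hj⟩ = extend x j from
      (extend_val x ⟨j, lt_of_mem_support hj⟩).symm]
    exact mul_ne_zero (Int.cast_ne_zero.2 hne) (mem_support.1 hj)
  · rw [← h0]
    have h1 := sum_mul_eq_sum_support x fun k =>
      ((if k ∈ support x then c k else 0 : ℤ) : ℂ) * ω.mult k
    have h2 : ∑ k ∈ support x, (c k : ℂ) * (ω.mult k * extend x k) =
        ∑ k ∈ support x, ((if k ∈ support x then c k else 0 : ℤ) : ℂ) * ω.mult k *
          extend x k := by
      refine Finset.sum_congr rfl fun k hk => ?_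
      rw [if_pos hk, mul_assoc]
    rw [h2, ← h1]
    refine Finset.sum_congr rfl fun k _ => ?_
    rw [hd, Sample.mult, extendNat_val]
    push_cast
    ring

/-- There are too many collisions of groups, or of groups with labels. -/
def Crowded {G : ℕ} (w : ℕ) (S : Finset (Fin n)) (h : Fin n → Fin G × Fin Q) : Prop :=
  (S.card : ℝ) ^ 2 / Fintype.card (Fin G) + S.card < collisions Prod.fst S h ∨
    (S.card : ℝ) ^ 2 / Fintype.card (Fin G × Fin Q) + S.card / w < collisions id S h

theorem le_mul_parts (K : ℕ) {d : ℕ} (hd : 0 < d) : K ≤ d * parts K d :=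
  (Nat.lt_mul_div_succ K hd).le

theorem parts_mul_le (K d : ℕ) : parts K d * d ≤ K + d := by
  rw [parts, add_mul, one_mul]
  exact Nat.add_le_add_right (Nat.div_mul_le_self K d) d

/-- The sizes of the design: the groups have `a = s₀ + r` measurements for a load of about
`s₀ = p * r`, and the labels are taken from a range of size `Q = s₀ * w`. -/
structure Sizes (s₀ a Q p r w : ℕ) : Prop where
  p_pos : 0 < p
  r_eq : r = 144 * p ^ 2 * (p + 1)
  w_eq : w = 96 * p ^ 2
  s_eq : s₀ = p * r
  a_eq : a = s₀ + r
  Q_eq : Q = s₀ * w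

variable {r w : ℕ}

theorem Sizes.r_pos (hz : Sizes s₀ a Q p r w) : 0 < r := by
  have := hz.p_pos
  rw [hz.r_eq]
  positivity

theorem Sizes.w_pos (hz : Sizes s₀ a Q p r w) : 0 < w := by
  have := hz.p_pos
  rw [hz.w_eq]
  positivity

theorem Sizes.s_pos (hz : Sizes s₀ a Q p r w) : 0 < s₀ := by
  rw [hz.s_eq]
  exact Nat.mul_pos hz.p_pos hz.r_pos

theorem Sizes.Q_pos (hz : Sizes s₀ a Q p r w) : 0 < Q := by
  rw [hz.Q_eq]
  exact Nat.mul_pos hz.s_pos hz.w_pos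

theorem Sizes.a_le_Q (hz : Sizes s₀ a Q p r w) : a ≤ Q := by
  have h1 : r ≤ s₀ := by
    rw [hz.s_eq]
    exact Nat.le_mul_of_pos_left _ hz.p_pos
  have h2 : 2 ≤ w := by
    have : 0 < p ^ 2 := pow_pos hz.p_pos 2
    have := hz.w_eq
    omega
  have h3 : s₀ * 2 ≤ s₀ * w := Nat.mul_le_mul_left _ h2
  rw [hz.a_eq, hz.Q_eq]
  omega

/-- Without too many collisions, few positions are shared or overloaded. -/
theorem card_hard_le (hz : Sizes s₀ a Q p r w) {S : Finset (Fin n)} (hS : S.card = K)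
    (hK : s₀ ^ 2 ≤ K) {h : Fin n → Fin (parts K s₀) × Fin Q} (hcr : ¬ Crowded w S h) :
    (S.filter fun i => (∃ k ∈ S, h k = h i ∧ k ≠ i) ∨
      a < (S.filter fun k => (h k).1 = (h i).1).card).card ≤ K / (24 * p ^ 2) := by
  have hs0 := hz.s_pos
  have hw0 := hz.w_pos
  have hp0 := hz.p_pos
  have hK0 : 0 < K := lt_of_lt_of_le (by positivity) hK
  have hs0' : (0 : ℝ) < s₀ := by exact_mod_cast hs0
  have hw0' : (0 : ℝ) < w := by exact_mod_cast hw0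
  have hp0' : (0 : ℝ) < p := by exact_mod_cast hp0
  have hK0' : (0 : ℝ) < K := by exact_mod_cast hK0
  have hG : 0 < parts K s₀ := Nat.succ_pos _
  have hG' : (0 : ℝ) < parts K s₀ := by exact_mod_cast hG
  have hKG : (K : ℝ) ≤ s₀ * parts K s₀ := by exact_mod_cast le_mul_parts K hs0
  have hQ' : (Q : ℝ) = s₀ * w := by exact_mod_cast hz.Q_eq
  rw [Crowded, not_or, not_lt, not_lt] at hcr
  obtain ⟨hgroups, hcells⟩ := hcr
  rw [hS, Fintype.card_fin] at hgroups
  rw [hS, Fintype.card_prod, Fintype.card_fin, Fintype.card_fin] at hcells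
  have hover := card_overloaded_le S (fun i => (h i).1) (s := s₀) (r := r) (p := p) hz.s_eq ?_ ?_ ?_
  · have hshared := card_shared_le S h
    have hshared' : ((S.filter fun i => ∃ k ∈ S, h k = h i ∧ k ≠ i).card : ℝ) ≤ 2 * K / w := by
      calc _ ≤ (collisions id S h : ℝ) := by exact_mod_cast hshared
        _ ≤ (K : ℝ) ^ 2 / ((parts K s₀ * Q : ℕ) : ℝ) + K / w := hcells
        _ ≤ K / w + K / w := by
          refine add_le_add ?_ le_rfl
          push_cast
          rw [hQ', div_le_div_iff₀ (by positivity) hw0']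
          calc (K : ℝ) ^ 2 * w = K * (K * w) := by ring
            _ ≤ K * ((s₀ * parts K s₀) * w) := by gcongr
            _ = _ := by ring
        _ = _ := by ring
    rw [Nat.le_div_iff_mul_le (by positivity)]
    have hunion : (S.filter fun i => (∃ k ∈ S, h k = h i ∧ k ≠ i) ∨
        a < (S.filter fun k => (h k).1 = (h i).1).card).card ≤
        (S.filter fun i => ∃ k ∈ S, h k = h i ∧ k ≠ i).card +
          (S.filter fun i => s₀ + r < (S.filter fun k => (h k).1 = (h i).1).card).card := by
      rw [Finset.filter_or, hz.a_eq]
      exact Finset.card_union_le _ _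
    set X := (S.filter fun i => ∃ k ∈ S, h k = h i ∧ k ≠ i).card
    set Y := (S.filter fun i => s₀ + r < (S.filter fun k => (h k).1 = (h i).1).card).card
    -- The sizes `w` and `r` are chosen so that `2 K / w` and `3 (p + 1) K / r` both equal `K / (48
    -- p²)`; together they make up the size up to which stopping sets are excluded.
    have hX : (X : ℝ) * (48 * p ^ 2) ≤ K := by
      have hw' : (w : ℝ) = 96 * p ^ 2 := by exact_mod_cast hz.w_eq
      rw [le_div_iff₀ hw0', hw'] at hshared'
      linarith
    have hY : (Y : ℝ) * (48 * p ^ 2) ≤ K := by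
      have hr' : (r : ℝ) = 144 * p ^ 2 * (p + 1) := by exact_mod_cast hz.r_eq
      have hover' : (r : ℝ) * Y ≤ 3 * (p + 1) * S.card := by convert hover
      rw [hr', hS] at hover'
      have hp1 : (0 : ℝ) < 3 * (p + 1) := by positivity
      refine le_of_mul_le_mul_left ?_ hp1
      linarith
    have hXY : (X + Y) * (24 * p ^ 2) ≤ K := by
      have : ((X : ℝ) + Y) * (24 * p ^ 2) ≤ K := by linarith
      exact_mod_cast this
    exact (Nat.mul_le_mul_right _ hunion).trans hXY
  · rw [hS]
    calc _ = (collisions Prod.fst S h : ℝ) := rfl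
      _ ≤ (K : ℝ) ^ 2 / parts K s₀ + K := hgroups
      _ ≤ _ := by
        gcongr
        rw [div_le_iff₀ hG']
        calc (K : ℝ) ^ 2 = K * K := sq _
          _ ≤ K * (s₀ * parts K s₀) := by gcongr
          _ = _ := by ring
  · rw [hS, Fintype.card_fin]
    exact_mod_cast parts_mul_le K s₀
  · rwa [hS]

/-- The decoder succeeds unless the random choices are exceptional. -/
theorem Sample.recovers (hz : Sizes s₀ a Q p r w) {m : ℕ}
    (hm : 6 * (parts K s₀ * (a + 1) + 4 * parts K p) + 5 ≤ m) (hK : s₀ ^ 2 ≤ K)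
    {x : Fin n → ℂ} {S : Finset (Fin n)} (hS : S.card = K) (hxS : ∀ j, x j ≠ 0 → j ∈ S)
    (ω : Sample K n s₀ a Q p) (h₁ : ¬ Degenerate (Q ^ a + n) x ω.1) (h₂ : ¬ Crowded w S ω.2.1)
    (h₃ : ¬ Stuck (K / (24 * p ^ 2)) S ω.2.2) :
    ∃ t, t ≤ timeConst s₀ a Q p * K ∧ RecoversIn (decoder s₀ a Q p) 3 K (ω.matrix m) x t := by
  have hs0 := hz.s_pos
  have hK0 : 0 < K := lt_of_lt_of_le (by positivity) hK
  have hsupp : ∀ j ∈ support x, ∃ i ∈ S, (i : ℕ) = j := by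
    intro j hj
    obtain ⟨i, hi, rfl⟩ := Finset.mem_image.1 hj
    exact ⟨i, hxS i (Finset.mem_filter.1 hi).2, rfl⟩
  have hx : numNonzero x ≤ K := by
    rw [← card_support, ← hS, ← Finset.card_image_of_injective S Fin.val_injective]
    refine Finset.card_le_card fun j hj => ?_
    obtain ⟨i, hi, rfl⟩ := hsupp j hj
    exact Finset.mem_image_of_mem _ hi
  have hhard := card_hard_le hz hS hK h₂
  refine recovers_design hK0 hx hz.a_le_Q hm ?_ ?_ ?_ ?_ ?_ ?_
  · intro j hj
    simp [Sample.mult, extendNat, hj]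
  · intro j hj
    simp [Sample.group, extendNat, hj]
  · intro j hj
    simp [Sample.label, extendNat, hj]
  · intro t ht j hj
    simp [Sample.table, extendNat, hj, ht]
  · intro c hc
    exact generic_of_not_degenerate h₁ c (by exact_mod_cast hc)
  · intro D hD hDne hDhard
    -- The table choices are functions on `Fin n`, so the set is moved there. Hardness passes from
    -- the support to `S`, as a larger set only adds collisions and load.
    set D' : Finset (Fin n) := S.filter fun i => (i : ℕ) ∈ D with hD'
    have hmem : ∀ j ∈ D, ∃ i ∈ D', (i : ℕ) = j := by
      intro j hj
      obtain ⟨i, hi, rfl⟩ := hsupp j (hD hj)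
      exact ⟨i, Finset.mem_filter.2 ⟨hi, hj⟩, rfl⟩
    have hsub : D' ⊆ S.filter fun i => (∃ k ∈ S, ω.2.1 k = ω.2.1 i ∧ k ≠ i) ∨
        a < (S.filter fun k => (ω.2.1 k).1 = (ω.2.1 i).1).card := by
      intro i hi
      obtain ⟨hiS, hiD⟩ := Finset.mem_filter.1 hi
      refine Finset.mem_filter.2 ⟨hiS, ?_⟩
      by_contra hcon
      rw [not_or, not_lt] at hcon
      refine hDhard i hiD ⟨?_, ?_⟩
      · intro k hk hkg hkl
        obtain ⟨k, hkS, rfl⟩ := hsupp k hk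
        by_contra hne
        refine hcon.1 ⟨k, hkS, ?_, fun hki => hne (congrArg Fin.val hki)⟩
        rw [Sample.group, extendNat_val, extendNat_val] at hkg
        rw [Sample.label, extendNat_val, extendNat_val] at hkl
        exact Prod.ext (Fin.ext hkg) (Fin.ext hkl)
      · refine (Finset.card_image_le.trans ?_).trans hcon.2
        rw [← Finset.card_image_of_injective (S.filter _) Fin.val_injective]
        refine Finset.card_le_card fun k hk => ?_
        obtain ⟨hk, hkg⟩ := Finset.mem_filter.1 hk
        obtain ⟨k, hkS, rfl⟩ := hsupp k hk
        rw [Sample.group, extendNat_val, extendNat_val] at hkg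
        exact Finset.mem_image_of_mem _ (Finset.mem_filter.2 ⟨hkS, Fin.ext hkg⟩)
    have hcard := (Finset.card_le_card hsub).trans hhard
    have hns : ∃ t, ¬ NoSingle D' (ω.2.2 t) := by
      by_contra hcon
      push Not at hcon
      obtain ⟨j, hj⟩ := hDne
      obtain ⟨i, hi, -⟩ := hmem j hj
      exact h₃ ⟨D', Finset.filter_subset _ _, ⟨i, hi⟩, hcard, hcon⟩
    obtain ⟨t, ht⟩ := hns
    rw [NoSingle] at ht
    push Not at ht
    obtain ⟨y, hy⟩ := ht
    obtain ⟨i, hi⟩ := Finset.card_eq_one.1 hy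
    have hiff : ∀ k, (k ∈ D' ∧ ω.2.2 t k = y) ↔ k = i := fun k => by
      simpa using Finset.ext_iff.1 hi k
    have hB : 0 < parts K p := Nat.succ_pos _
    have hdiv : (t * parts K p + y : ℕ) / parts K p = t := by
      rw [mul_comm, Nat.mul_add_div hB, Nat.div_eq_of_lt y.2, add_zero]
    have hmod : (t * parts K p + y : ℕ) % parts K p = y := by
      rw [mul_comm, Nat.mul_add_mod, Nat.mod_eq_of_lt y.2]
    refine ⟨t * parts K p + y, ?_, i, ?_⟩
    · have h1 : ((t : ℕ) + 1) * parts K p ≤ 4 * parts K p := Nat.mul_le_mul_right _ t.2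
      have h2 := y.2
      rw [add_mul, one_mul] at h1
      omega
    · rw [hdiv, hmod]
      have htab : ∀ k : Fin n, ω.table t k = ω.2.2 t k := by
        intro k
        rw [Sample.table, dif_pos t.2, extendNat_val]
      ext j
      rw [Finset.mem_filter, Finset.mem_singleton]
      constructor
      · rintro ⟨hj, hjy⟩
        obtain ⟨k, hk, rfl⟩ := hmem j hj
        rw [htab] at hjy
        rw [(hiff k).1 ⟨hk, Fin.ext hjy⟩]
      · rintro rfl
        obtain ⟨hiD', hiy⟩ := (hiff i).2 rfl
        exact ⟨(Finset.mem_filter.1 hiD').2, by rw [htab, hiy]⟩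

/-- The range of the multipliers is `K + 1` times the number of coefficient vectors, so the union
bound leaves a fraction of at most `1 / (K + 1)`. -/
theorem card_degenerate_le (hK : 0 < K) (x : Fin n → ℂ) :
    ((Finset.univ.filter fun u : Fin n → Fin (multipliers K n a Q) =>
      Degenerate (Q ^ a + n) x u).card : ℝ) ≤
      1 / K * Fintype.card (Fin n → Fin (multipliers K n a Q)) := by
  have h1 := card_not_generic (M := multipliers K n a Q) (b := Q ^ a + n) x
  set M := multipliers K n a Q with hM
  have hb : (0 : ℝ) < (2 * ((Q ^ a + n : ℕ) : ℝ) + 1) ^ n := by positivity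
  have hM' : (M : ℝ) = (K + 1) * (2 * ((Q ^ a + n : ℕ) : ℝ) + 1) ^ n := by
    rw [hM, multipliers]
    push_cast
    rfl
  have hK' : (0 : ℝ) < K := by exact_mod_cast hK
  set X : ℝ := ((Finset.univ.filter fun u : Fin n → Fin M => Degenerate (Q ^ a + n) x u).card : ℝ)
    with hX
  have h2 : X * M ≤ (2 * ((Q ^ a + n : ℕ) : ℝ) + 1) ^ n * (M : ℝ) ^ n := h1
  rw [Fintype.card_fun, Fintype.card_fin, Fintype.card_fin, Nat.cast_pow, one_div,
    ← div_eq_inv_mul, le_div_iff₀ hK']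
  have h3 : X * (K + 1) ≤ (M : ℝ) ^ n := by
    refine le_of_mul_le_mul_left ?_ hb
    calc _ = X * ((K + 1) * (2 * ((Q ^ a + n : ℕ) : ℝ) + 1) ^ n) := by ring
      _ = X * M := by rw [hM']
      _ ≤ _ := h2
  have hX0 : 0 ≤ X := Nat.cast_nonneg _
  linarith

/-- Chebyshev's inequality with deviation `K` for groups and `K / w` for groups with labels; `K ≤ s₀
* parts K s₀` turns the two variances into the terms `2 s₀ / K` and `2 w / K`. -/
theorem card_crowded_le (hz : Sizes s₀ a Q p r w) {S : Finset (Fin n)} (hS : S.card = K)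
    (hK : 0 < K) :
    ((Finset.univ.filter fun h : Fin n → Fin (parts K s₀) × Fin Q =>
      Crowded w S h).card : ℝ) ≤
      (2 * s₀ + 2 * w) / K * Fintype.card (Fin n → Fin (parts K s₀) × Fin Q) := by
  have hG : 0 < parts K s₀ := Nat.succ_pos _
  have hs0' : (0 : ℝ) < s₀ := by exact_mod_cast hz.s_pos
  have hw0' : (0 : ℝ) < w := by exact_mod_cast hz.w_pos
  have hQ0' : (0 : ℝ) < Q := by exact_mod_cast hz.Q_pos
  have hK' : (0 : ℝ) < K := by exact_mod_cast hK
  have hG' : (0 : ℝ) < parts K s₀ := by exact_mod_cast hG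
  have hKG : (K : ℝ) ≤ s₀ * parts K s₀ := by exact_mod_cast le_mul_parts K hz.s_pos
  have hQ' : (Q : ℝ) = s₀ * w := by exact_mod_cast hz.Q_eq
  have : Nonempty (Fin (parts K s₀)) := ⟨⟨0, hG⟩⟩
  have : Nonempty (Fin Q) := ⟨⟨0, hz.Q_pos⟩⟩
  set T : ℝ := (Fintype.card (Fin n → Fin (parts K s₀) × Fin Q) : ℝ) with hT
  have hT0 : 0 ≤ T := Nat.cast_nonneg _
  have hfst : ∀ b : Fin (parts K s₀), (Finset.univ.filter fun q : Fin (parts K s₀) × Fin Q =>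
      q.1 = b).card * Fintype.card (Fin (parts K s₀)) =
        Fintype.card (Fin (parts K s₀) × Fin Q) := by
    intro b
    have : (Finset.univ.filter fun q : Fin (parts K s₀) × Fin Q => q.1 = b) =
        {b} ×ˢ Finset.univ := by
      ext ⟨i, j⟩
      simp [eq_comm]
    rw [this, Finset.card_product, Finset.card_singleton, one_mul, Finset.card_univ,
      Fintype.card_prod, mul_comm]
  have hid : ∀ b : Fin (parts K s₀) × Fin Q, (Finset.univ.filter fun q => id q = b).card *
      Fintype.card (Fin (parts K s₀) × Fin Q) = Fintype.card (Fin (parts K s₀) × Fin Q) := by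
    intro b
    have : (Finset.univ.filter fun q : Fin (parts K s₀) × Fin Q => id q = b) = {b} := by
      ext
      simp
    rw [this, Finset.card_singleton, one_mul]
  have h1 := card_collisions_gt (ι := Fin n) (f := Prod.fst)
    (fun b => by convert hfst b) S (τ := (K : ℝ)) hK'
  have h2 := card_collisions_gt (ι := Fin n) (f := id)
    (fun b => by convert hid b) S (τ := (K : ℝ) / w) (by positivity)
  rw [← hT, hS, Fintype.card_fin] at h1
  rw [← hT, hS, Fintype.card_prod, Fintype.card_fin, Fintype.card_fin] at h2
  have hunion : ((Finset.univ.filter fun h : Fin n → Fin (parts K s₀) × Fin Q =>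
      Crowded w S h).card : ℝ) ≤
      ((Finset.univ.filter fun h : Fin n → Fin (parts K s₀) × Fin Q =>
        (K : ℝ) ^ 2 / (parts K s₀ : ℕ) + K < collisions Prod.fst S h).card : ℝ) +
      ((Finset.univ.filter fun h : Fin n → Fin (parts K s₀) × Fin Q =>
        (K : ℝ) ^ 2 / (parts K s₀ * Q : ℕ) + K / w < collisions id S h).card : ℝ) := by
    simp only [Crowded, hS, Fintype.card_prod, Fintype.card_fin]
    rw [Finset.filter_or]
    exact_mod_cast Finset.card_union_le _ _
  refine hunion.trans ?_
  set X : ℝ := ((Finset.univ.filter fun h : Fin n → Fin (parts K s₀) × Fin Q =>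
        (K : ℝ) ^ 2 / (parts K s₀ : ℕ) + K < collisions Prod.fst S h).card : ℝ)
  set Y : ℝ := ((Finset.univ.filter fun h : Fin n → Fin (parts K s₀) × Fin Q =>
        (K : ℝ) ^ 2 / (parts K s₀ * Q : ℕ) + K / w < collisions id S h).card : ℝ)
  have hX : X ≤ 2 * s₀ / K * T := by
    have h3 : X * K ^ 2 ≤ (2 * s₀ / K * T) * K ^ 2 := by
      refine h1.trans ?_
      calc 2 * (K : ℝ) ^ 2 / parts K s₀ * T = 2 * K * (K / parts K s₀) * T := by ring
        _ ≤ 2 * K * s₀ * T := by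
          gcongr
          rwa [div_le_iff₀ hG']
        _ = _ := by field_simp
    exact le_of_mul_le_mul_right h3 (by positivity)
  have hY : Y ≤ 2 * w / K * T := by
    have h3 : Y * (K / w) ^ 2 ≤ (2 * w / K * T) * (K / w) ^ 2 := by
      refine h2.trans ?_
      push_cast
      calc 2 * (K : ℝ) ^ 2 / (parts K s₀ * Q) * T = 2 * (K / w) * (K / (s₀ * parts K s₀)) * T := by
            rw [hQ']
            field_simp
        _ ≤ 2 * (K / w) * 1 * T := by
          gcongr
          rwa [div_le_one (by positivity)]
        _ = _ := by field_simp
    exact le_of_mul_le_mul_right h3 (by positivity)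
  calc X + Y ≤ 2 * s₀ / K * T + 2 * w / K * T := add_le_add hX hY
    _ = _ := by ring

/-- The random choices are not suited to the signal `x` with support in `S`. -/
def Sample.Exceptional (w : ℕ) (x : Fin n → ℂ) (S : Finset (Fin n)) (ω : Sample K n s₀ a Q p) :
    Prop :=
  Degenerate (Q ^ a + n) x ω.1 ∨ Crowded w S ω.2.1 ∨ Stuck (K / (24 * p ^ 2)) S ω.2.2

theorem card_exceptional_le (hz : Sizes s₀ a Q p r w) (x : Fin n → ℂ) {S : Finset (Fin n)}
    (hS : S.card = K) (hK : 0 < K) :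
    ((Finset.univ.filter fun ω : Sample K n s₀ a Q p => ω.Exceptional w x S).card : ℝ) ≤
      (1 + 2 * s₀ + 2 * w + 12 * p ^ 2) / K * Fintype.card (Sample K n s₀ a Q p) := by
  have hp := hz.p_pos
  -- The excluded sets must be no larger than a table, which is what the counting of possible images
  -- needs.
  have h1 : p ≤ 24 * p ^ 2 := by nlinarith
  have h2 : K / (24 * p ^ 2) ≤ K / p := Nat.div_le_div_left h1 hp
  have h3 := card_stopping_le (p := p) (B := parts K p) S (Nat.succ_pos _) (by rwa [hS])
    (by rw [hS]; exact le_mul_parts K hp) (N := K / (24 * p ^ 2)) (h2.trans (Nat.le_succ _))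
    (by rw [hS]; exact Nat.mul_div_le K _)
  have h4 := card_filter_or_le (card_degenerate_le (a := a) (Q := Q) hK x)
    (card_crowded_le hz hS hK) h3
  have h5 : (Finset.univ.filter fun ω : Sample K n s₀ a Q p => ω.Exceptional w x S).card ≤
      (Finset.univ.filter fun ω : Sample K n s₀ a Q p => Degenerate (Q ^ a + n) x ω.1 ∨
        Crowded w S ω.2.1 ∨ Stuck (K / (24 * p ^ 2)) S ω.2.2).card :=
    Finset.card_le_card fun ω hω =>
      Finset.mem_filter.2 ⟨Finset.mem_univ _, (Finset.mem_filter.1 hω).2⟩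
  refine (Nat.cast_le.2 h5).trans (h4.trans_eq ?_)
  rw [hS]
  congr 1
  ring

instance (K n s₀ a Q p : ℕ) [NeZero Q] : Nonempty (Sample K n s₀ a Q p) := by
  have h1 : 0 < multipliers K n a Q := by
    unfold multipliers
    positivity
  have h2 : 0 < parts K s₀ := Nat.succ_pos _
  have h3 : 0 < parts K p := Nat.succ_pos _
  exact ⟨fun _ => ⟨0, h1⟩, fun _ => (⟨0, h2⟩, ⟨0, Nat.pos_of_ne_zero (NeZero.ne Q)⟩),
    fun _ _ => ⟨0, h3⟩⟩

instance (m n : ℕ) : MeasurableSingletonClass (Matrix (Fin m) (Fin n) ℂ) :=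
  inferInstanceAs (MeasurableSingletonClass (Fin m → Fin n → ℂ))

end RandomDesign

section RandomDesign

open scoped Classical

variable {K n s₀ a Q p r w : ℕ}

theorem law_fails_le (hz : Sizes s₀ a Q p r w) [NeZero Q] {m : ℕ}
    (hm : 6 * (parts K s₀ * (a + 1) + 4 * parts K p) + 5 ≤ m) (hK : s₀ ^ 2 ≤ K) (hn : K ≤ n)
    {x : Fin n → ℂ} (hx : numNonzero x ≤ K) :
    uniformLaw (fun ω : Sample K n s₀ a Q p => ω.matrix m)
      {A | ¬ ∃ t : ℕ, t ≤ timeConst s₀ a Q p * K ∧ RecoversIn (decoder s₀ a Q p) 3 K A x t} ≤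
      ENNReal.ofReal ((1 + 2 * s₀ + 2 * w + 12 * p ^ 2) / K) := by
  have hs0 := hz.s_pos
  have hK0 : 0 < K := lt_of_lt_of_le (by positivity) hK
  -- The support is padded to size exactly `K`, so that all counts depend on `K` and not on the
  -- actual sparsity; this is where `K ≤ n` enters.
  obtain ⟨S, hS₁, -, hS⟩ := Finset.exists_subsuperset_card_eq
    (Finset.subset_univ (Finset.univ.filter fun j => x j ≠ 0)) (n := K)
    (by simpa [numNonzero] using hx) (by simpa using hn)
  refine uniformLaw_apply_le _ (bad := fun ω => ω.Exceptional w x S) ?_ ?_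
  · intro ω hω
    rw [Set.mem_ofPred_eq] at hω
    by_contra hcon
    rw [Sample.Exceptional, not_or, not_or] at hcon
    apply hω
    exact (ω.recovers hz hm hK hS (fun j hj => hS₁ (by simpa using hj)) hcon.1 hcon.2.1 hcon.2.2)
  · exact card_exceptional_le hz x hS hK0

end RandomDesign

/-- The number of rows of the design. -/
theorem rows_le {s₀ a Q p r w : ℕ} (hz : Sizes s₀ a Q p r w) {ε : ℝ} (hp : 12 ≤ ε * p) {K : ℕ}
    (hK : 6 * ((s₀ : ℝ) + r + 1) + 31 ≤ 3 * ε * K) :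
    ((6 * (parts K s₀ * (a + 1) + 4 * parts K p) + 5 : ℕ) : ℝ) ≤ 6 * K * (1 + ε) - 2 := by
  have hp0 : (0 : ℝ) < p := by exact_mod_cast hz.p_pos
  have hr0 : (0 : ℝ) < r := by exact_mod_cast hz.r_pos
  have hr1 : (1 : ℝ) ≤ r := by exact_mod_cast hz.r_pos
  have hs0 : (0 : ℝ) < s₀ := by exact_mod_cast hz.s_pos
  have hs : (s₀ : ℝ) = p * r := by exact_mod_cast hz.s_eq
  have ha : (a : ℝ) = s₀ + r := by exact_mod_cast hz.a_eq
  have hG : (parts K s₀ : ℝ) ≤ K / s₀ + 1 := by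
    rw [parts]
    push_cast
    gcongr
    exact Nat.cast_div_le
  have hB : (parts K p : ℝ) ≤ K / p + 1 := by
    rw [parts]
    push_cast
    gcongr
    exact Nat.cast_div_le
  have hKp : (K : ℝ) / s₀ * r = K / p := by
    rw [hs]
    field_simp
  have hKs : (K : ℝ) / s₀ ≤ K / p := by
    refine div_le_div_of_nonneg_left (Nat.cast_nonneg K) hp0 ?_
    rw [hs]
    nlinarith
  have hKε : 12 * ((K : ℝ) / p) ≤ ε * K := by
    rw [mul_div_assoc', div_le_iff₀ hp0]
    nlinarith [mul_le_mul_of_nonneg_right hp (Nat.cast_nonneg (α := ℝ) K)]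
  have h1 : (parts K s₀ : ℝ) * (a + 1) ≤ (K / s₀ + 1) * (a + 1) := by gcongr
  have h2 : ((K : ℝ) / s₀ + 1) * (a + 1) = K + K / p + K / s₀ + (s₀ + r + 1) := by
    rw [ha, ← hKp]
    field_simp
  push_cast
  -- The excess over `6K` is at most `36 K / p ≤ 3 ε K` plus a constant, which the other `3 ε K`
  -- absorbs together with the `2`: `31 = 6 * 4 + 5 + 2`.
  linarith

end

end PhaseRetrieval

/-- For every `ε > 0` there are a program `P`, a constant `T` and random designs of the measurement
matrix with at most `6K(1+ε) - 2` rows, such that every fixed `K`-sparse signal is recovered from the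
magnitudes of its measurements, up to a global phase and within `T * K` steps, with a probability
that tends to `1` as `K → ∞` (uniformly in the signal and its length); and no program can recover a
signal with `K` non-zero components in fewer than `K` steps. -/
theorem mainTheorem3 :
    (∀ ε : ℝ, 0 < ε →
      ∃ (P : PhaseRetrieval.Cmd) (c T : ℕ) (m : ℕ → ℕ)
        (μ : ∀ K n : ℕ, MeasureTheory.Measure (Matrix (Fin (m K)) (Fin n) ℂ)),
        (∀ K : ℕ, 1 ≤ K → (m K : ℝ) ≤ 6 * K * (1 + ε) - 2) ∧
        (∀ K n : ℕ, MeasureTheory.IsProbabilityMeasure (μ K n)) ∧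
        (∀ δ : ℝ, 0 < δ → ∃ K₀ : ℕ, ∀ K : ℕ, K₀ ≤ K → ∀ n : ℕ, K ≤ n →
          ∀ x : Fin n → ℂ, PhaseRetrieval.numNonzero x ≤ K →
            μ K n {A | ¬ ∃ t : ℕ, t ≤ T * K ∧ PhaseRetrieval.RecoversIn P c K A x t}
              ≤ ENNReal.ofReal δ)) ∧
    (∀ (P : PhaseRetrieval.Cmd) (c K m n : ℕ) (A : Matrix (Fin m) (Fin n) ℂ)
      (x : Fin n → ℂ) (t : ℕ), PhaseRetrieval.numNonzero x = K →
        PhaseRetrieval.RecoversIn P c K A x t → K ≤ t) := by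
  refine ⟨fun ε hε => ?_, fun P c K m n A x t hx h => h.le_time hx⟩
  -- Only `12 ≤ ε p` is needed for the number of rows; the summand `1` yields `p > 0`.
  obtain ⟨p, hp⟩ : ∃ p : ℕ, 12 / ε + 1 ≤ p := exists_nat_ge _
  have hp0 : 0 < p := by
    have h1 : (0 : ℝ) < 12 / ε + 1 := by positivity
    exact_mod_cast h1.trans_le hp
  have hpε : 12 ≤ ε * p := by
    have h1 : 12 / ε ≤ p := by linarith
    rwa [div_le_iff₀ hε, mul_comm] at h1
  obtain ⟨r, hr⟩ : ∃ r, r = 144 * p ^ 2 * (p + 1) := ⟨_, rfl⟩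
  obtain ⟨w, hw⟩ : ∃ w, w = 96 * p ^ 2 := ⟨_, rfl⟩
  obtain ⟨s₀, hs⟩ : ∃ s₀, s₀ = p * r := ⟨_, rfl⟩
  obtain ⟨a, ha⟩ : ∃ a, a = s₀ + r := ⟨_, rfl⟩
  obtain ⟨Q, hQ⟩ : ∃ Q, Q = s₀ * w := ⟨_, rfl⟩
  have hz : PhaseRetrieval.Sizes s₀ a Q p r w := ⟨hp0, hr, hw, hs, ha, hQ⟩
  have hQ0 : NeZero Q := ⟨hz.Q_pos.ne'⟩
  refine ⟨PhaseRetrieval.decoder s₀ a Q p, 3, PhaseRetrieval.timeConst s₀ a Q p,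
    -- All rows allowed are used; for large `K` the design fits, and surplus rows are never read.
    fun K => ⌊6 * (K : ℝ) * (1 + ε) - 2⌋₊,
    fun K n => PhaseRetrieval.uniformLaw
      fun ω : PhaseRetrieval.Sample K n s₀ a Q p => ω.matrix ⌊6 * (K : ℝ) * (1 + ε) - 2⌋₊,
    fun K hK => Nat.floor_le ?_, fun K n => PhaseRetrieval.isProbabilityMeasure_uniformLaw _,
    fun δ hδ => ?_⟩
  · have hK' : (1 : ℝ) ≤ K := by exact_mod_cast hK
    nlinarith
  -- `K₁` makes the design fit into the rows, and `K₂` pushes the failure probability below `δ`.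
  · obtain ⟨K₁, hK₁⟩ := exists_nat_ge ((6 * ((s₀ : ℝ) + r + 1) + 31) / (3 * ε))
    obtain ⟨K₂, hK₂⟩ := exists_nat_ge ((1 + 2 * (s₀ : ℝ) + 2 * w + 12 * p ^ 2) / δ)
    refine ⟨max (s₀ ^ 2) (max K₁ K₂), fun K hK n hn x hx => ?_⟩
    simp only [max_le_iff] at hK
    obtain ⟨hK, hKK₁, hKK₂⟩ := hK
    have hs0 := hz.s_pos
    have hK0 : 0 < K := lt_of_lt_of_le (by positivity) hK
    have hK0' : (0 : ℝ) < K := by exact_mod_cast hK0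
    refine (PhaseRetrieval.law_fails_le hz (Nat.le_floor (PhaseRetrieval.rows_le hz hpε ?_)) hK hn
      hx).trans (ENNReal.ofReal_le_ofReal ?_)
    · have h1 : (K₁ : ℝ) ≤ K := by exact_mod_cast hKK₁
      rw [div_le_iff₀ (by positivity)] at hK₁
      nlinarith
    · have h2 : (K₂ : ℝ) ≤ K := by exact_mod_cast hKK₂
      rw [div_le_iff₀ hδ] at hK₂
      rw [div_le_iff₀ hK0']
      nlinarith
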